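/- **Setting.** Let $k$ be a field of characteristic zero, $V=\bigoplus_{i\in\mathbb Z}V_i$ a $\mathbb Z$-graded vector space, $C_\bullet(V)=\bigoplus_{n\ge 1}V^{\otimes n}$ and $C^\bullet(V)=\mathrm{Hom}(C_\bullet(V),V)$. For homogeneous cochains and vectors put $$A\{A_1,\dots,A_r\}(a_1,\dots,a_n)=\sum_{0\le k_1\le\dots\le k_r\le n}(-1)^{\sum_i|A_i|(|a_1|+\dots+|a_{k_i}|)}A(a_1,\dots,a_{k_1},A_1(a_{k_1+1},\dots),\dots,A_r(a_{k_r+1},\dots),\dots,a_n),$$ and $A\circ B=A\{B\}$. For $A\in C^\bullet(V)$ let $L_A$ be the operator on $C_\bullet(V)$ with $$L_A(a_0,\dots,a_n)=\sum(-1)^{|A|(|a_0|+\dots+|a_j|)}(a_0,\dots,a_j,A(a_{j+1},\dots),\dots,a_n)+\sum(-1)^{(|a_0|+\dots+|a_j|)(|a_{j+1}|+\dots+|a_n|)}(A(a_{j+1},\dots,a_n,a_0,\dots),\dots,a_j),$$ the sums being over all possible insertions, with $a_0$ inside $A$ in the second one. Given $m\in C^\bullet(V)$, put $A\cup B=(-1)^{|A|-1}m\{A,B\}$,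 and let $i_A$ be the operator on $C_\bullet(V)$ with $$i_A(a_0,\dots,a_n)=\sum(-1)^{(|a_0|+\dots+|a_j|)(|a_{j+1}|+\dots+|a_n|)+|A|(|a_{j+1}|+\dots+|a_{q}|)}\,(m(a_{j+1},\dots,a_q,A(a_{q+1},\dots),\dots,a_n,a_0,\dots),\dots,a_j),$$ the sum being over all terms with $a_0$ inside $m$ and to the right of $A$. All operations are extended to formal power series in parameters of even degrees. Let $t_1,\dots,t_n$ be formal parameters of even degrees, and write $f_{(i)}=\partial f/\partial t_i$. A family of $A_\infty$-structures is a series $m\in C^\bullet(V)[[t_1,\dots,t_n]]$ of total degree $1$ with $m\circ m=0$. Its Hochschild cycles are the $\alpha\in C_\bullet(V)[[t_1,\dots,t_n]]$ with $L_m\alpha=0$, and its Hochschild cocycles are the $S\in C_\bullet(V)^*[[t_1,\dots,t_n]]$ with $S L_m=0$. Let $m$ be such a family, let $c^{j_1\cdots j_l}\in k[[t_1,\dots,t_n]]$ ($1\le l\le N$, $1\le j_s\le n$), and $$\Psi[m]=\sum_{l=1}^{N}\sum_{j_1,\dots,j_l}c^{j_1\cdots j_l}\,m_{(j_1)}\cup(m_{(j_2)}\cup(\cdots\cup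 m_{(j_l)})),$$ all of whose summands are homogeneous of one degree $p$. Let $t_0$ be a further parameter, of even degree $1-p$, and let $\tilde m\in C^\bullet(V)[[t_0,t_1,\dots,t_n]]$ be the inner deformation of $m$ generated by $\Psi$, that is, $\tilde m_{(0)}=\Psi[\tilde m]$ and $\tilde m|_{t_0=0}=m$. Put $$V^j=\sum_{l=1}^N\sum_{s=1}^{l}\sum_{j_1,\dots,j_{l-1}}c^{j_1\cdots j_{s-1}\,j\,j_s\cdots j_{l-1}}\,i_{\tilde m_{(j_1)}}\cdots i_{\tilde m_{(j_{l-1})}},$$ where $i$ is formed with $\tilde m$ (for symmetric coefficients $V^j=\sum_l\sum_{j_1,\dots,j_{l-1}} l\,c^{j_1\cdots j_{l-1}j}i_{\tilde m_{(j_1)}}\cdots i_{\tilde m_{(j_{l-1})}}$). **Theorem.** $\tilde m$ is a family of $A_\infty$-structures in the parameters $t_0,\dots,t_n$, and the following hold. 1. There is a series $W\in\mathrm{End}(C_\bullet(V))[[t_0,\dots,t_n]]$ of total degree $p-1$ with $$L_{\Psi[\tilde m]}=[L_{\tilde m},W]+\sum_{j=1}^nV^jL_{\tilde m_{(j)}}.$$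 For every such $W$ and every Hochschild cycle $\alpha$ of $C_\bullet(V,m)$, the linear flow $$\tilde\alpha_{(0)}=\sum_{j=1}^nV^j\tilde\alpha_{(j)}-W\tilde\alpha,\qquad\tilde\alpha|_{t_0=0}=\alpha,$$ has a unique solution $\tilde\alpha\in C_\bullet(V)[[t_0,\dots,t_n]]$, and $\tilde\alpha$ is a Hochschild cycle of $C_\bullet(V,\tilde m)$. If $\alpha$ is homogeneous of total degree $q$, then so is $\tilde\alpha$. 2. There is a series $W\in\mathrm{End}(C_\bullet(V))[[t_0,\dots,t_n]]$ of total degree $p-1$ with $$L_{\Psi[\tilde m]}=[L_{\tilde m},W]+\sum_{j=1}^nL_{\tilde m_{(j)}}V^j.$$ For every such $W$ and every Hochschild cocycle $S$ of $C^\bullet(V,m)$, the linear flow $$\tilde S_{(0)}=\sum_{j=1}^n\tilde S_{(j)}V^j+\tilde SW,\qquad\tilde S|_{t_0=0}=S,$$ has a unique solution $\tilde S\in C_\bullet(V)^*[[t_0,\dots,t_n]]$, and $\tilde S$ is a Hochschild cocycle of $C^\bullet(V,\tilde m)$. If $S$ is homogeneous of total degree $q$, then so is $\tilde S$. -/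

import Mathlib

open scoped TensorProduct

noncomputable section

namespace AInf

section Words

variable {k V : Type*} [Field k] [AddCommGroup V] [Module k V]

/-- The word `a₁ ⊗ ⋯ ⊗ aₙ` in the (full) tensor algebra `T(V) = ⨁_{n ≥ 0} V^{⊗n}`. -/
def word (k : Type*) {V : Type*} [Field k] [AddCommGroup V] [Module k V] (l : List V) :
    TensorAlgebra k V :=
  (l.map (TensorAlgebra.ι k)).prod

/-- The space `C_•(V) = ⨁_{n ≥ 1} V^{⊗n}` of Hochschild chains, in the form `V ⊗ T(V)`:
the chain `(a₀, a₁, …, aₙ)` is `a₀ ⊗ (a₁ ⋯ aₙ)`. -/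
abbrev Chain (k V : Type*) [Field k] [AddCommGroup V] [Module k V] : Type _ :=
  V ⊗[k] TensorAlgebra k V

/-- Cochains: linear maps `T(V) → V`. The elements of `C^•(V) = Hom(⨁_{n ≥ 1} V^{⊗n}, V)` are
those which vanish on the empty word, see `IsUncurved`. The component `A_n` is the restriction to
`V^{⊗n}`, so `A (a₁, …, aₙ) = A (word k [a₁, …, aₙ])`. -/
abbrev Cochain (k V : Type*) [Field k] [AddCommGroup V] [Module k V] : Type _ :=
  TensorAlgebra k V →ₗ[k] V

/-- A cochain without component on the empty word. -/
def IsUncurved (A : Cochain k V) : Prop := A 1 = 0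

/-- Step of the recursion for deconcatenation: `(w, x) ↦ (a w, 1 ⊗ a w + (a ⊗ 1) x)`. -/
def deconcStep (k V : Type*) [Field k] [AddCommGroup V] [Module k V] :
    V →ₗ[k] Module.End k
      (TensorAlgebra k V × (TensorAlgebra k V ⊗[k] TensorAlgebra k V)) :=
  LinearMap.mk₂ k
    (fun a x => (TensorAlgebra.ι k a * x.1,
      1 ⊗ₜ[k] (TensorAlgebra.ι k a * x.1) + (TensorAlgebra.ι k a ⊗ₜ[k] 1) * x.2))
    (fun a b x => by
      ext <;> simp [add_mul, TensorProduct.tmul_add, TensorProduct.add_tmul]; abel)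
    (fun c a x => by
      ext
      · simp
      · simp only [map_smul, smul_mul_assoc, TensorProduct.tmul_smul, Prod.smul_mk, smul_add,
          ← TensorProduct.smul_tmul'])
    (fun a x y => by
      ext <;> simp [mul_add, TensorProduct.tmul_add]; abel)
    (fun c a x => by
      ext <;> simp)

/-- Deconcatenation `a₁⋯aₙ ↦ ∑_{i = 0}^{n} (a₁⋯aᵢ) ⊗ (aᵢ₊₁⋯aₙ)`, empty words included
(no signs), see `deconc_word`. -/
def deconc (k V : Type*) [Field k] [AddCommGroup V] [Module k V] :
    TensorAlgebra k V →ₗ[k] TensorAlgebra k V ⊗[k] TensorAlgebra k V :=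
  LinearMap.snd k _ _ ∘ₗ
    (LinearMap.applyₗ ((1 : TensorAlgebra k V), (1 : TensorAlgebra k V) ⊗ₜ[k]
      (1 : TensorAlgebra k V))) ∘ₗ
    (TensorAlgebra.lift k (deconcStep k V)).toLinearMap

theorem deconc_one : deconc k V 1 = 1 ⊗ₜ[k] 1 := by
  simp [deconc]

theorem deconc_cons (a : V) (w : TensorAlgebra k V) :
    deconc k V (TensorAlgebra.ι k a * w) =
      1 ⊗ₜ[k] (TensorAlgebra.ι k a * w) + (TensorAlgebra.ι k a ⊗ₜ[k] 1) * deconc k V w := by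
  have h : ∀ (w : TensorAlgebra k V)
      (x : TensorAlgebra k V × (TensorAlgebra k V ⊗[k] TensorAlgebra k V)),
      (TensorAlgebra.lift k (deconcStep k V) w x).1 = w * x.1 := by
    intro w
    induction w using TensorAlgebra.induction with
    | algebraMap r => intro x; simp [Algebra.smul_def]
    | ι a => intro x; simp [deconcStep]
    | mul a b ha hb => intro x; simp [ha, hb, mul_assoc]
    | add x y hx hy => intro z; simp [hx, hy, add_mul]
  have h' := h w (1, 1 ⊗ₜ[k] 1)
  rw [mul_one] at h'
  simp only [deconc, LinearMap.comp_apply, AlgHom.toLinearMap_apply, map_mul,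
    TensorAlgebra.lift_ι_apply, LinearMap.applyₗ_apply_apply, Module.End.mul_apply,
    LinearMap.snd_apply]
  rw [deconcStep, LinearMap.mk₂_apply, ← deconcStep, h']

theorem deconc_word (l : List V) :
    deconc k V (word k l) =
      ∑ i ∈ Finset.range (l.length + 1), word k (l.take i) ⊗ₜ[k] word k (l.drop i) := by
  induction l with
  | nil => simp [word, deconc_one]
  | cons a l ih =>
    have h : word k (a :: l) = TensorAlgebra.ι k a * word k l := by simp [word]
    rw [h, deconc_cons, ih, List.length_cons, Finset.sum_range_succ' _ (l.length + 1), add_comm,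
      Finset.mul_sum]
    simp [word]

/-- The splittings of a word in three consecutive (possibly empty) pieces. -/
def deconc₃ (k V : Type*) [Field k] [AddCommGroup V] [Module k V] :
    TensorAlgebra k V →ₗ[k]
      TensorAlgebra k V ⊗[k] (TensorAlgebra k V ⊗[k] TensorAlgebra k V) :=
  LinearMap.lTensor _ (deconc k V) ∘ₗ deconc k V

/-- The multiplication `(z, (a, u)) ↦ z ⊗ a ⊗ u`. -/
def glue (k V : Type*) [Field k] [AddCommGroup V] [Module k V] :
    TensorAlgebra k V ⊗[k] Chain k V →ₗ[k] TensorAlgebra k V :=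
  LinearMap.mul' k (TensorAlgebra k V) ∘ₗ
    TensorProduct.map LinearMap.id
      (LinearMap.mul' k (TensorAlgebra k V) ∘ₗ
        TensorProduct.map (TensorAlgebra.ι k) LinearMap.id)

/-- `(z, (a, w)) ↦ ∑ (A(z, a, u), v)`, the sum being over all splittings `w = u v`. -/
def wrap (A : Cochain k V) : TensorAlgebra k V ⊗[k] Chain k V →ₗ[k] Chain k V :=
  LinearMap.rTensor (TensorAlgebra k V) (A ∘ₗ glue k V) ∘ₗ
    (TensorProduct.assoc k (TensorAlgebra k V) (Chain k V) (TensorAlgebra k V)).symm.toLinearMap ∘ₗ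
    LinearMap.lTensor (TensorAlgebra k V)
      ((TensorProduct.assoc k V (TensorAlgebra k V) (TensorAlgebra k V)).symm.toLinearMap ∘ₗ
        LinearMap.lTensor V (deconc k V))

/-- Exchange of two factors with the Koszul sign. Here `f` and `g` are the parity operators
`x ↦ (-1)^{|x|} x` of the two factors, and `(-1)^{st} = (1 + (-1)^s + (-1)^t - (-1)^{s+t}) / 2`,
so that `x ⊗ y ↦ (-1)^{|x||y|} y ⊗ x`, see `koszulSwap_tmul`. -/
def koszulSwap {X Y : Type*} [AddCommGroup X] [Module k X] [AddCommGroup Y] [Module k Y]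
    (f : X →ₗ[k] X) (g : Y →ₗ[k] Y) : X ⊗[k] Y →ₗ[k] Y ⊗[k] X :=
  (TensorProduct.comm k X Y).toLinearMap ∘ₗ
    ((2 : k)⁻¹ • (LinearMap.id + TensorProduct.map f LinearMap.id
      + TensorProduct.map LinearMap.id g - TensorProduct.map f g))

theorem koszulSwap_tmul [CharZero k] {X Y : Type*} [AddCommGroup X] [Module k X]
    [AddCommGroup Y] [Module k Y] (f : X →ₗ[k] X) (g : Y →ₗ[k] Y) (s t : ℤ) (x : X) (y : Y)
    (hx : f x = ((-1 : k) ^ s) • x) (hy : g y = ((-1 : k) ^ t) • y) :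
    koszulSwap f g (x ⊗ₜ[k] y) = ((-1 : k) ^ (s * t)) • (y ⊗ₜ[k] x) := by
  have h2 : (2 : k) ≠ 0 := two_ne_zero
  simp only [koszulSwap, LinearMap.comp_apply, LinearMap.smul_apply, LinearMap.add_apply,
    LinearMap.sub_apply, TensorProduct.map_tmul, hx, hy, LinearMap.id_apply, map_smul, map_add,
    map_sub, LinearEquiv.coe_coe, TensorProduct.comm_tmul, TensorProduct.tmul_smul,
    ← TensorProduct.smul_tmul']
  have hm : ∀ u : ℤ, (-1 : k) ^ (2 * u) = 1 := fun u => by simp [zpow_mul]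
  have hm' : ∀ u : ℤ, (-1 : k) ^ (2 * u + 1) = -1 := fun u => by
    rw [zpow_add₀ (by simp), hm]; simp
  rcases Int.even_or_odd' s with ⟨s, rfl | rfl⟩ <;> rcases Int.even_or_odd' t with ⟨t, rfl | rfl⟩
  · rw [show 2 * s * (2 * t) = 2 * (s * (2 * t)) by ring]
    simp only [hm, one_smul]
    module
  · rw [show 2 * s * (2 * t + 1) = 2 * (s * (2 * t + 1)) by ring]
    simp only [hm, hm', one_smul]
    module
  · rw [show (2 * s + 1) * (2 * t) = 2 * ((2 * s + 1) * t) by ring]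
    simp only [hm, hm', one_smul]
    module
  · rw [show (2 * s + 1) * (2 * t + 1) = 2 * (2 * s * t + s + t) + 1 by ring]
    simp only [hm']
    module

end Words

section Graded

variable {k V : Type*} [Field k] [AddCommGroup V] [Module k V]
variable (𝒱 : ℤ → Submodule k V) [DirectSum.Decomposition 𝒱]

/-- The operator `a ↦ (-1)^{p |a|} a` on `V`. -/
def sgn (p : ℤ) : V →ₗ[k] V :=
  DirectSum.toModule k ℤ V (fun i => ((-1 : k) ^ (p * i)) • (𝒱 i).subtype) ∘ₗ
    (DirectSum.decomposeLinearEquiv 𝒱).toLinearMap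

theorem sgn_of_mem (p i : ℤ) {a : V} (ha : a ∈ 𝒱 i) : sgn 𝒱 p a = ((-1 : k) ^ (p * i)) • a := by
  lift a to 𝒱 i using ha
  simp only [sgn, LinearMap.comp_apply, LinearEquiv.coe_coe, DirectSum.decomposeLinearEquiv_apply,
    DirectSum.decompose_coe]
  rw [← DirectSum.lof_eq_of k, DirectSum.toModule_lof]
  simp

/-- The operator `w ↦ (-1)^{p |w|} w` on `T(V)`, with `|a₁⋯aₙ| = |a₁| + ⋯ + |aₙ|`. -/
def tsgn (p : ℤ) : TensorAlgebra k V →ₐ[k] TensorAlgebra k V :=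
  TensorAlgebra.lift k (TensorAlgebra.ι k ∘ₗ sgn 𝒱 p)

/-- Insertion of a cochain `A` of degree `p` in all places of a word,
`w ↦ ∑_{w = u v z} (-1)^{p |u|} u A(v) z` (the coderivation `D_A`). -/
def coder (p : ℤ) (A : Cochain k V) : TensorAlgebra k V →ₗ[k] TensorAlgebra k V :=
  LinearMap.mul' k (TensorAlgebra k V) ∘ₗ
    TensorProduct.map (tsgn 𝒱 p).toLinearMap
      (LinearMap.mul' k (TensorAlgebra k V) ∘ₗ
        TensorProduct.map (TensorAlgebra.ι k ∘ₗ A) LinearMap.id) ∘ₗ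
    deconc₃ k V

/-- Insertion of `A` (of degree `p`) and, further to the right, of `B` (of degree `q`):
`w ↦ ∑_{w = u v x y z} (-1)^{p |u| + q (|u| + |v| + |x|)} u A(v) x B(y) z`. -/
def coder₂ (p : ℤ) (A : Cochain k V) (q : ℤ) (B : Cochain k V) :
    TensorAlgebra k V →ₗ[k] TensorAlgebra k V :=
  LinearMap.mul' k (TensorAlgebra k V) ∘ₗ
    TensorProduct.map (tsgn 𝒱 (p + q)).toLinearMap
      (LinearMap.mul' k (TensorAlgebra k V) ∘ₗ
        TensorProduct.map (TensorAlgebra.ι k ∘ₗ A ∘ₗ (tsgn 𝒱 q).toLinearMap) (coder 𝒱 q B)) ∘ₗ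
    deconc₃ k V

/-- The composition product `A ∘ B = A{B}`, with `B` of degree `q`. -/
def circ (A : Cochain k V) (q : ℤ) (B : Cochain k V) : Cochain k V :=
  A ∘ₗ coder 𝒱 q B

/-- The brace `A{B, C}`, with `B` of degree `p` and `C` of degree `q`. -/
def brace₂ (A : Cochain k V) (p : ℤ) (B : Cochain k V) (q : ℤ) (C : Cochain k V) : Cochain k V :=
  A ∘ₗ coder₂ 𝒱 p B q C

/-- The cyclic rotations of a chain that move a (possibly empty) final piece `z` to the left of
`a₀`: `(a₀, w) ↦ ∑_{w = w' z} (-1)^{|z| (|a₀| + |w'|)} z ⊗ (a₀, w')`. -/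
def rot : Chain k V →ₗ[k] TensorAlgebra k V ⊗[k] Chain k V :=
  koszulSwap (TensorProduct.map (sgn 𝒱 1) (tsgn 𝒱 1).toLinearMap) (tsgn 𝒱 1).toLinearMap ∘ₗ
    (TensorProduct.assoc k V (TensorAlgebra k V) (TensorAlgebra k V)).symm.toLinearMap ∘ₗ
    LinearMap.lTensor V (deconc k V)

/-- The Lie derivative `L_A` on chains along a cochain `A` of degree `p`:
`A` is inserted in all places of the cyclic word `(a₀, …, aₙ)`. The first summand has the terms
`(a₀, …, A(…), …, aₙ)`, the second one the terms `(A(aⱼ₊₁, …, aₙ, a₀, …), …, aⱼ)`. -/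
def lie (p : ℤ) (A : Cochain k V) : Module.End k (Chain k V) :=
  TensorProduct.map (sgn 𝒱 p) (coder 𝒱 p A) + wrap A ∘ₗ rot 𝒱

/-- The contraction `i_A` on the chains of `(V, m)` by a cochain `A` of degree `p`:
the sum of all terms `± (m(aⱼ₊₁, …, A(…), …, aₙ, a₀, …), …, aⱼ)` with `a₀` inside `m` and to the
right of `A`. The sign is the Koszul sign. -/
def contr (m : Cochain k V) (p : ℤ) (A : Cochain k V) : Module.End k (Chain k V) :=
  wrap m ∘ₗ LinearMap.rTensor (Chain k V) (coder 𝒱 p A) ∘ₗ rot 𝒱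

/-- The degree of a list of homogeneous vectors. -/
def degList (l : List (Σ i : ℤ, 𝒱 i)) : ℤ := (l.map Sigma.fst).sum

/-- The word formed by a list of homogeneous vectors. -/
def homWord (l : List (Σ i : ℤ, 𝒱 i)) : TensorAlgebra k V :=
  word k (l.map fun x => (x.2 : V))

theorem tsgn_homWord (p : ℤ) (l : List (Σ i : ℤ, 𝒱 i)) :
    tsgn 𝒱 p (homWord 𝒱 l) = ((-1 : k) ^ (p * degList 𝒱 l)) • homWord 𝒱 l := by
  induction l with
  | nil => simp [homWord, degList, word]
  | cons a l ih =>
    have h : homWord 𝒱 (a :: l) = TensorAlgebra.ι k (a.2 : V) * homWord 𝒱 l := by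
      simp [homWord, word]
    have h' : degList 𝒱 (a :: l) = a.1 + degList 𝒱 l := by simp [degList]
    rw [h, map_mul, ih, h', mul_add, zpow_add₀ (by simp)]
    simp [tsgn, sgn_of_mem 𝒱 p a.1 a.2.2, smul_smul, mul_comm]

/-- `A` is homogeneous of degree `q` as a map of graded vector spaces. -/
def IsHomCochain (q : ℤ) (A : Cochain k V) : Prop :=
  ∀ l : List (Σ i : ℤ, 𝒱 i), A (homWord 𝒱 l) ∈ 𝒱 (degList 𝒱 l + q)

/-- The chains of degree `q`. -/
def chainDeg (q : ℤ) : Submodule k (Chain k V) :=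
  Submodule.span k {x | ∃ (a : Σ i : ℤ, 𝒱 i) (l : List (Σ i : ℤ, 𝒱 i)),
    a.1 + degList 𝒱 l = q ∧ x = (a.2 : V) ⊗ₜ[k] homWord 𝒱 l}

/-- Operators on chains that are homogeneous of degree `r`. -/
def IsHomOp (r : ℤ) (W : Module.End k (Chain k V)) : Prop :=
  ∀ q : ℤ, ∀ x ∈ chainDeg 𝒱 q, W x ∈ chainDeg 𝒱 (q + r)

/-- Functionals on chains that are homogeneous of degree `q` (`k` sits in degree `0`). -/
def IsHomDual (q : ℤ) (S : Module.Dual k (Chain k V)) : Prop :=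
  ∀ r : ℤ, r + q ≠ 0 → ∀ x ∈ chainDeg 𝒱 r, S x = 0

end Graded

section Series

/-! Formal power series `M[[t₁, …, t_N]]` with coefficients in a vector space `M` are functions
from exponents to `M`; `MvPowerSeries (Fin N) M` is used as this type. -/

variable {N : ℕ}

/-- The degree of the monomial `t^ν` when `tᵢ` has degree `d i`. -/
def wt (d : Fin N → ℤ) (ν : Fin N →₀ ℕ) : ℤ := ∑ i, (ν i : ℤ) * d i

/-- The extension of a bilinear operation to power series (Cauchy product). -/
def conv {X Y Z : Type*} [AddCommMonoid Z] (B : X → Y → Z)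
    (f : MvPowerSeries (Fin N) X) (g : MvPowerSeries (Fin N) Y) : MvPowerSeries (Fin N) Z :=
  fun ν => ∑ e ∈ Finset.HasAntidiagonal.antidiagonal ν, B (f e.1) (g e.2)

/-- The partial derivative `∂f/∂tᵢ`. -/
def pd {M : Type*} [AddCommMonoid M] (i : Fin N) (f : MvPowerSeries (Fin N) M) :
    MvPowerSeries (Fin N) M :=
  fun ν => (ν i + 1) • f (ν + Finsupp.single i 1)

/-- The restriction `f|_{t₀ = 0}`. -/
def atZero {M : Type*} (f : MvPowerSeries (Fin (N + 1)) M) : MvPowerSeries (Fin N) M :=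
  fun ν => f (Finsupp.cons 0 ν)

/-- The inclusion `M[[t₁, …, t_N]] ⊆ M[[t₀, t₁, …, t_N]]`. -/
def incl {M : Type*} [Zero M] (f : MvPowerSeries (Fin N) M) : MvPowerSeries (Fin (N + 1)) M :=
  fun ν => if ν 0 = 0 then f (Finsupp.tail ν) else 0

variable {k V : Type*} [Field k] [AddCommGroup V] [Module k V]
variable (𝒱 : ℤ → Submodule k V) [DirectSum.Decomposition 𝒱]

/-- The Lie derivative along a power series of cochains of total degree `p`. (All parameters
having even degrees, the signs only depend on `p`; the same holds below.) -/
def lieS (p : ℤ) (A : MvPowerSeries (Fin N) (Cochain k V)) :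
    MvPowerSeries (Fin N) (Module.End k (Chain k V)) :=
  fun ν => lie 𝒱 p (A ν)

/-- The contraction `i_A` in the family `m`. -/
def contrS (m : MvPowerSeries (Fin N) (Cochain k V)) (p : ℤ)
    (A : MvPowerSeries (Fin N) (Cochain k V)) :
    MvPowerSeries (Fin N) (Module.End k (Chain k V)) :=
  conv (fun m' A' => contr 𝒱 m' p A') m A

/-- The cup product `A ∪ B = (-1)^{|A| - 1} m{A, B}` in the family `m`, where `|A| = p`
and `|B| = q`. -/
def cupS (m : MvPowerSeries (Fin N) (Cochain k V)) (p : ℤ)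
    (A : MvPowerSeries (Fin N) (Cochain k V)) (q : ℤ)
    (B : MvPowerSeries (Fin N) (Cochain k V)) : MvPowerSeries (Fin N) (Cochain k V) :=
  fun ν => ((-1 : k) ^ (p - 1)) • ∑ e ∈ Finset.HasAntidiagonal.antidiagonal ν, ∑ e' ∈ Finset.HasAntidiagonal.antidiagonal e.2,
    brace₂ 𝒱 (m e.1) p (A e'.1) q (B e'.2)

/-- Families of `A_∞`-structures on `V`: power series `m` in parameters of degrees `d i`, of total
degree `1`, with `m ∘ m = 0`. -/
structure IsAInfFamily (d : Fin N → ℤ) (m : MvPowerSeries (Fin N) (Cochain k V)) : Prop where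
  uncurved : ∀ ν, IsUncurved (m ν)
  degree : ∀ ν, IsHomCochain 𝒱 (1 - wt d ν) (m ν)
  maurerCartan : conv (fun A B => circ 𝒱 A 1 B) m m = 0

/-- `W α` for a power series `W` of operators and a power series `α` of chains. -/
def applyS (W : MvPowerSeries (Fin N) (Module.End k (Chain k V)))
    (α : MvPowerSeries (Fin N) (Chain k V)) : MvPowerSeries (Fin N) (Chain k V) :=
  conv (fun f x => f x) W α

/-- `S W` for a power series `S` of functionals on chains and a power series `W` of operators. -/
def dualS (S : MvPowerSeries (Fin N) (Module.Dual k (Chain k V)))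
    (W : MvPowerSeries (Fin N) (Module.End k (Chain k V))) :
    MvPowerSeries (Fin N) (Module.Dual k (Chain k V)) :=
  conv (fun s f => s ∘ₗ f) S W

/-- Hochschild cycles of `C_•(V, m)`: `∂α = L_m α = 0`. -/
def IsCycle (m : MvPowerSeries (Fin N) (Cochain k V))
    (α : MvPowerSeries (Fin N) (Chain k V)) : Prop :=
  applyS (lieS 𝒱 1 m) α = 0

/-- Hochschild cocycles of the dual complex `C^•(V, m)`: `S ∂ = 0`. -/
def IsCocycle (m : MvPowerSeries (Fin N) (Cochain k V))
    (S : MvPowerSeries (Fin N) (Module.Dual k (Chain k V))) : Prop :=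
  dualS S (lieS 𝒱 1 m) = 0

/-- Power series of chains of total degree `q`. -/
def IsHomChainS (d : Fin N → ℤ) (q : ℤ) (α : MvPowerSeries (Fin N) (Chain k V)) : Prop :=
  ∀ ν, α ν ∈ chainDeg 𝒱 (q - wt d ν)

/-- Power series of functionals of total degree `q`. -/
def IsHomDualS (d : Fin N → ℤ) (q : ℤ)
    (S : MvPowerSeries (Fin N) (Module.Dual k (Chain k V))) : Prop :=
  ∀ ν, IsHomDual 𝒱 (q - wt d ν) (S ν)

/-- Power series of operators of total degree `r`. -/
def IsHomOpS (d : Fin N → ℤ) (r : ℤ)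
    (W : MvPowerSeries (Fin N) (Module.End k (Chain k V))) : Prop :=
  ∀ ν, IsHomOp 𝒱 (r - wt d ν) (W ν)

end Series

section InnerDeformations

variable {k V : Type*} [Field k] [AddCommGroup V] [Module k V]
variable (𝒱 : ℤ → Submodule k V) [DirectSum.Decomposition 𝒱]
variable {n : ℕ} (d : Fin n → ℤ)

/-! Below `m` is a power series in `t₀, t₁, …, tₙ`, the parameter `t_j` with `1 ≤ j ≤ n` being
`j' = Fin.succ j` with `j : Fin n`, and `d j` its degree. -/

/-- The degree of `m_(j₁) ∪ ⋯ ∪ m_(jₗ)`; the cup product has degree `1`. -/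
def cupDeg (J : List (Fin n)) : ℤ := (J.map fun j => 1 - d j).sum + ((J.length : ℤ) - 1)

/-- The cup monomial `m_(j₁) ∪ (m_(j₂) ∪ (⋯ ∪ m_(jₗ)))`, for `l ≥ 1`
(the value at the empty list is not used). -/
def cupMon (m : MvPowerSeries (Fin (n + 1)) (Cochain k V)) :
    List (Fin n) → MvPowerSeries (Fin (n + 1)) (Cochain k V)
  | [] => 0
  | [j] => pd j.succ m
  | j :: j' :: J =>
      cupS 𝒱 m (1 - d j) (pd j.succ m) (cupDeg d (j' :: J)) (cupMon m (j' :: J))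

/-- The cup polynomial `Ψ[m] = ∑_{l = 1}^{L} c^{j₁⋯jₗ} m_(j₁) ∪ ⋯ ∪ m_(jₗ)`. The coefficients
`c^{j₁⋯jₗ} ∈ k[[t₁, …, tₙ]]` of the monomials of length `l + 1` are given by `c l`. -/
def cupPoly (L : ℕ) (c : (l : ℕ) → (Fin (l + 1) → Fin n) → MvPowerSeries (Fin n) k)
    (m : MvPowerSeries (Fin (n + 1)) (Cochain k V)) :
    MvPowerSeries (Fin (n + 1)) (Cochain k V) :=
  ∑ l ∈ Finset.range L, ∑ J : Fin (l + 1) → Fin n,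
    conv (fun (x : k) (A : Cochain k V) => x • A) (incl (c l J)) (cupMon 𝒱 d m (List.ofFn J))

/-- All summands of the cup polynomial are homogeneous of degree `p`. -/
def IsHomPoly (p : ℤ) (L : ℕ)
    (c : (l : ℕ) → (Fin (l + 1) → Fin n) → MvPowerSeries (Fin n) k) : Prop :=
  ∀ l < L, ∀ (J : Fin (l + 1) → Fin n) (ν : Fin n →₀ ℕ), c l J ν ≠ 0 →
    wt d ν + cupDeg d (List.ofFn J) = p

/-- `m'` is the inner deformation of `m` generated by the cup polynomial with coefficients `c`:
`∂m'/∂t₀ = Ψ[m']` and `m'|_{t₀ = 0} = m`. -/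
structure IsInnerDeformation (L : ℕ)
    (c : (l : ℕ) → (Fin (l + 1) → Fin n) → MvPowerSeries (Fin n) k)
    (m : MvPowerSeries (Fin n) (Cochain k V))
    (m' : MvPowerSeries (Fin (n + 1)) (Cochain k V)) : Prop where
  flow : pd 0 m' = cupPoly 𝒱 d L c m'
  initial : atZero m' = m

/-- The operators `V^j = ∑_l ∑_{s = 1}^{l} c^{j₁⋯j_{s-1} j j_s⋯j_{l-1}} i_{m_(j₁)} ⋯ i_{m_(j_{l-1})}`.
For coefficients that are symmetric in their indices this is
`∑_l l c^{j₁⋯j_{l-1} j} i_{m_(j₁)} ⋯ i_{m_(j_{l-1})}`. -/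
def flowV (L : ℕ) (c : (l : ℕ) → (Fin (l + 1) → Fin n) → MvPowerSeries (Fin n) k)
    (m : MvPowerSeries (Fin (n + 1)) (Cochain k V)) (j : Fin n) :
    MvPowerSeries (Fin (n + 1)) (Module.End k (Chain k V)) :=
  ∑ l ∈ Finset.range L, ∑ s : Fin (l + 1), ∑ J : Fin l → Fin n,
    MvPowerSeries.map (algebraMap k (Module.End k (Chain k V)))
        (incl (c l (Fin.insertNth (α := fun _ => Fin n) s j J))) *
      (List.ofFn fun r : Fin l => contrS 𝒱 m (1 - d (J r)) (pd (J r).succ m)).prod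

/-- The operators `W`, of degree `p - 1`, with `L_Ψ = [L_m, W] + ∑_j V^j L_{m_(j)}`. -/
structure IsChainW (p : ℤ) (L : ℕ)
    (c : (l : ℕ) → (Fin (l + 1) → Fin n) → MvPowerSeries (Fin n) k)
    (m : MvPowerSeries (Fin (n + 1)) (Cochain k V))
    (W : MvPowerSeries (Fin (n + 1)) (Module.End k (Chain k V))) : Prop where
  degree : IsHomOpS 𝒱 (Fin.cons (1 - p) d) (p - 1) W
  identity : lieS 𝒱 p (cupPoly 𝒱 d L c m) =
    (lieS 𝒱 1 m * W - W * lieS 𝒱 1 m) +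
      ∑ j : Fin n, flowV 𝒱 d L c m j * lieS 𝒱 (1 - d j) (pd j.succ m)

/-- The operators `W`, of degree `p - 1`, with `L_Ψ = [L_m, W] + ∑_j L_{m_(j)} V^j`. -/
structure IsCochainW (p : ℤ) (L : ℕ)
    (c : (l : ℕ) → (Fin (l + 1) → Fin n) → MvPowerSeries (Fin n) k)
    (m : MvPowerSeries (Fin (n + 1)) (Cochain k V))
    (W : MvPowerSeries (Fin (n + 1)) (Module.End k (Chain k V))) : Prop where
  degree : IsHomOpS 𝒱 (Fin.cons (1 - p) d) (p - 1) W
  identity : lieS 𝒱 p (cupPoly 𝒱 d L c m) =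
    (lieS 𝒱 1 m * W - W * lieS 𝒱 1 m) +
      ∑ j : Fin n, lieS 𝒱 (1 - d j) (pd j.succ m) * flowV 𝒱 d L c m j

/-- The linear flow `∂α/∂t₀ = ∑_j V^j ∂α/∂t_j - W α` on chains. -/
def ChainFlow (L : ℕ) (c : (l : ℕ) → (Fin (l + 1) → Fin n) → MvPowerSeries (Fin n) k)
    (m : MvPowerSeries (Fin (n + 1)) (Cochain k V))
    (W : MvPowerSeries (Fin (n + 1)) (Module.End k (Chain k V)))
    (α : MvPowerSeries (Fin (n + 1)) (Chain k V)) : Prop :=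
  pd 0 α = ∑ j : Fin n, applyS (flowV 𝒱 d L c m j) (pd j.succ α) - applyS W α

/-- The linear flow `∂S/∂t₀ = ∑_j (∂S/∂t_j) V^j + S W` on functionals. -/
def CochainFlow (L : ℕ) (c : (l : ℕ) → (Fin (l + 1) → Fin n) → MvPowerSeries (Fin n) k)
    (m : MvPowerSeries (Fin (n + 1)) (Cochain k V))
    (W : MvPowerSeries (Fin (n + 1)) (Module.End k (Chain k V)))
    (S : MvPowerSeries (Fin (n + 1)) (Module.Dual k (Chain k V))) : Prop :=
  pd 0 S = ∑ j : Fin n, dualS (pd j.succ S) (flowV 𝒱 d L c m j) + dualS S W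

end InnerDeformations

end AInf

end

open AInf

/-! Put `D = L_m̃` and write `∂_j` for `∂/∂t_j`. Since the Lie derivative is linear in the cochain,
`∂_0 D = L_Ψ` and `∂_j D = L_{m̃_(j)}`, so the first identity required of `W` says `∂_0 D = [D, W] +
Σ V^j ∂_j D`. Each `V^j` commutes with `D`. Hence, if `α̃` solves the linear flow, so does `D α̃`.
Its initial value `L_m α` is zero, and solutions of such a flow are determined by their initial
value, so `D α̃ = 0` (`applyS_eq_zero_of_flow`, and `dualS_eq_zero_of_flow` for functionals).
Existence and uniqueness of solutions (`exists_flow`, `flow_unique`) follow by recursion on the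
order in `t₀`: the right hand side up to a given order depends on the unknown only up to that order.

The Maurer-Cartan equation for `m̃` is proved in the same spirit. One has `∂_0 (m̃ ∘ m̃) = [m̃,
Ψ[m̃]]`. The bracket `[m̃, -]` acts on cup products by a Leibniz rule up to terms containing `m̃ ∘
m̃`, and `[m̃, m̃_(j)] = ∂_j (m̃ ∘ m̃)`. Thus the right hand side vanishes to every order in `t₀` to
which `m̃ ∘ m̃` vanishes (`IsInnerDeformation.isAInfFamily`).

What remains is the existence of `W`, a Cartan calculus up to homotopy. For odd cocycles `A`, `B` of
`[m, -]`: (a) `[L_m, i_A] = 0` (`lieS_commute_contrS`); (b) `i_{A ∪ B} = i_A i_B - [L_m, H]`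
(`contrS_braceS`); (c) `L_{A ∪ B} = i_A L_B + L_A i_B + [L_m, K]` (`lieS_braceS`). Differentiating
(a) by `t_i` for `A = m_(j)` shows that `[L_{m_(i)}, i_{m_(j)}]` is a commutator with `L_m`.
Induction on the length of a cup monomial then gives `L_{m_(j₁) ∪ ⋯ ∪ m_(jₗ)} = Σ_s (∏_{r ≠ s}
i_{m_(j_r)}) L_{m_(j_s)} + [L_m, W]` (`exists_lieS_cupMon`), and collecting the terms with `j_s = j`
produces `V^j`. Moving `L_{m_(j)}` to the other side of `V^j` changes `W` by a further homotopy.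

In (a) and (b) the structure `m` occurs twice. These identities are proved for two independent odd
cochains `P`, `Q` and symmetrized, because some terms are antisymmetric in `P` and `Q`; setting `P =
Q = m` then gives twice the desired identity.

The combinatorics rests on one device. Every operator on chains considered here has the form `lam`:
rotate a final piece of the chain in front of `a₀`, then apply an operation on words with a marked
letter. By `rot_comp_lam`, a rotation following such an operator can be replaced by an operation on
marked words following one rotation of the input. Compositions therefore reduce to convolution
calculus for deconcatenation, the signs being carried by parity operators, and the identities hold
term by term. -/

noncomputable section

namespace AInf

/-! ### Sums over the splittings of a list -/

section Splittings

variable {α X Y : Type*} [AddCommMonoid X] [AddCommMonoid Y]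

/-- The sum of `φ u v` over all splittings `l = u ++ v` of a list. -/
def spl : List α → (List α → List α → X) → X
  | [], φ => φ [] []
  | a :: l, φ => φ [] (a :: l) + spl l (fun u v => φ (a :: u) v)

@[simp] theorem spl_nil (φ : List α → List α → X) : spl [] φ = φ [] [] := rfl

theorem spl_cons (a : α) (l : List α) (φ : List α → List α → X) :
    spl (a :: l) φ = φ [] (a :: l) + spl l (fun u v => φ (a :: u) v) := rfl

theorem spl_add (l : List α) (φ ψ : List α → List α → X) :
    spl l (fun u v => φ u v + ψ u v) = spl l φ + spl l ψ := by
  induction l generalizing φ ψ with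
  | nil => rfl
  | cons a l ih => simp only [spl_cons, ih]; abel

theorem spl_zero (l : List α) : spl l (fun _ _ => (0 : X)) = 0 := by
  induction l with
  | nil => rfl
  | cons a l ih => simp [spl_cons, ih]

theorem map_spl {F : Type*} [FunLike F X Y] [AddMonoidHomClass F X Y] (f : F) (l : List α)
    (φ : List α → List α → X) : f (spl l φ) = spl l (fun u v => f (φ u v)) := by
  induction l generalizing φ with
  | nil => rfl
  | cons a l ih => simp only [spl_cons, map_add, ih]

theorem spl_sum {ι : Type*} (s : Finset ι) (l : List α) (φ : ι → List α → List α → X) :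
    spl l (fun u v => ∑ i ∈ s, φ i u v) = ∑ i ∈ s, spl l (φ i) := by
  induction l generalizing φ with
  | nil => rfl
  | cons a l ih => simp only [spl_cons, ih, Finset.sum_add_distrib]

/-- Both sides run over all splittings of `l` in three consecutive pieces. -/
theorem spl_coassoc (l : List α) (φ : List α → List α → List α → X) :
    spl l (fun u v => spl v (φ u)) = spl l (fun w v => spl w (fun x y => φ x y v)) := by
  induction l generalizing φ with
  | nil => rfl
  | cons a l ih =>
    simp only [spl_cons, spl_add, ih, spl_nil]
    abel

theorem spl_comm {β : Type*} (l : List α) (l' : List β)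
    (φ : List α → List α → List β → List β → X) :
    spl l (fun u v => spl l' (φ u v)) = spl l' (fun x y => spl l (fun u v => φ u v x y)) := by
  induction l generalizing φ with
  | nil => rfl
  | cons a l ih => simp only [spl_cons, ih, ← spl_add]

/-- The cut lies either before the letter `a` or after it. -/
theorem spl_append_cons (z : List α) (a : α) (l : List α) (φ : List α → List α → X) :
    spl (z ++ a :: l) φ =
      spl z (fun u v => φ u (v ++ a :: l)) + spl l (fun u v => φ (z ++ a :: u) v) := by
  induction z generalizing φ with
  | nil => simp [spl_cons]
  | cons b z ih => simp only [List.cons_append, spl_cons, ih]; abel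

/-- Only the splitting with an empty first piece contributes. -/
theorem spl_left (l : List α) (φ : List α → List α → X) (h : ∀ a u v, φ (a :: u) v = 0) :
    spl l φ = φ [] l := by
  cases l with
  | nil => rfl
  | cons a l => simp [spl_cons, h, spl_zero]

/-- Only the splitting with an empty last piece contributes. -/
theorem spl_right (l : List α) (φ : List α → List α → X) (h : ∀ u a v, φ u (a :: v) = 0) :
    spl l φ = φ l [] := by
  induction l generalizing φ with
  | nil => rfl
  | cons a l ih => rw [spl_cons, h, zero_add, ih _ fun u b v => h _ _ _]

theorem spl_map {β : Type*} (f : β → α) (l : List β) (φ : List α → List α → X) :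
    spl (l.map f) φ = spl l (fun u v => φ (u.map f) (v.map f)) := by
  induction l generalizing φ with
  | nil => rfl
  | cons a l ih => simp only [List.map_cons, spl_cons, ih, List.map_nil]

theorem spl_congr {l : List α} {φ ψ : List α → List α → X}
    (h : ∀ u v, u ++ v = l → φ u v = ψ u v) : spl l φ = spl l ψ := by
  induction l generalizing φ ψ with
  | nil => exact h _ _ rfl
  | cons a l ih =>
    rw [spl_cons, spl_cons, h [] (a :: l) rfl, ih fun u v e => h _ _ (by simp [e])]

theorem spl_mem {S : Type*} [SetLike S X] [AddSubmonoidClass S X] (s : S) {l : List α}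
    {φ : List α → List α → X} (h : ∀ u v, u ++ v = l → φ u v ∈ s) : spl l φ ∈ s := by
  induction l generalizing φ with
  | nil => exact h _ _ rfl
  | cons a l ih =>
    rw [spl_cons]
    exact add_mem (h _ _ rfl) (ih fun u v e => h _ _ (by simp [e]))

theorem spl_coassoc₂ (l : List α) (φ : List α → List α → List α → List α → X) :
    spl l (fun u v => spl u fun a b => spl v fun c d => φ a b c d) =
      spl l (fun u v => spl u fun w c => spl w fun a b => φ a b c v) := by
  rw [← spl_coassoc (φ := fun u c v => spl u fun a b => φ a b c v)]
  exact spl_congr fun u v _ => spl_comm u v φ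

theorem mul_spl {R : Type*} [NonUnitalNonAssocSemiring R] (r : R) (l : List α)
    (φ : List α → List α → R) : r * spl l φ = spl l fun u v => r * φ u v :=
  map_spl (AddMonoidHom.mulLeft r) l φ

theorem spl_mul {R : Type*} [NonUnitalNonAssocSemiring R] (r : R) (l : List α)
    (φ : List α → List α → R) : spl l φ * r = spl l fun u v => φ u v * r :=
  map_spl (AddMonoidHom.mulRight r) l φ

theorem smul_spl {R : Type*} [DistribSMul R X] (r : R) (l : List α)
    (φ : List α → List α → X) : r • spl l φ = spl l fun u v => r • φ u v :=
  map_spl (DistribSMul.toAddMonoidHom X r) l φ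

theorem tmul_spl {k X Y : Type*} [CommSemiring k] [AddCommMonoid X] [AddCommMonoid Y] [Module k X]
    [Module k Y] (x : X) (l : List α) (φ : List α → List α → Y) :
    x ⊗ₜ[k] spl l φ = spl l fun u v => x ⊗ₜ[k] φ u v :=
  map_spl (TensorProduct.mk k X Y x) l φ

theorem spl_tmul {k X Y : Type*} [CommSemiring k] [AddCommMonoid X] [AddCommMonoid Y] [Module k X]
    [Module k Y] (y : Y) (l : List α) (φ : List α → List α → X) :
    spl l φ ⊗ₜ[k] y = spl l fun u v => φ u v ⊗ₜ[k] y :=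
  map_spl ((TensorProduct.mk k X Y).flip y) l φ

end Splittings

/-! ### Convolution of operators on words, and their coproducts -/

section Convolution

variable {k V : Type*} [Field k] [AddCommGroup V] [Module k V]

local notation "T" => TensorAlgebra k V
local notation "C" => Chain k V

@[simp] theorem word_nil : word k ([] : List V) = 1 := rfl

theorem word_cons (a : V) (l : List V) : word k (a :: l) = TensorAlgebra.ι k a * word k l := by
  simp [word]

theorem word_append (l l' : List V) : word k (l ++ l') = word k l * word k l' := by
  simp [word]

theorem span_words : Submodule.span k (Set.range (word k (V := V))) = ⊤ := by
  rw [eq_top_iff]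
  rintro x -
  induction x using TensorAlgebra.induction with
  | algebraMap r =>
    rw [Algebra.algebraMap_eq_smul_one]
    exact Submodule.smul_mem _ _ (Submodule.subset_span ⟨[], rfl⟩)
  | ι a => exact Submodule.subset_span ⟨[a], by simp [word]⟩
  | mul x y hx hy =>
    have := Submodule.mul_mem_mul hx hy
    rw [Submodule.span_mul_span] at this
    refine Submodule.span_mono ?_ this
    rintro _ ⟨_, ⟨u, rfl⟩, _, ⟨v, rfl⟩, rfl⟩
    exact ⟨u ++ v, word_append u v⟩
  | add x y hx hy => exact add_mem hx hy

theorem ext_word {X : Type*} [AddCommMonoid X] [Module k X] {f g : T →ₗ[k] X}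
    (h : ∀ l, f (word k l) = g (word k l)) : f = g :=
  LinearMap.ext_on span_words (by rintro _ ⟨l, rfl⟩; exact h l)

theorem ext_chain {X : Type*} [AddCommMonoid X] [Module k X] {f g : C →ₗ[k] X}
    (h : ∀ a l, f (a ⊗ₜ word k l) = g (a ⊗ₜ word k l)) : f = g :=
  TensorProduct.ext (LinearMap.ext fun a => ext_word fun l => h a l)

theorem ext_marked {X : Type*} [AddCommMonoid X] [Module k X] {f g : T ⊗[k] C →ₗ[k] X}
    (h : ∀ z a l, f (word k z ⊗ₜ (a ⊗ₜ word k l)) = g (word k z ⊗ₜ (a ⊗ₜ word k l))) : f = g :=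
  TensorProduct.ext (ext_word fun z => ext_chain fun a l => h z a l)

theorem deconc_word_eq (l : List V) :
    deconc k V (word k l) = spl l fun u v => word k u ⊗ₜ[k] word k v := by
  induction l with
  | nil => simp [deconc_one]
  | cons a l ih => simp [word_cons, deconc_cons, ih, spl_cons, mul_spl]

/-- A cut of `x b y` before the letter `b` is a cut of `x`, and a cut after it is a cut of `y`. -/
theorem deconc_mul_ι_mul (x : T) (b : V) (y : T) :
    deconc k V (x * (TensorAlgebra.ι k b * y)) =
      deconc k V x * (1 ⊗ₜ (TensorAlgebra.ι k b * y)) +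
        ((x * TensorAlgebra.ι k b) ⊗ₜ 1) * deconc k V y := by
  have : deconc k V ∘ₗ LinearMap.mulRight k (TensorAlgebra.ι k b * y) =
      LinearMap.mulRight k (1 ⊗ₜ (TensorAlgebra.ι k b * y)) ∘ₗ deconc k V +
      LinearMap.mulRight k (deconc k V y) ∘ₗ (TensorProduct.mk k T T).flip 1 ∘ₗ
        LinearMap.mulRight k (TensorAlgebra.ι k b) := by
    refine ext_word fun l => ?_
    induction l with
    | nil => simp [deconc_one, deconc_cons]
    | cons a l ih =>
      simp only [LinearMap.comp_apply, LinearMap.add_apply, LinearMap.mulRight_apply,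
        LinearMap.flip_apply, TensorProduct.mk_apply] at ih ⊢
      rw [word_cons, mul_assoc, deconc_cons, ih, deconc_cons, mul_add, add_mul, ← mul_assoc,
        ← mul_assoc, ← add_assoc]
      simp [mul_assoc, ← mul_assoc (_ ⊗ₜ[k] (1 : T)) (_ ⊗ₜ[k] (1 : T))]
  exact LinearMap.congr_fun this x

/-- The convolution product of two operators on words. -/
def star (f g : T →ₗ[k] T) : T →ₗ[k] T :=
  LinearMap.mul' k T ∘ₗ TensorProduct.map f g ∘ₗ deconc k V

local infixl:70 "⋆" => star

theorem star_word (f g : T →ₗ[k] T) (l : List V) :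
    (f ⋆ g) (word k l) = spl l fun u v => f (word k u) * g (word k v) := by
  simp [star, deconc_word_eq, map_spl]

theorem star_assoc (f g h : T →ₗ[k] T) : f ⋆ g ⋆ h = f ⋆ (g ⋆ h) := by
  refine ext_word fun l => ?_
  simp only [star_word, mul_spl, spl_mul, spl_coassoc, mul_assoc]

theorem add_star (f f' g : T →ₗ[k] T) : (f + f') ⋆ g = f ⋆ g + f' ⋆ g := by
  simp [star, TensorProduct.map_add_left, LinearMap.comp_add, LinearMap.add_comp]

theorem star_add (f g g' : T →ₗ[k] T) : f ⋆ (g + g') = f ⋆ g + f ⋆ g' := by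
  simp [star, TensorProduct.map_add_right, LinearMap.comp_add, LinearMap.add_comp]

theorem neg_star (f g : T →ₗ[k] T) : (-f) ⋆ g = -(f ⋆ g) := by
  rw [eq_neg_iff_add_eq_zero, ← add_star]; simp [star]

theorem star_neg (f g : T →ₗ[k] T) : f ⋆ (-g) = -(f ⋆ g) := by
  rw [eq_neg_iff_add_eq_zero, ← star_add]; simp [star]

/-- The unit of the convolution product. -/
def unitOp (k V : Type*) [Field k] [AddCommGroup V] [Module k V] :
    TensorAlgebra k V →ₗ[k] TensorAlgebra k V :=
  Algebra.linearMap k _ ∘ₗ (TensorAlgebra.algebraMapInv (R := k) (M := V)).toLinearMap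

@[simp] theorem unitOp_one : unitOp k V 1 = 1 := by simp [unitOp]

@[simp] theorem unitOp_word_cons (a : V) (l : List V) : unitOp k V (word k (a :: l)) = 0 := by
  simp [unitOp, word_cons, TensorAlgebra.algebraMapInv]

theorem unitOp_star (f : T →ₗ[k] T) : unitOp k V ⋆ f = f := by
  refine ext_word fun l => ?_
  rw [star_word, spl_left _ _ (by simp)]; simp

theorem star_unitOp (f : T →ₗ[k] T) : f ⋆ unitOp k V = f := by
  refine ext_word fun l => ?_
  rw [star_word, spl_right _ _ (by simp)]; simp

/-- `Σ xᵢ ⊗ yᵢ` is a coproduct of the operator `g`. -/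
def HasCoprod {ι : Type*} [Fintype ι] (g : T →ₗ[k] T) (x y : ι → T →ₗ[k] T) : Prop :=
  deconc k V ∘ₗ g = ∑ i, TensorProduct.map (x i) (y i) ∘ₗ deconc k V

theorem hasCoprod_id :
    HasCoprod (LinearMap.id : T →ₗ[k] T) (fun _ : Unit => .id) (fun _ => .id) := by
  simp [HasCoprod]

/-- A coproduct of `h` lets `h` pass through deconcatenation, which makes precomposition with `h` a
twisted Leibniz rule for the convolution product. -/
theorem star_comp {ι : Type*} [Fintype ι] {h : T →ₗ[k] T} {x y : ι → T →ₗ[k] T}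
    (H : HasCoprod h x y) (f g : T →ₗ[k] T) :
    (f ⋆ g) ∘ₗ h = ∑ i, (f ∘ₗ x i) ⋆ (g ∘ₗ y i) := by
  simp only [star, LinearMap.comp_assoc]
  rw [H]
  ext x : 1
  simp [TensorProduct.map_comp]

theorem hasCoprod_iff {ι : Type*} [Fintype ι] {g : T →ₗ[k] T} {x y : ι → T →ₗ[k] T} :
    HasCoprod g x y ↔ ∀ l, deconc k V (g (word k l)) =
      spl l fun u v => ∑ i, x i (word k u) ⊗ₜ y i (word k v) := by
  refine ⟨fun h l => ?_, fun h => ext_word fun l => ?_⟩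
  · have := LinearMap.congr_fun h (word k l)
    simpa [deconc_word_eq, map_spl, spl_sum] using this
  · simpa [deconc_word_eq, map_spl, spl_sum] using h l

/-- The coproduct of `f ⋆ A ⋆ g` for a group-like `f`. -/
theorem hasCoprod_star {ι : Type*} [Fintype ι] {f g : T →ₗ[k] T} {x y : ι → T →ₗ[k] T}
    (hf : HasCoprod f (fun _ : Unit => f) (fun _ => f)) (hg : HasCoprod g x y)
    (A : Cochain k V) :
    HasCoprod (f ⋆ ((TensorAlgebra.ι k ∘ₗ A) ⋆ g))
      (fun i : Option ι => i.elim f fun i => f ⋆ ((TensorAlgebra.ι k ∘ₗ A) ⋆ x i))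
      (fun i : Option ι => i.elim (f ⋆ ((TensorAlgebra.ι k ∘ₗ A) ⋆ g)) y) := by
  rw [hasCoprod_iff] at hf hg ⊢
  intro l
  -- A cut of `f(u) A(v) g(w)` to the left of the letter `A(v)` splits `f(u)` and gives the term
  -- `none`; a cut to the right of it splits `g(w)` and gives the terms `some i`.
  simp only [star_word, map_spl, Fintype.sum_option, Option.elim, mul_spl,
    LinearMap.comp_apply, deconc_mul_ι_mul, hf, hg, spl_add, spl_mul, Finset.univ_unique,
    Finset.sum_singleton, Algebra.TensorProduct.tmul_mul_tmul, mul_one, one_mul, Finset.mul_sum,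
    tmul_spl, spl_tmul, spl_sum, spl_coassoc, spl_coassoc₂, mul_assoc]

end Convolution

/-! ### Operations on words with a marked letter -/

section Marked

variable {k V : Type*} [Field k] [AddCommGroup V] [Module k V]

local notation "T" => TensorAlgebra k V
local notation "C" => Chain k V
local infixl:70 "⋆" => star

theorem glue_word (z : List V) (a : V) (l : List V) :
    glue k V (word k z ⊗ₜ (a ⊗ₜ word k l)) = word k (z ++ a :: l) := by
  simp [glue, word_append, word_cons]

/-- The right coaction `(a, w) ↦ ∑ (a, u) ⊗ v`, the sum being over all splittings `w = u v`. -/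
def coact (k V : Type*) [Field k] [AddCommGroup V] [Module k V] :
    Chain k V →ₗ[k] Chain k V ⊗[k] TensorAlgebra k V :=
  (TensorProduct.assoc k V (TensorAlgebra k V) (TensorAlgebra k V)).symm.toLinearMap ∘ₗ
    LinearMap.lTensor V (deconc k V)

theorem coact_word (a : V) (l : List V) :
    coact k V (a ⊗ₜ word k l) = spl l fun u v => (a ⊗ₜ word k u) ⊗ₜ word k v := by
  simp [coact, deconc_word_eq, tmul_spl, map_spl]

/-- `(z, (a, w)) ↦ ∑ (Φ(z, a, u), g(v))`, the sum being over all splittings `w = u v`. -/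
def wrapG (Φ : T ⊗[k] C →ₗ[k] V) (g : T →ₗ[k] T) : T ⊗[k] C →ₗ[k] C :=
  TensorProduct.map Φ g ∘ₗ (TensorProduct.assoc k T C T).symm.toLinearMap ∘ₗ
    LinearMap.lTensor T (coact k V)

theorem wrap_eq_wrapG (A : Cochain k V) : wrap A = wrapG (A ∘ₗ glue k V) .id := rfl

theorem wrapG_word (Φ : T ⊗[k] C →ₗ[k] V) (g : T →ₗ[k] T) (z : T) (a : V) (l : List V) :
    wrapG Φ g (z ⊗ₜ (a ⊗ₜ word k l)) =
      spl l fun u v => Φ (z ⊗ₜ (a ⊗ₜ word k u)) ⊗ₜ g (word k v) := by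
  simp [wrapG, coact_word, map_spl, tmul_spl]

/-- `(z, (a, w)) ↦ ∑ f(x) ⊗ (Φ(y, a, u), g(v))`, the sum being over all splittings
`z = x y` and `w = u v`. -/
def tri (f : T →ₗ[k] T) (Φ : T ⊗[k] C →ₗ[k] V) (g : T →ₗ[k] T) :
    T ⊗[k] C →ₗ[k] T ⊗[k] C :=
  TensorProduct.map f (wrapG Φ g) ∘ₗ (TensorProduct.assoc k T T C).toLinearMap ∘ₗ
    LinearMap.rTensor C (deconc k V)

theorem tri_word (f : T →ₗ[k] T) (Φ : T ⊗[k] C →ₗ[k] V) (g : T →ₗ[k] T) (z : List V) (c : C) :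
    tri f Φ g (word k z ⊗ₜ c) =
      spl z fun x y => f (word k x) ⊗ₜ wrapG Φ g (word k y ⊗ₜ c) := by
  simp [tri, deconc_word_eq, map_spl, spl_tmul]

/-- `(z, (a, w)) ↦ ∑ f(x) Φ(y, a, u) g(v)`, the sum being over all splittings
`z = x y` and `w = u v`. -/
def mon (f : T →ₗ[k] T) (Φ : T ⊗[k] C →ₗ[k] V) (g : T →ₗ[k] T) : T ⊗[k] C →ₗ[k] T :=
  glue k V ∘ₗ tri f Φ g

theorem glue_tmul (f : T) (a : V) (g : T) :
    glue k V (f ⊗ₜ (a ⊗ₜ g)) = f * (TensorAlgebra.ι k a * g) := by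
  simp [glue]

theorem mon_word (f : T →ₗ[k] T) (Φ : T ⊗[k] C →ₗ[k] V) (g : T →ₗ[k] T) (z : List V) (a : V)
    (l : List V) :
    mon f Φ g (word k z ⊗ₜ (a ⊗ₜ word k l)) =
      spl z fun x y => spl l fun u v => f (word k x) *
        (TensorAlgebra.ι k (Φ (word k y ⊗ₜ (a ⊗ₜ word k u))) * g (word k v)) := by
  simp only [mon, LinearMap.comp_apply, tri_word, wrapG_word, tmul_spl, map_spl, glue_tmul]

section Linearity

variable (f f' : TensorAlgebra k V →ₗ[k] TensorAlgebra k V)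
  (Φ Φ' : TensorAlgebra k V ⊗[k] Chain k V →ₗ[k] V)
  (g g' : TensorAlgebra k V →ₗ[k] TensorAlgebra k V)

theorem wrapG_add_left : wrapG (Φ + Φ') g = wrapG Φ g + wrapG Φ' g := by
  simp [wrapG, TensorProduct.map_add_left, LinearMap.add_comp]

theorem wrapG_add_right : wrapG Φ (g + g') = wrapG Φ g + wrapG Φ g' := by
  simp [wrapG, TensorProduct.map_add_right, LinearMap.add_comp]

theorem wrapG_zero_left : wrapG (0 : T ⊗[k] C →ₗ[k] V) g = 0 := by simp [wrapG]

theorem wrapG_neg_left : wrapG (-Φ) g = -wrapG Φ g := by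
  rw [eq_neg_iff_add_eq_zero, ← wrapG_add_left]; simp [wrapG]

theorem wrapG_neg_right : wrapG Φ (-g) = -wrapG Φ g := by
  rw [eq_neg_iff_add_eq_zero, ← wrapG_add_right]; simp [wrapG]

theorem mon_add_left : mon (f + f') Φ g = mon f Φ g + mon f' Φ g := by
  simp [mon, tri, TensorProduct.map_add_left, LinearMap.add_comp, LinearMap.comp_add]

theorem mon_add_mid : mon f (Φ + Φ') g = mon f Φ g + mon f Φ' g := by
  simp [mon, tri, wrapG_add_left, TensorProduct.map_add_right, LinearMap.add_comp,
    LinearMap.comp_add]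

theorem tri_add_left : tri (f + f') Φ g = tri f Φ g + tri f' Φ g := by
  simp [tri, TensorProduct.map_add_left, LinearMap.add_comp]

theorem tri_add_mid : tri f (Φ + Φ') g = tri f Φ g + tri f Φ' g := by
  simp [tri, wrapG_add_left, TensorProduct.map_add_right, LinearMap.add_comp]

theorem tri_neg_left : tri (-f) Φ g = -tri f Φ g := by
  refine LinearMap.ext fun x => ?_
  rw [LinearMap.neg_apply]
  refine eq_neg_of_add_eq_zero_left (a := tri (-f) Φ g x) ?_
  rw [← LinearMap.add_apply, ← tri_add_left]
  simp [tri]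

theorem tri_neg_mid : tri f (-Φ) g = -tri f Φ g := by
  refine LinearMap.ext fun x => ?_
  rw [LinearMap.neg_apply]
  refine eq_neg_of_add_eq_zero_left (a := tri f (-Φ) g x) ?_
  rw [← LinearMap.add_apply, ← tri_add_mid]
  simp [tri, wrapG]

theorem mon_neg_left : mon (-f) Φ g = -mon f Φ g := by
  rw [eq_neg_iff_add_eq_zero, ← mon_add_left]; simp [mon, tri]

theorem mon_neg_mid : mon f (-Φ) g = -mon f Φ g := by
  rw [eq_neg_iff_add_eq_zero, ← mon_add_mid]; simp [mon, tri, wrapG]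

end Linearity

/-- The left action of operators on words on maps of marked words. -/
def lact (f : T →ₗ[k] T) (Ξ : T ⊗[k] C →ₗ[k] T) : T ⊗[k] C →ₗ[k] T :=
  LinearMap.mul' k T ∘ₗ TensorProduct.map f Ξ ∘ₗ (TensorProduct.assoc k T T C).toLinearMap ∘ₗ
    LinearMap.rTensor C (deconc k V)

/-- The right action of operators on words on maps of marked words. -/
def ract (Ξ : T ⊗[k] C →ₗ[k] T) (g : T →ₗ[k] T) : T ⊗[k] C →ₗ[k] T :=
  LinearMap.mul' k T ∘ₗ TensorProduct.map Ξ g ∘ₗ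
    (TensorProduct.assoc k T C T).symm.toLinearMap ∘ₗ LinearMap.lTensor T (coact k V)

theorem lact_word (f : T →ₗ[k] T) (Ξ : T ⊗[k] C →ₗ[k] T) (z : List V) (c : C) :
    lact f Ξ (word k z ⊗ₜ c) = spl z fun x y => f (word k x) * Ξ (word k y ⊗ₜ c) := by
  simp [lact, deconc_word_eq, map_spl, spl_tmul]

theorem ract_word (Ξ : T ⊗[k] C →ₗ[k] T) (g : T →ₗ[k] T) (z : T) (a : V) (l : List V) :
    ract Ξ g (z ⊗ₜ (a ⊗ₜ word k l)) =
      spl l fun u v => Ξ (z ⊗ₜ (a ⊗ₜ word k u)) * g (word k v) := by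
  simp [ract, coact_word, map_spl, tmul_spl]

theorem lact_add (f : T →ₗ[k] T) (Ξ Ξ' : T ⊗[k] C →ₗ[k] T) :
    lact f (Ξ + Ξ') = lact f Ξ + lact f Ξ' := by
  simp [lact, TensorProduct.map_add_right, LinearMap.add_comp, LinearMap.comp_add]

/-- The splittings of `z` made for `h` and for `f` merge by coassociativity. Together with
`ract_mon` and `star_comp_glue` this evaluates iterated convolution products on marked words. -/
theorem lact_mon (h f : T →ₗ[k] T) (Φ : T ⊗[k] C →ₗ[k] V) (g : T →ₗ[k] T) :
    lact h (mon f Φ g) = mon (h ⋆ f) Φ g := by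
  refine ext_marked fun z a l => ?_
  simp only [lact_word, mon_word, star_word, mul_spl, spl_mul, spl_coassoc, mul_assoc]
  refine spl_congr fun u v _ => ?_
  rw [spl_comm]

theorem ract_mon (h f : T →ₗ[k] T) (Φ : T ⊗[k] C →ₗ[k] V) (g : T →ₗ[k] T) :
    ract (mon f Φ g) h = mon f Φ (g ⋆ h) := by
  refine ext_marked fun z a l => ?_
  simp only [ract_word, mon_word, star_word, mul_spl, spl_mul, spl_coassoc, mul_assoc]
  rw [spl_comm]

/-- The marked letter falls in the piece of `g` if the cut is before it, and in the piece of `f`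
otherwise. -/
theorem star_comp_glue (f g : T →ₗ[k] T) :
    (f ⋆ g) ∘ₗ glue k V = lact f (g ∘ₗ glue k V) + ract (f ∘ₗ glue k V) g := by
  refine ext_marked fun z a l => ?_
  simp only [LinearMap.comp_apply, LinearMap.add_apply, lact_word, ract_word, glue_word,
    star_word, spl_append_cons]

/-- The unit of the convolution product vanishes on nonempty words, so only the splitting survives
in which `Φ` takes the whole marked word. -/
theorem ι_comp_eq_mon (Φ : T ⊗[k] C →ₗ[k] V) :
    TensorAlgebra.ι k ∘ₗ Φ = mon (unitOp k V) Φ (unitOp k V) := by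
  refine ext_marked fun z a l => ?_
  rw [mon_word, spl_left _ _ (by simp [spl_zero]), spl_right _ _ (by simp)]
  simp

/-- The map `M → V`, `(z, a, w) ↦ ε(z) ε(w) σ(a)`. -/
def mark (σ : V →ₗ[k] V) : T ⊗[k] C →ₗ[k] V :=
  (TensorProduct.lid k V).toLinearMap ∘ₗ
    TensorProduct.map (TensorAlgebra.algebraMapInv (R := k) (M := V)).toLinearMap
      ((TensorProduct.rid k V).toLinearMap ∘ₗ
        TensorProduct.map σ (TensorAlgebra.algebraMapInv (R := k) (M := V)).toLinearMap)

theorem mark_tmul (σ : V →ₗ[k] V) (z : T) (a : V) (w : T) :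
    mark σ (z ⊗ₜ (a ⊗ₜ w)) =
      TensorAlgebra.algebraMapInv z • TensorAlgebra.algebraMapInv w • σ a := by
  simp only [mark, LinearMap.comp_apply, TensorProduct.map_tmul, LinearEquiv.coe_coe,
    AlgHom.toLinearMap_apply, TensorProduct.rid_tmul, TensorProduct.lid_tmul]

@[simp] theorem counit_word_cons (a : V) (l : List V) :
    (TensorAlgebra.algebraMapInv (R := k)) (word k (a :: l)) = 0 := by
  simp [word_cons, TensorAlgebra.algebraMapInv]

theorem wrapG_mark (σ : V →ₗ[k] V) (g : T →ₗ[k] T) (z : T) (a : V) (w : T) :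
    wrapG (mark σ) g (z ⊗ₜ (a ⊗ₜ w)) = TensorAlgebra.algebraMapInv z • (σ a ⊗ₜ g w) := by
  have : wrapG (mark σ) g = (TensorProduct.lid k C).toLinearMap ∘ₗ
      TensorProduct.map (TensorAlgebra.algebraMapInv (R := k) (M := V)).toLinearMap
        (TensorProduct.map σ g) := by
    refine ext_marked fun z a l => ?_
    rw [wrapG_word, spl_left _ _ (by simp [mark_tmul])]
    simp [mark_tmul, TensorProduct.smul_tmul']
  simp [this]

theorem tri_mark (f : T →ₗ[k] T) (σ : V →ₗ[k] V) (g : T →ₗ[k] T) :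
    tri f (mark σ) g = TensorProduct.map f (TensorProduct.map σ g) := by
  refine ext_marked fun z a l => ?_
  simp only [tri_word, wrapG_mark]
  rw [spl_right _ _ (by simp)]
  simp

/-- `mark σ` tolerates nothing in front of the marked letter. Since `f` preserves the counit, the
piece `x` must be empty, and `Φ` receives all of `z`. -/
theorem wrapG_mark_comp_tri (σ : V →ₗ[k] V) (g' f : T →ₗ[k] T) (Φ : T ⊗[k] C →ₗ[k] V)
    (g : T →ₗ[k] T) (hf : (TensorAlgebra.algebraMapInv (R := k) (M := V)).toLinearMap ∘ₗ f =
      (TensorAlgebra.algebraMapInv (R := k) (M := V)).toLinearMap) :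
    wrapG (mark σ) g' ∘ₗ tri f Φ g = wrapG (σ ∘ₗ Φ) (g' ∘ₗ g) := by
  have hf' : ∀ x, TensorAlgebra.algebraMapInv (f x) = TensorAlgebra.algebraMapInv x :=
    fun x => LinearMap.congr_fun hf x
  refine ext_marked fun z a l => ?_
  simp only [LinearMap.comp_apply, tri_word, wrapG_word, map_spl, tmul_spl, wrapG_mark, hf']
  rw [spl_left _ _ (by simp [spl_zero])]
  simp

theorem wrapG_mark_comp_tri_zero (σ : V →ₗ[k] V) (g' f : T →ₗ[k] T) (Φ : T ⊗[k] C →ₗ[k] V)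
    (g : T →ₗ[k] T)
    (hf : (TensorAlgebra.algebraMapInv (R := k) (M := V)).toLinearMap ∘ₗ f = 0) :
    wrapG (mark σ) g' ∘ₗ tri f Φ g = 0 := by
  have hf' : ∀ x, TensorAlgebra.algebraMapInv (f x) = 0 :=
    fun x => LinearMap.congr_fun hf x
  refine ext_marked fun z a l => ?_
  simp only [LinearMap.comp_apply, tri_word, wrapG_word, map_spl, tmul_spl, wrapG_mark, hf']
  simp [spl_zero]

theorem wrapG_comp_rTensor (Φ : T ⊗[k] C →ₗ[k] V) (g h : T →ₗ[k] T) :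
    wrapG Φ g ∘ₗ LinearMap.rTensor C h = wrapG (Φ ∘ₗ LinearMap.rTensor C h) g := by
  refine ext_marked fun z a l => ?_
  simp [wrapG_word]

theorem rTensor_comp_tri (h f : T →ₗ[k] T) (Φ : T ⊗[k] C →ₗ[k] V) (g : T →ₗ[k] T) :
    LinearMap.rTensor C h ∘ₗ tri f Φ g = tri (h ∘ₗ f) Φ g := by
  refine ext_marked fun z a l => ?_
  simp [tri_word, map_spl]

/-- `h` acts on the word in front of the marked letter, which `tri` splits; the coproduct of `h`
distributes it over the two pieces. -/
theorem tri_comp_rTensor {ι : Type*} [Fintype ι] {h : T →ₗ[k] T} {x y : ι → T →ₗ[k] T}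
    (H : HasCoprod h x y) (f : T →ₗ[k] T) (Φ : T ⊗[k] C →ₗ[k] V) (g : T →ₗ[k] T) :
    tri f Φ g ∘ₗ LinearMap.rTensor C h =
      ∑ i, tri (f ∘ₗ x i) (Φ ∘ₗ LinearMap.rTensor C (y i)) g := by
  rw [hasCoprod_iff] at H
  refine ext_marked fun z a l => ?_
  simp only [LinearMap.comp_apply, LinearMap.sum_apply, tri_word, LinearMap.rTensor_tmul,
    ← wrapG_comp_rTensor, ← spl_sum]
  simp [tri, H, map_spl, spl_tmul, TensorProduct.sum_tmul]

theorem mon_comp_rTensor {ι : Type*} [Fintype ι] {h : T →ₗ[k] T} {x y : ι → T →ₗ[k] T}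
    (H : HasCoprod h x y) (f : T →ₗ[k] T) (Φ : T ⊗[k] C →ₗ[k] V) (g : T →ₗ[k] T) :
    mon f Φ g ∘ₗ LinearMap.rTensor C h =
      ∑ i, mon (f ∘ₗ x i) (Φ ∘ₗ LinearMap.rTensor C (y i)) g := by
  refine LinearMap.ext fun x => ?_
  have := LinearMap.congr_fun (tri_comp_rTensor H f Φ g) x
  simp only [LinearMap.comp_apply, LinearMap.sum_apply] at this
  simp [mon, this]

theorem coact_comp_wrapG {ι : Type*} [Fintype ι] {g : T →ₗ[k] T} {x y : ι → T →ₗ[k] T}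
    (H : HasCoprod g x y) (Φ : T ⊗[k] C →ₗ[k] V) :
    coact k V ∘ₗ wrapG Φ g = ∑ i, TensorProduct.map (wrapG Φ (x i)) (y i) ∘ₗ
      (TensorProduct.assoc k T C T).symm.toLinearMap ∘ₗ LinearMap.lTensor T (coact k V) := by
  rw [hasCoprod_iff] at H
  refine ext_marked fun z a l => ?_
  have hc : ∀ (a : V) l, coact k V (a ⊗ₜ g (word k l)) =
      ∑ i, spl l fun u v => (a ⊗ₜ x i (word k u)) ⊗ₜ y i (word k v) := fun a l => by
    simp [coact, H, tmul_spl, map_spl, TensorProduct.tmul_sum, spl_sum]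
  simp only [LinearMap.comp_apply, LinearMap.sum_apply, wrapG_word, map_spl, coact_word, tmul_spl,
    spl_tmul, hc, spl_coassoc, spl_sum, LinearMap.lTensor_tmul, LinearEquiv.coe_coe,
    TensorProduct.assoc_symm_tmul, TensorProduct.map_tmul]

/-- `A` takes all of `f(x)`, the new marked letter and an initial piece of `g(v)`; the coproduct of
`g` describes this piece together with the remaining one. -/
theorem wrapG_glue_comp_tri {ι : Type*} [Fintype ι] {g : T →ₗ[k] T} {x y : ι → T →ₗ[k] T}
    (H : HasCoprod g x y) (A : Cochain k V) (g' f : T →ₗ[k] T) (Φ : T ⊗[k] C →ₗ[k] V) :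
    wrapG (A ∘ₗ glue k V) g' ∘ₗ tri f Φ g = ∑ i, wrapG (A ∘ₗ mon f Φ (x i)) (g' ∘ₗ y i) := by
  have hc : ∀ z a l, coact k V (wrapG Φ g (word k z ⊗ₜ (a ⊗ₜ word k l))) =
      ∑ i, spl l fun u v => spl u fun u w =>
        (Φ (word k z ⊗ₜ (a ⊗ₜ word k u)) ⊗ₜ x i (word k w)) ⊗ₜ y i (word k v) := fun z a l => by
    refine (LinearMap.congr_fun (coact_comp_wrapG H Φ) _).trans ?_
    simp only [LinearMap.comp_apply, LinearMap.sum_apply, LinearMap.lTensor_tmul,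
      LinearEquiv.coe_coe, coact_word, tmul_spl, map_spl, TensorProduct.assoc_symm_tmul,
      TensorProduct.map_tmul, wrapG_word, spl_tmul]
  refine ext_marked fun z a l => ?_
  simp only [LinearMap.comp_apply, LinearMap.sum_apply, tri_word, map_spl]
  simp only [wrapG_word _ (g' ∘ₗ _)]
  rw [wrapG]
  simp only [LinearMap.comp_apply, LinearMap.lTensor_tmul, hc, LinearEquiv.coe_coe,
    tmul_spl, map_spl, TensorProduct.assoc_symm_tmul, TensorProduct.map_tmul, spl_tmul,
    TensorProduct.tmul_sum, map_sum, spl_sum, glue_tmul, mon_word]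
  simp only [spl_comm z]

end Marked

/-! ### Homogeneous words, parity operators and Koszul signs of rotations -/

section Signs

variable {k V : Type*} [Field k] [AddCommGroup V] [Module k V]
variable (𝒱 : ℤ → Submodule k V) [DirectSum.Decomposition 𝒱]

local notation "T" => TensorAlgebra k V
local notation "C" => Chain k V
local infixl:70 "⋆" => star

theorem ext_hom {X : Type*} [AddCommMonoid X] [Module k X] {f g : V →ₗ[k] X}
    (h : ∀ i, ∀ a ∈ 𝒱 i, f a = g a) : f = g := by
  refine LinearMap.ext fun a => ?_
  induction a using DirectSum.Decomposition.inductionOn 𝒱 with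
  | zero => simp
  | homogeneous a => exact h _ _ a.2
  | add a b ha hb => simp [ha, hb]

theorem span_homWord : Submodule.span k (Set.range (homWord 𝒱)) = ⊤ := by
  have key : ∀ a : V, ∀ x ∈ Submodule.span k (Set.range (homWord 𝒱)),
      TensorAlgebra.ι k a * x ∈ Submodule.span k (Set.range (homWord 𝒱)) := by
    intro a x hx
    induction hx using Submodule.span_induction with
    | zero => simp
    | add x y _ _ hx hy => rw [mul_add]; exact add_mem hx hy
    | smul c x _ hx => rw [mul_smul_comm]; exact Submodule.smul_mem _ _ hx
    | mem x hx =>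
      obtain ⟨l, rfl⟩ := hx
      induction a using DirectSum.Decomposition.inductionOn 𝒱 with
      | zero => simp
      | @homogeneous i a => exact Submodule.subset_span ⟨⟨i, a⟩ :: l, by simp [homWord, word_cons]⟩
      | add a b ha hb => rw [map_add, add_mul]; exact add_mem ha hb
  rw [← top_le_iff, ← span_words, Submodule.span_le]
  rintro _ ⟨l, rfl⟩
  induction l with
  | nil => exact Submodule.subset_span ⟨[], rfl⟩
  | cons a l ih => rw [word_cons]; exact key _ _ ih

theorem ext_homWord {X : Type*} [AddCommMonoid X] [Module k X] {f g : T →ₗ[k] X}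
    (h : ∀ l, f (homWord 𝒱 l) = g (homWord 𝒱 l)) : f = g :=
  LinearMap.ext_on (span_homWord 𝒱) (by rintro _ ⟨l, rfl⟩; exact h l)

theorem ext_homChain {X : Type*} [AddCommMonoid X] [Module k X] {f g : C →ₗ[k] X}
    (h : ∀ i, ∀ a ∈ 𝒱 i, ∀ l, f (a ⊗ₜ homWord 𝒱 l) = g (a ⊗ₜ homWord 𝒱 l)) : f = g :=
  TensorProduct.ext (ext_hom 𝒱 fun i a ha => ext_homWord 𝒱 fun l => h i a ha l)

omit [DirectSum.Decomposition 𝒱] in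
theorem homWord_append (l l' : List (Σ i : ℤ, 𝒱 i)) :
    homWord 𝒱 (l ++ l') = homWord 𝒱 l * homWord 𝒱 l' := by
  simp [homWord, word_append]

omit [DirectSum.Decomposition 𝒱] in
theorem degList_append (l l' : List (Σ i : ℤ, 𝒱 i)) :
    degList 𝒱 (l ++ l') = degList 𝒱 l + degList 𝒱 l' := by
  simp [degList]

omit [DirectSum.Decomposition 𝒱] in
theorem deconc_homWord (l : List (Σ i : ℤ, 𝒱 i)) :
    deconc k V (homWord 𝒱 l) = spl l fun u v => homWord 𝒱 u ⊗ₜ[k] homWord 𝒱 v := by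
  simp only [homWord, deconc_word_eq, spl_map]

omit [DirectSum.Decomposition 𝒱] in
theorem coact_homWord (a : V) (l : List (Σ i : ℤ, 𝒱 i)) :
    coact k V (a ⊗ₜ homWord 𝒱 l) =
      spl l fun u v => (a ⊗ₜ homWord 𝒱 u) ⊗ₜ homWord 𝒱 v := by
  simp only [homWord, coact_word, spl_map]

theorem sgn_comp_sgn (p q : ℤ) : sgn 𝒱 p ∘ₗ sgn 𝒱 q = sgn 𝒱 (p + q) :=
  ext_hom 𝒱 fun i a ha => by
    rw [LinearMap.comp_apply, sgn_of_mem 𝒱 _ i ha, sgn_of_mem 𝒱 _ i ha, map_smul,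
      sgn_of_mem 𝒱 _ i ha, smul_smul, add_mul, zpow_add₀ (by simp), mul_comm]

theorem tsgn_comp_tsgn (p q : ℤ) :
    (tsgn 𝒱 p).toLinearMap ∘ₗ (tsgn 𝒱 q).toLinearMap = (tsgn 𝒱 (p + q)).toLinearMap :=
  ext_homWord 𝒱 fun l => by
    simp only [LinearMap.comp_apply, AlgHom.toLinearMap_apply, tsgn_homWord, map_smul, smul_smul,
      add_mul]
    rw [zpow_add₀ (by simp), mul_comm]

theorem neg_one_zpow_mul_of_even {p : ℤ} (hp : Even p) (i : ℤ) : (-1 : k) ^ (p * i) = 1 :=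
  (hp.mul_right i).neg_one_zpow

theorem neg_one_zpow_mul_of_odd {p : ℤ} (hp : Odd p) (i : ℤ) :
    (-1 : k) ^ (p * i) = (-1) ^ (1 * i) := by
  obtain ⟨r, rfl⟩ := hp
  rw [add_mul, zpow_add₀ (by simp), neg_one_zpow_mul_of_even (even_two_mul r), one_mul]

theorem sgn_even {p : ℤ} (hp : Even p) : sgn 𝒱 p = .id :=
  ext_hom 𝒱 fun i a ha => by simp [sgn_of_mem 𝒱 p i ha, neg_one_zpow_mul_of_even hp]

theorem sgn_odd {p : ℤ} (hp : Odd p) : sgn 𝒱 p = sgn 𝒱 1 :=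
  ext_hom 𝒱 fun i a ha => by simp [sgn_of_mem 𝒱 _ i ha, neg_one_zpow_mul_of_odd hp]

theorem tsgn_even {p : ℤ} (hp : Even p) : (tsgn 𝒱 p).toLinearMap = .id :=
  ext_homWord 𝒱 fun l => by simp [tsgn_homWord, neg_one_zpow_mul_of_even hp]

theorem tsgn_odd {p : ℤ} (hp : Odd p) : (tsgn 𝒱 p).toLinearMap = (tsgn 𝒱 1).toLinearMap :=
  ext_homWord 𝒱 fun l => by simp [tsgn_homWord, neg_one_zpow_mul_of_odd hp]

/-- The parity operator `w ↦ (-1)^{|w|} w` on words. -/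
abbrev par : T →ₗ[k] T := (tsgn 𝒱 1).toLinearMap

/-- The parity operator on chains. -/
def parC : C →ₗ[k] C := TensorProduct.map (sgn 𝒱 1) (par 𝒱)

/-- The parity operator on marked words. -/
def parM : T ⊗[k] C →ₗ[k] T ⊗[k] C := TensorProduct.map (par 𝒱) (parC 𝒱)

theorem sgn_sgn : sgn 𝒱 1 ∘ₗ sgn 𝒱 1 = .id := by
  rw [sgn_comp_sgn, sgn_even 𝒱 (by decide)]

theorem par_par : par 𝒱 ∘ₗ par 𝒱 = .id := by
  rw [par, tsgn_comp_tsgn, tsgn_even 𝒱 (by decide)]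

theorem parC_parC : parC 𝒱 ∘ₗ parC 𝒱 = .id := by
  rw [parC, ← TensorProduct.map_comp, sgn_sgn, par_par, TensorProduct.map_id]

theorem parM_parM : parM 𝒱 ∘ₗ parM 𝒱 = .id := by
  rw [parM, ← TensorProduct.map_comp, parC_parC, par_par, TensorProduct.map_id]

theorem tsgn_word (p : ℤ) (l : List V) :
    tsgn 𝒱 p (word k l) = word k (l.map (sgn 𝒱 p)) := by
  induction l with
  | nil => simp
  | cons a l ih => rw [word_cons, map_mul, ih, List.map_cons, word_cons]; simp [tsgn]

theorem hasCoprod_tsgn (p : ℤ) : HasCoprod (tsgn 𝒱 p).toLinearMap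
    (fun _ : Unit => (tsgn 𝒱 p).toLinearMap) (fun _ => (tsgn 𝒱 p).toLinearMap) := by
  rw [hasCoprod_iff]
  intro l
  simp [tsgn_word, deconc_word_eq, spl_map]

theorem star_par (f g : T →ₗ[k] T) :
    (f ⋆ g) ∘ₗ par 𝒱 = (f ∘ₗ par 𝒱) ⋆ (g ∘ₗ par 𝒱) := by
  simpa using star_comp (hasCoprod_tsgn 𝒱 1) f g

theorem par_star (f g : T →ₗ[k] T) :
    par 𝒱 ∘ₗ (f ⋆ g) = (par 𝒱 ∘ₗ f) ⋆ (par 𝒱 ∘ₗ g) := by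
  refine ext_word fun l => ?_
  simp [star_word, map_spl]

theorem par_ι : par 𝒱 ∘ₗ TensorAlgebra.ι k = TensorAlgebra.ι k ∘ₗ sgn 𝒱 1 := by
  ext a; simp [par, tsgn]

theorem counit_tsgn (p : ℤ) :
    (TensorAlgebra.algebraMapInv (R := k) (M := V)).toLinearMap ∘ₗ (tsgn 𝒱 p).toLinearMap =
      (TensorAlgebra.algebraMapInv (R := k) (M := V)).toLinearMap := by
  refine ext_word fun l => ?_
  cases l <;> simp [tsgn_word]

/-- Every word produced contains the letter made by `A`, so it is not empty. -/
theorem counit_star_ι_star (f g : T →ₗ[k] T) (A : Cochain k V) :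
    (TensorAlgebra.algebraMapInv (R := k) (M := V)).toLinearMap ∘ₗ
      (f ⋆ ((TensorAlgebra.ι k ∘ₗ A) ⋆ g)) = 0 := by
  refine ext_word fun l => ?_
  simp [star_word, map_spl, TensorAlgebra.algebraMapInv, spl_zero]

theorem tsgn_comp_glue (p : ℤ) : (tsgn 𝒱 p).toLinearMap ∘ₗ glue k V =
    mon (tsgn 𝒱 p).toLinearMap (mark (sgn 𝒱 p)) (tsgn 𝒱 p).toLinearMap := by
  refine ext_marked fun z a l => ?_
  simp [mon, tri_mark, glue_tmul, tsgn]

theorem id_comp_glue : (LinearMap.id : T →ₗ[k] T) ∘ₗ glue k V = mon .id (mark .id) .id := by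
  refine ext_marked fun z a l => ?_
  simp [mon, tri_mark]

theorem glue_comp_parM : glue k V ∘ₗ parM 𝒱 = par 𝒱 ∘ₗ glue k V := by
  rw [par, tsgn_comp_glue, mon, tri_mark]; rfl

theorem parC_comp_wrapG {Φ : T ⊗[k] C →ₗ[k] V} {g : T →ₗ[k] T} {φ γ : ℕ}
    (hΦ : sgn 𝒱 1 ∘ₗ Φ = (-1 : k) ^ φ • (Φ ∘ₗ parM 𝒱))
    (hg : par 𝒱 ∘ₗ g = (-1 : k) ^ γ • (g ∘ₗ par 𝒱)) :
    parC 𝒱 ∘ₗ wrapG Φ g = (-1 : k) ^ (φ + γ) • (wrapG Φ g ∘ₗ parM 𝒱) := by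
  have hg' : ∀ x, tsgn 𝒱 1 (g x) = (-1 : k) ^ γ • g (tsgn 𝒱 1 x) := LinearMap.congr_fun hg
  have hΦ' : ∀ x, sgn 𝒱 1 (Φ x) = (-1 : k) ^ φ • Φ (parM 𝒱 x) := LinearMap.congr_fun hΦ
  refine ext_marked fun z a l => ?_
  rw [LinearMap.comp_apply, LinearMap.smul_apply, LinearMap.comp_apply]
  simp [parC, parM, wrapG_word, map_spl, tsgn_word, spl_map, hΦ', hg', smul_smul, pow_add,
    ← TensorProduct.smul_tmul', smul_spl, mul_comm]

theorem wrapG_comp_parM (Φ : T ⊗[k] C →ₗ[k] V) (g : T →ₗ[k] T) :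
    wrapG Φ g ∘ₗ parM 𝒱 = wrapG (Φ ∘ₗ parM 𝒱) (g ∘ₗ par 𝒱) := by
  refine ext_marked fun z a l => ?_
  simp [parC, parM, wrapG_word, tsgn_word, spl_map]

/-- The hypotheses `hP` and `hQ` say that `P` and `Q` have parities `π` and `ϖ`. By the Koszul rule,
`P` passes the second factor with the sign `g' ^ π`, `Q` passes the first one with the sign `f' ^
ϖ`, and they pass each other with `(-1)^(π ϖ)`. -/
theorem koszulSwap_comp_map [CharZero k] {X Y X' Y' : Type*} [AddCommGroup X] [Module k X] [AddCommGroup Y]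
    [Module k Y] [AddCommGroup X'] [Module k X'] [AddCommGroup Y'] [Module k Y']
    {P : X' →ₗ[k] X} {Q : Y' →ₗ[k] Y} {f : X →ₗ[k] X} {g : Y →ₗ[k] Y}
    {f' : Module.End k X'} {g' : Module.End k Y'} {π ϖ : ℕ}
    (hf' : f' * f' = 1) (hg' : g' * g' = 1)
    (hP : f ∘ₗ P = (-1 : k) ^ π • (P ∘ₗ f')) (hQ : g ∘ₗ Q = (-1 : k) ^ ϖ • (Q ∘ₗ g')) :
    koszulSwap f g ∘ₗ TensorProduct.map P Q =
      (-1 : k) ^ (π * ϖ) • (TensorProduct.map (Q ∘ₗ g' ^ π) (P ∘ₗ f' ^ ϖ) ∘ₗ koszulSwap f' g') := by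
  have hf : ∀ x, f' (f' x) = x := LinearMap.congr_fun hf'
  have hg : ∀ x, g' (g' x) = x := LinearMap.congr_fun hg'
  have hP' : ∀ x, f (P x) = (-1 : k) ^ π • P (f' x) := LinearMap.congr_fun hP
  have hQ' : ∀ x, g (Q x) = (-1 : k) ^ ϖ • Q (g' x) := LinearMap.congr_fun hQ
  have he : ∀ r, f' ^ (2 * r) = 1 := fun r => by rw [pow_mul, pow_two, hf', one_pow]
  have he' : ∀ r, g' ^ (2 * r) = 1 := fun r => by rw [pow_mul, pow_two, hg', one_pow]
  refine TensorProduct.ext' fun x y => ?_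
  obtain ⟨r, rfl | rfl⟩ := Nat.even_or_odd' π <;> obtain ⟨s, rfl | rfl⟩ := Nat.even_or_odd' ϖ <;>
  simp [koszulSwap, hP', hQ', he, he', pow_add, pow_mul, hf, hg, smul_sub, smul_add,
    TensorProduct.tmul_neg, TensorProduct.neg_tmul] <;> module

theorem rot_homChain [CharZero k] {i : ℤ} {a : V} (ha : a ∈ 𝒱 i) (l : List (Σ i : ℤ, 𝒱 i)) :
    rot 𝒱 (a ⊗ₜ homWord 𝒱 l) = spl l fun u v =>
      (-1 : k) ^ ((i + degList 𝒱 u) * degList 𝒱 v) • (homWord 𝒱 v ⊗ₜ (a ⊗ₜ homWord 𝒱 u)) := by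
  have : rot 𝒱 = koszulSwap (parC 𝒱) (par 𝒱) ∘ₗ coact k V := rfl
  rw [this, LinearMap.comp_apply, coact_homWord, map_spl]
  refine spl_congr fun u v _ => koszulSwap_tmul _ _ _ _ _ _ ?_ ?_
  · rw [parC, TensorProduct.map_tmul, sgn_of_mem 𝒱 1 i ha, AlgHom.toLinearMap_apply, tsgn_homWord,
      TensorProduct.tmul_smul, ← TensorProduct.smul_tmul', smul_smul, one_mul, one_mul,
      zpow_add₀ (by simp), mul_comm]
  · simp [tsgn_homWord]

/-- Cyclic coassociativity. -/
theorem koszulSwap_comp_rot [CharZero k] :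
    koszulSwap (parM 𝒱) (par 𝒱) ∘ₗ (TensorProduct.assoc k T C T).symm.toLinearMap ∘ₗ
      LinearMap.lTensor T (coact k V) ∘ₗ rot 𝒱 =
    (TensorProduct.assoc k T T C).toLinearMap ∘ₗ LinearMap.rTensor C (deconc k V) ∘ₗ rot 𝒱 := by
  refine ext_homChain 𝒱 fun i a ha l => ?_
  have h : ∀ x y v : List (Σ i : ℤ, 𝒱 i), koszulSwap (parM 𝒱) (par 𝒱)
      ((homWord 𝒱 v ⊗ₜ (a ⊗ₜ homWord 𝒱 x)) ⊗ₜ homWord 𝒱 y) =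
      (-1 : k) ^ ((degList 𝒱 v + i + degList 𝒱 x) * degList 𝒱 y) •
        homWord 𝒱 y ⊗ₜ (homWord 𝒱 v ⊗ₜ (a ⊗ₜ homWord 𝒱 x)) := by
    intro x y v
    refine koszulSwap_tmul _ _ _ _ _ _ ?_ ?_
    · simp only [parM, parC, TensorProduct.map_tmul, sgn_of_mem 𝒱 1 i ha,
        AlgHom.toLinearMap_apply, tsgn_homWord, TensorProduct.tmul_smul,
        ← TensorProduct.smul_tmul', smul_smul, one_mul]
      rw [zpow_add₀ (by simp), zpow_add₀ (by simp)]
      ring_nf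
    · simp [tsgn_homWord]
  simp only [LinearMap.comp_apply, rot_homChain 𝒱 ha, map_spl, map_smul, LinearMap.lTensor_tmul,
    LinearMap.rTensor_tmul, coact_homWord, deconc_homWord, tmul_spl, spl_tmul, smul_spl, h,
    LinearEquiv.coe_coe, TensorProduct.assoc_symm_tmul, TensorProduct.assoc_tmul, smul_smul]
  -- `X`, `Y`, `Z` are the degrees of `x`, `y`, `v`. The first rotation moves `v` past `y` and the
  -- second one moves `y` past `v`, so the sign `(-1)^(Y Z)` occurs twice and disappears.
  have e : ∀ X Y Z : ℤ, (-1 : k) ^ ((i + (X + Y)) * Z) * (-1) ^ ((Z + i + X) * Y) =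
      (-1) ^ ((i + X) * (Y + Z)) := by
    intro X Y Z
    rw [← zpow_add₀ (by simp), show (i + (X + Y)) * Z + (Z + i + X) * Y =
      (i + X) * (Y + Z) + 2 * (Y * Z) by ring, zpow_add₀ (by simp), zpow_mul (-1 : k) 2]
    simp
  refine Eq.trans ?_ ((spl_coassoc l fun x y v => (-1 : k) ^ ((i + degList 𝒱 x) *
    (degList 𝒱 y + degList 𝒱 v)) • homWord 𝒱 y ⊗ₜ (homWord 𝒱 v ⊗ₜ (a ⊗ₜ homWord 𝒱 x))).symm.trans ?_)
  · refine spl_congr fun u v _ => spl_congr fun x y hxy => ?_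
    rw [← hxy, degList_append, e]
  · refine spl_congr fun u v _ => spl_congr fun x y hxy => ?_
    rw [← hxy, degList_append]

/-- The operator on chains `(a, w) ↦ ∑ ± (Φ(z, a, u), g(v))`, the sum being over all splittings
`w = u v z`. -/
def lam (Φ : T ⊗[k] C →ₗ[k] V) (g : T →ₗ[k] T) : C →ₗ[k] C := wrapG Φ g ∘ₗ rot 𝒱

/-- Rotating the output moves a final part of `g(v)` to the front. By `koszulSwap_comp_rot` this
part and the piece `z` can be rotated together before anything is applied. The powers of the parity
operators and the explicit sign record which operators pass which pieces. As a result, a composition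
of operators on chains needs only one rotation. -/
theorem rot_comp_lam [CharZero k] {ι : Type*} [Fintype ι] {g : T →ₗ[k] T} {x y : ι → T →ₗ[k] T}
    (H : HasCoprod g x y) {Φ : T ⊗[k] C →ₗ[k] V} (φ : ℕ) (ξ η : ι → ℕ)
    (hΦ : sgn 𝒱 1 ∘ₗ Φ = (-1 : k) ^ φ • (Φ ∘ₗ parM 𝒱))
    (hx : ∀ i, par 𝒱 ∘ₗ x i = (-1 : k) ^ ξ i • (x i ∘ₗ par 𝒱))
    (hy : ∀ i, par 𝒱 ∘ₗ y i = (-1 : k) ^ η i • (y i ∘ₗ par 𝒱)) :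
    rot 𝒱 ∘ₗ lam 𝒱 Φ g = (∑ i, (-1 : k) ^ ((φ + ξ i) * η i) •
      tri (y i ∘ₗ (par 𝒱 : Module.End k T) ^ (φ + ξ i))
        (Φ ∘ₗ (parM 𝒱 : Module.End k (T ⊗[k] C)) ^ η i)
        (x i ∘ₗ (par 𝒱 : Module.End k T) ^ η i)) ∘ₗ rot 𝒱 := by
  have h0 : rot 𝒱 = koszulSwap (parC 𝒱) (par 𝒱) ∘ₗ coact k V := rfl
  have hw : ∀ (x : T →ₗ[k] T) (η : ℕ), wrapG Φ x ∘ₗ (parM 𝒱 : Module.End k (T ⊗[k] C)) ^ η =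
      wrapG (Φ ∘ₗ (parM 𝒱 : Module.End k (T ⊗[k] C)) ^ η)
        (x ∘ₗ (par 𝒱 : Module.End k T) ^ η) := by
    intro x η
    induction η with
    | zero => rfl
    | succ η ih =>
      rw [pow_succ, pow_succ, Module.End.mul_eq_comp, Module.End.mul_eq_comp, ← LinearMap.comp_assoc, ih, wrapG_comp_parM]; rfl
  have h1 : ∀ i, koszulSwap (parC 𝒱) (par 𝒱) ∘ₗ TensorProduct.map (wrapG Φ (x i)) (y i) = _ :=
    fun i => koszulSwap_comp_map (parM_parM 𝒱) (par_par 𝒱) (parC_comp_wrapG 𝒱 hΦ (hx i)) (hy i)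
  rw [lam, h0, LinearMap.comp_assoc, ← LinearMap.comp_assoc _ _ (coact k V), coact_comp_wrapG H, ← h0]
  refine LinearMap.ext fun c => ?_
  have h2 := LinearMap.congr_fun (koszulSwap_comp_rot 𝒱) c
  simp only [LinearMap.comp_apply, LinearMap.sum_apply, map_sum, LinearMap.smul_apply] at h2 ⊢
  refine Finset.sum_congr rfl fun i _ => ?_
  refine (LinearMap.congr_fun (h1 i) _).trans ?_
  simp only [LinearMap.comp_apply, LinearMap.smul_apply, h2, tri, hw]

end Signs

/-! ### Coderivations, double insertions and their commutators -/

section Coderivations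

variable {k V : Type*} [Field k] [AddCommGroup V] [Module k V]
variable (𝒱 : ℤ → Submodule k V) [DirectSum.Decomposition 𝒱]

local notation "T" => TensorAlgebra k V
local notation "C" => Chain k V
local infixl:70 "⋆" => star

/-- Cochains of odd degree. -/
def IsOddCochain (A : Cochain k V) : Prop := sgn 𝒱 1 ∘ₗ A = -(A ∘ₗ par 𝒱)

theorem coder_eq (p : ℤ) (A : Cochain k V) :
    coder 𝒱 p A = (tsgn 𝒱 p).toLinearMap ⋆ ((TensorAlgebra.ι k ∘ₗ A) ⋆ .id) := by
  refine ext_word fun l => ?_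
  simp [coder, deconc₃, star_word, deconc_word_eq, map_spl, tmul_spl, mul_spl]

theorem coder₂_eq (p : ℤ) (A : Cochain k V) (q : ℤ) (B : Cochain k V) :
    coder₂ 𝒱 p A q B = (tsgn 𝒱 (p + q)).toLinearMap ⋆
      ((TensorAlgebra.ι k ∘ₗ (A ∘ₗ (tsgn 𝒱 q).toLinearMap)) ⋆ coder 𝒱 q B) := by
  refine ext_word fun l => ?_
  simp [coder₂, deconc₃, star_word, deconc_word_eq, map_spl, tmul_spl, mul_spl]

theorem coder₂_one_one (A B : Cochain k V) : coder₂ 𝒱 1 A 1 B =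
    LinearMap.id ⋆ ((TensorAlgebra.ι k ∘ₗ (A ∘ₗ par 𝒱)) ⋆ coder 𝒱 1 B) := by
  rw [coder₂_eq, tsgn_even 𝒱 (by decide)]

theorem coder_zero (A : Cochain k V) : coder 𝒱 0 A =
    LinearMap.id ⋆ ((TensorAlgebra.ι k ∘ₗ A) ⋆ .id) := by
  rw [coder_eq, tsgn_even 𝒱 (by decide)]

/-- The cut is to the left of the inserted letter, in which case the left piece contributes its
sign, or to the right of it: `D_A` is a coderivation. -/
theorem hasCoprod_coder (A : Cochain k V) : HasCoprod (coder 𝒱 1 A)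
    (fun i : Option Unit => i.elim (par 𝒱) fun _ => coder 𝒱 1 A)
    (fun i : Option Unit => i.elim (coder 𝒱 1 A) fun _ => .id) := by
  have := hasCoprod_star (hasCoprod_tsgn 𝒱 1) hasCoprod_id A
  rwa [← coder_eq] at this

theorem coder_comp_par (A : Cochain k V) : coder 𝒱 1 A ∘ₗ par 𝒱 =
    LinearMap.id ⋆ ((TensorAlgebra.ι k ∘ₗ (A ∘ₗ par 𝒱)) ⋆ par 𝒱) := by
  rw [coder_eq, star_par, star_par, par_par, LinearMap.comp_assoc, LinearMap.id_comp]

/-- The three terms have the cut to the left of both inserted letters, between them, and to the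
right of both. The total insertion is even, so no parity operator is left in the first term. -/
theorem hasCoprod_coder₂ (A B : Cochain k V) : HasCoprod (coder₂ 𝒱 1 A 1 B)
    (fun i : Option (Option Unit) => i.elim .id fun i => i.elim (coder 𝒱 1 A ∘ₗ par 𝒱)
      fun _ => coder₂ 𝒱 1 A 1 B)
    (fun i : Option (Option Unit) => i.elim (coder₂ 𝒱 1 A 1 B) fun i => i.elim (coder 𝒱 1 B)
      fun _ => .id) := by
  have := hasCoprod_star hasCoprod_id (hasCoprod_coder 𝒱 B) (A ∘ₗ par 𝒱)
  rw [← coder₂_one_one] at this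
  convert this using 2 with i
  rcases i with _ | _ | _
  · rfl
  · simp only [Option.elim, coder_comp_par]
  · simp only [Option.elim, coder₂_one_one]

theorem star_comp_coder (A : Cochain k V) (f g : T →ₗ[k] T) : (f ⋆ g) ∘ₗ coder 𝒱 1 A =
    (f ∘ₗ par 𝒱) ⋆ (g ∘ₗ coder 𝒱 1 A) + (f ∘ₗ coder 𝒱 1 A) ⋆ g := by
  simpa [Fintype.sum_option] using star_comp (hasCoprod_coder 𝒱 A) f g

theorem star_comp_coder₂ (A B : Cochain k V) (f g : T →ₗ[k] T) :
    (f ⋆ g) ∘ₗ coder₂ 𝒱 1 A 1 B = f ⋆ (g ∘ₗ coder₂ 𝒱 1 A 1 B) +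
      ((f ∘ₗ (coder 𝒱 1 A ∘ₗ par 𝒱)) ⋆ (g ∘ₗ coder 𝒱 1 B) + (f ∘ₗ coder₂ 𝒱 1 A 1 B) ⋆ g) := by
  simpa [Fintype.sum_option] using star_comp (hasCoprod_coder₂ 𝒱 A B) f g

variable {𝒱}

theorem par_comp_ι {A : Cochain k V} (hA : IsOddCochain 𝒱 A) :
    par 𝒱 ∘ₗ (TensorAlgebra.ι k ∘ₗ A) = -(TensorAlgebra.ι k ∘ₗ (A ∘ₗ par 𝒱)) := by
  rw [← LinearMap.comp_assoc, par_ι, LinearMap.comp_assoc, hA, LinearMap.comp_neg]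

theorem par_comp_coder {A : Cochain k V} (hA : IsOddCochain 𝒱 A) :
    par 𝒱 ∘ₗ coder 𝒱 1 A = -(coder 𝒱 1 A ∘ₗ par 𝒱) := by
  rw [coder_comp_par, coder_eq, par_star, par_star, par_comp_ι hA, par_par, neg_star, star_neg,
    LinearMap.comp_id]

theorem par_comp_coder_comp_par {A : Cochain k V} (hA : IsOddCochain 𝒱 A) :
    par 𝒱 ∘ₗ (coder 𝒱 1 A ∘ₗ par 𝒱) = -coder 𝒱 1 A := by
  rw [← LinearMap.comp_assoc, par_comp_coder hA, LinearMap.neg_comp, LinearMap.comp_assoc,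
    par_par, LinearMap.comp_id]

theorem par_comp_coder₂ {A B : Cochain k V} (hA : IsOddCochain 𝒱 A) (hB : IsOddCochain 𝒱 B) :
    par 𝒱 ∘ₗ coder₂ 𝒱 1 A 1 B = coder₂ 𝒱 1 A 1 B ∘ₗ par 𝒱 := by
  have : par 𝒱 ∘ₗ (TensorAlgebra.ι k ∘ₗ (A ∘ₗ par 𝒱)) = -(TensorAlgebra.ι k ∘ₗ A) := by
    change (par 𝒱 ∘ₗ (TensorAlgebra.ι k ∘ₗ A)) ∘ₗ par 𝒱 = _
    rw [par_comp_ι hA, LinearMap.neg_comp, LinearMap.comp_assoc, LinearMap.comp_assoc, par_par,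
      LinearMap.comp_id]
  rw [coder₂_one_one, par_star, par_star, star_par, star_par, this, par_comp_coder hB,
    LinearMap.comp_assoc, LinearMap.comp_assoc, par_par]
  simp [neg_star, star_neg]

theorem coder₂_comp_par_star {A B : Cochain k V} (f : T →ₗ[k] T) :
    (coder₂ 𝒱 1 A 1 B ∘ₗ par 𝒱) ⋆ f =
      par 𝒱 ⋆ ((TensorAlgebra.ι k ∘ₗ A) ⋆ (coder 𝒱 1 B ∘ₗ par 𝒱 ⋆ f)) := by
  rw [coder₂_one_one, star_par, star_par, LinearMap.comp_assoc, LinearMap.comp_assoc, par_par]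
  simp [star_assoc]

/-- The composition of coderivations. -/
theorem coder_comp_coder {A B : Cochain k V} (hB : IsOddCochain 𝒱 B) :
    coder 𝒱 1 A ∘ₗ coder 𝒱 1 B =
      coder₂ 𝒱 1 A 1 B - coder₂ 𝒱 1 B 1 A + coder 𝒱 0 (circ 𝒱 A 1 B) := by
  rw [coder_eq 𝒱 1 A, star_comp_coder, star_comp_coder, par_comp_coder hB, coder₂_one_one,
    coder₂_one_one, coder_zero, par_par, LinearMap.comp_assoc, LinearMap.comp_assoc,
    LinearMap.id_comp, coder_comp_par, coder_eq 𝒱 1 A, circ]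
  simp only [neg_star, star_assoc, star_add]
  abel

theorem coder_zero_add (A B : Cochain k V) :
    coder 𝒱 0 (A + B) = coder 𝒱 0 A + coder 𝒱 0 B := by
  simp only [coder_zero, LinearMap.comp_add, add_star, star_add]

/-- Insertions in disjoint places are antisymmetric in `A` and `B` by `coder_comp_coder`, so only
the nested ones remain. -/
theorem coder_anticomm {A B : Cochain k V} (hA : IsOddCochain 𝒱 A) (hB : IsOddCochain 𝒱 B) :
    coder 𝒱 1 A ∘ₗ coder 𝒱 1 B + coder 𝒱 1 B ∘ₗ coder 𝒱 1 A =
      coder 𝒱 0 (circ 𝒱 A 1 B + circ 𝒱 B 1 A) := by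
  rw [coder_comp_coder hA, coder_comp_coder hB, coder_zero_add]
  abel

/-- The commutator of the coderivation `D_P` and the insertion of two cochains. -/
theorem coder_comp_coder₂ {P A B : Cochain k V} (hP : IsOddCochain 𝒱 P) (hA : IsOddCochain 𝒱 A)
    (hB : IsOddCochain 𝒱 B) :
    coder 𝒱 1 P ∘ₗ coder₂ 𝒱 1 A 1 B = coder₂ 𝒱 1 A 1 B ∘ₗ coder 𝒱 1 P +
      coder 𝒱 1 (brace₂ 𝒱 P 1 A 1 B) + coder₂ 𝒱 0 (circ 𝒱 P 1 A + circ 𝒱 A 1 P) 1 B -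
      coder₂ 𝒱 1 A 0 (circ 𝒱 P 1 B + circ 𝒱 B 1 P) := by
  -- The terms are sorted by whether the letters made by `A` and `B` lie to the left of the
  -- arguments of `P`, among them, or to the right of them.
  have h1 : coder 𝒱 1 P ∘ₗ coder₂ 𝒱 1 A 1 B = (coder₂ 𝒱 1 A 1 B ∘ₗ par 𝒱) ⋆ ((TensorAlgebra.ι k ∘ₗ P) ⋆ .id)
      - coder 𝒱 1 A ⋆ ((TensorAlgebra.ι k ∘ₗ circ 𝒱 P 1 B) ⋆ .id
        + (TensorAlgebra.ι k ∘ₗ (P ∘ₗ par 𝒱)) ⋆ coder 𝒱 1 B)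
      + par 𝒱 ⋆ ((TensorAlgebra.ι k ∘ₗ (brace₂ 𝒱 P 1 A 1 B)) ⋆ .id
        + (TensorAlgebra.ι k ∘ₗ (circ 𝒱 P 1 A ∘ₗ par 𝒱)) ⋆ coder 𝒱 1 B
        + (TensorAlgebra.ι k ∘ₗ P) ⋆ coder₂ 𝒱 1 A 1 B) := by
    rw [coder_eq 𝒱 1 P, star_comp_coder₂, star_comp_coder₂, star_comp_coder,
      par_comp_coder_comp_par hA, par_comp_coder₂ hA hB]
    simp only [LinearMap.comp_assoc, LinearMap.id_comp, neg_star, star_add, circ, brace₂]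
    abel
  have h2 : coder₂ 𝒱 1 A 1 B ∘ₗ coder 𝒱 1 P = coder 𝒱 1 P ⋆ ((TensorAlgebra.ι k ∘ₗ (A ∘ₗ par 𝒱)) ⋆ coder 𝒱 1 B)
      - par 𝒱 ⋆ ((TensorAlgebra.ι k ∘ₗ (circ 𝒱 A 1 P ∘ₗ par 𝒱)) ⋆ coder 𝒱 1 B)
      + par 𝒱 ⋆ ((TensorAlgebra.ι k ∘ₗ A) ⋆ (coder 𝒱 1 B ∘ₗ coder 𝒱 1 P)) := by
    rw [coder₂_one_one, star_comp_coder, star_comp_coder]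
    simp only [LinearMap.comp_assoc, LinearMap.id_comp, par_comp_coder hP, par_par, circ,
      LinearMap.comp_neg, neg_star, star_add, star_neg, LinearMap.comp_id]
    abel
  -- `h2` contains `D_B D_P` to the right of `A`. It is traded for the bracket `[P, B]` of the
  -- statement, and what is left matches the terms of `h1`.
  have h3 : coder 𝒱 1 B ∘ₗ coder 𝒱 1 P = coder 𝒱 0 (circ 𝒱 P 1 B + circ 𝒱 B 1 P) -
      (coder₂ 𝒱 1 P 1 B - coder₂ 𝒱 1 B 1 P + coder 𝒱 0 (circ 𝒱 P 1 B)) := by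
    rw [← coder_comp_coder hB, ← coder_anticomm hP hB]; abel
  rw [h1, h2, h3, coder₂_comp_par_star, coder_comp_par, coder₂_eq 𝒱 0, coder₂_eq 𝒱 1 A 0,
    coder₂_one_one, coder₂_one_one, coder₂_one_one, tsgn_even 𝒱 (p := 0) (by decide),
    coder_eq 𝒱 1 A, coder_eq 𝒱 1 P, coder_eq 𝒱 1 (brace₂ _ _ _ _ _ _), zero_add, add_zero,
    coder_zero 𝒱 (circ 𝒱 P 1 B)]
  simp only [LinearMap.add_comp, LinearMap.comp_add, sub_eq_add_neg, star_add, add_star, star_neg,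
    star_assoc, LinearMap.comp_id, neg_add, neg_neg]
  abel

/-- The commutator of an odd cochain with a brace of odd cochains. -/
theorem circ_brace₂ {P A B : Cochain k V} (Q : Cochain k V) (hP : IsOddCochain 𝒱 P)
    (hA : IsOddCochain 𝒱 A) (hB : IsOddCochain 𝒱 B) :
    circ 𝒱 (brace₂ 𝒱 Q 1 A 1 B) 1 P + circ 𝒱 Q 1 (brace₂ 𝒱 P 1 A 1 B) =
      brace₂ 𝒱 (circ 𝒱 Q 1 P) 1 A 1 B - brace₂ 𝒱 Q 0 (circ 𝒱 P 1 A + circ 𝒱 A 1 P) 1 B +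
      brace₂ 𝒱 Q 1 A 0 (circ 𝒱 P 1 B + circ 𝒱 B 1 P) := by
  simp only [circ, brace₂, LinearMap.comp_assoc]
  rw [coder_comp_coder₂ hP hA hB]
  simp only [LinearMap.comp_add, LinearMap.comp_sub, circ, brace₂]
  abel

end Coderivations

/-! ### Operators on chains in terms of rotations and marked words -/

section ChainOperators

variable {k V : Type*} [Field k] [CharZero k] [AddCommGroup V] [Module k V]
variable (𝒱 : ℤ → Submodule k V) [DirectSum.Decomposition 𝒱]

local notation "T" => TensorAlgebra k V
local notation "C" => Chain k V
local infixl:70 "⋆" => star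

/-- Only the trivial rotation survives under `mark σ`. Operators that leave `a₀` in its place thus
have the form `lam` as well, so that both summands of a Lie derivative are treated alike. -/
theorem lam_mark (σ : V →ₗ[k] V) (g : T →ₗ[k] T) :
    lam 𝒱 (mark σ) g = TensorProduct.map σ g := by
  refine ext_homChain 𝒱 fun i a ha l => ?_
  simp only [lam, LinearMap.comp_apply, rot_homChain 𝒱 ha, map_spl, map_smul, wrapG_mark]
  rw [spl_right _ _ (by simp [homWord])]
  simp [homWord, degList]

theorem lie_eq (p : ℤ) (A : Cochain k V) : lie 𝒱 p A =
    lam 𝒱 (mark (sgn 𝒱 p)) (coder 𝒱 p A) + lam 𝒱 (A ∘ₗ glue k V) .id := by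
  rw [lam_mark]; rfl

omit [CharZero k] in
theorem contr_eq (m : Cochain k V) (p : ℤ) (A : Cochain k V) : contr 𝒱 m p A =
    lam 𝒱 (m ∘ₗ glue k V ∘ₗ LinearMap.rTensor C (coder 𝒱 p A)) .id := by
  rw [lam, ← LinearMap.comp_assoc, ← wrapG_comp_rTensor]; rfl

/-- The action of the coderivation `D_A` on marked words. -/
def lieM (A : Cochain k V) : T ⊗[k] C →ₗ[k] T ⊗[k] C :=
  tri (par 𝒱) (mark (sgn 𝒱 1)) (coder 𝒱 1 A) + tri (coder 𝒱 1 A) (mark .id) .id +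
    tri (par 𝒱) (A ∘ₗ glue k V) .id

omit [CharZero k]

/-- The new letter is to the right of the marked letter, to the left of it, or has it as an
argument. -/
theorem coder_comp_glue (A : Cochain k V) : coder 𝒱 1 A ∘ₗ glue k V =
    mon (par 𝒱) (mark (sgn 𝒱 1)) (coder 𝒱 1 A) + mon (coder 𝒱 1 A) (mark .id) .id +
      mon (par 𝒱) (A ∘ₗ glue k V) .id := by
  rw [coder_eq, star_comp_glue, star_comp_glue, LinearMap.comp_assoc, ι_comp_eq_mon, id_comp_glue,
    tsgn_comp_glue]
  simp only [lact_mon, ract_mon, lact_add, star_unitOp, unitOp_star]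
  abel

theorem coder₂_comp_glue (A B : Cochain k V) : coder₂ 𝒱 1 A 1 B ∘ₗ glue k V =
    mon .id (mark .id) (coder₂ 𝒱 1 A 1 B) + mon (coder₂ 𝒱 1 A 1 B) (mark .id) .id +
      mon (coder 𝒱 1 A ∘ₗ par 𝒱) (mark (sgn 𝒱 1)) (coder 𝒱 1 B) +
      mon .id ((A ∘ₗ par 𝒱) ∘ₗ glue k V) (coder 𝒱 1 B) +
      mon (coder 𝒱 1 A ∘ₗ par 𝒱) (B ∘ₗ glue k V) .id := by
  rw [coder₂_one_one, star_comp_glue, star_comp_glue, LinearMap.comp_assoc, ι_comp_eq_mon,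
    id_comp_glue, coder_comp_glue, coder_comp_par]
  simp only [lact_mon, ract_mon, lact_add, star_unitOp, unitOp_star]
  abel

theorem counit_coder (p : ℤ) (A : Cochain k V) :
    (TensorAlgebra.algebraMapInv (R := k) (M := V)).toLinearMap ∘ₗ coder 𝒱 p A = 0 := by
  rw [coder_eq, counit_star_ι_star]

theorem counit_coder₂ (p : ℤ) (A : Cochain k V) (q : ℤ) (B : Cochain k V) :
    (TensorAlgebra.algebraMapInv (R := k) (M := V)).toLinearMap ∘ₗ coder₂ 𝒱 p A q B = 0 := by
  rw [coder₂_eq, counit_star_ι_star]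

omit [DirectSum.Decomposition 𝒱] in
theorem mark_comp_rTensor_zero (σ : V →ₗ[k] V) {h : T →ₗ[k] T}
    (H : (TensorAlgebra.algebraMapInv (R := k) (M := V)).toLinearMap ∘ₗ h = 0) :
    mark σ ∘ₗ LinearMap.rTensor C h = 0 := by
  refine ext_marked fun z a l => ?_
  have := LinearMap.congr_fun H (word k z)
  simp only [LinearMap.comp_apply, AlgHom.toLinearMap_apply, LinearMap.zero_apply] at this
  simp [mark_tmul, this]

theorem mon_comp_rTensor_coder (A : Cochain k V) (f : T →ₗ[k] T) (Φ : T ⊗[k] C →ₗ[k] V)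
    (g : T →ₗ[k] T) : mon f Φ g ∘ₗ LinearMap.rTensor C (coder 𝒱 1 A) =
      mon (f ∘ₗ par 𝒱) (Φ ∘ₗ LinearMap.rTensor C (coder 𝒱 1 A)) g +
        mon (f ∘ₗ coder 𝒱 1 A) Φ g := by
  simpa [Fintype.sum_option] using mon_comp_rTensor (hasCoprod_coder 𝒱 A) f Φ g

theorem mon_comp_rTensor_coder₂ (A B : Cochain k V) (f : T →ₗ[k] T) (Φ : T ⊗[k] C →ₗ[k] V)
    (g : T →ₗ[k] T) : mon f Φ g ∘ₗ LinearMap.rTensor C (coder₂ 𝒱 1 A 1 B) =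
      mon f (Φ ∘ₗ LinearMap.rTensor C (coder₂ 𝒱 1 A 1 B)) g +
        (mon (f ∘ₗ (coder 𝒱 1 A ∘ₗ par 𝒱)) (Φ ∘ₗ LinearMap.rTensor C (coder 𝒱 1 B)) g +
        mon (f ∘ₗ coder₂ 𝒱 1 A 1 B) Φ g) := by
  simpa [Fintype.sum_option] using mon_comp_rTensor (hasCoprod_coder₂ 𝒱 A B) f Φ g

omit [DirectSum.Decomposition 𝒱] in
theorem wrapG_glue_comp_tri_id (A : Cochain k V) (g' f : T →ₗ[k] T) (Φ : T ⊗[k] C →ₗ[k] V) :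
    wrapG (A ∘ₗ glue k V) g' ∘ₗ tri f Φ .id = wrapG (A ∘ₗ mon f Φ .id) g' := by
  simpa using wrapG_glue_comp_tri hasCoprod_id A g' f Φ

theorem wrapG_glue_comp_tri_coder (A B : Cochain k V) (g' f : T →ₗ[k] T)
    (Φ : T ⊗[k] C →ₗ[k] V) : wrapG (A ∘ₗ glue k V) g' ∘ₗ tri f Φ (coder 𝒱 1 B) =
      wrapG (A ∘ₗ mon f Φ (par 𝒱)) (g' ∘ₗ coder 𝒱 1 B) +
        wrapG (A ∘ₗ mon f Φ (coder 𝒱 1 B)) g' := by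
  simpa [Fintype.sum_option] using wrapG_glue_comp_tri (hasCoprod_coder 𝒱 B) A g' f Φ

theorem wrapG_glue_comp_tri_coder₂ (Q A B : Cochain k V) (g' f : T →ₗ[k] T)
    (Φ : T ⊗[k] C →ₗ[k] V) : wrapG (Q ∘ₗ glue k V) g' ∘ₗ tri f Φ (coder₂ 𝒱 1 A 1 B) =
      wrapG (Q ∘ₗ mon f Φ .id) (g' ∘ₗ coder₂ 𝒱 1 A 1 B) +
        (wrapG (Q ∘ₗ mon f Φ (coder 𝒱 1 A ∘ₗ par 𝒱)) (g' ∘ₗ coder 𝒱 1 B) +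
        wrapG (Q ∘ₗ mon f Φ (coder₂ 𝒱 1 A 1 B)) g') := by
  simpa [Fintype.sum_option] using wrapG_glue_comp_tri (hasCoprod_coder₂ 𝒱 A B) Q g' f Φ

omit [DirectSum.Decomposition 𝒱] in
theorem wrapG_glue_rTensor_comp_tri (Q : Cochain k V) (h g' f : T →ₗ[k] T)
    (Φ : T ⊗[k] C →ₗ[k] V) (g : T →ₗ[k] T) :
    wrapG (Q ∘ₗ glue k V ∘ₗ LinearMap.rTensor C h) g' ∘ₗ tri f Φ g =
      wrapG (Q ∘ₗ glue k V) g' ∘ₗ tri (h ∘ₗ f) Φ g := by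
  rw [← LinearMap.comp_assoc, ← wrapG_comp_rTensor, LinearMap.comp_assoc, rTensor_comp_tri]

/-- Either the letter made by `B` stays to the right of the arguments of `Q`, with the sign of
passing them, or it is among them; the terms of the second kind are those of `coder_comp_glue` and
add up to `Q ∘ B`. -/
theorem wrapG_glue_comp_lieM (Q B : Cochain k V) (g' : T →ₗ[k] T) :
    wrapG (Q ∘ₗ glue k V) g' ∘ₗ lieM 𝒱 B = wrapG ((Q ∘ₗ par 𝒱) ∘ₗ glue k V) (g' ∘ₗ coder 𝒱 1 B) +
      wrapG (circ 𝒱 Q 1 B ∘ₗ glue k V) g' := by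
  rw [lieM, LinearMap.comp_add, LinearMap.comp_add, wrapG_glue_comp_tri_coder,
    wrapG_glue_comp_tri_id, wrapG_glue_comp_tri_id, circ, LinearMap.comp_assoc _ _ Q,
    LinearMap.comp_assoc _ _ Q, coder_comp_glue, tsgn_comp_glue]
  simp only [LinearMap.comp_add, wrapG_add_left]
  abel

theorem wrapG_mark_comp_lieM (σ : V →ₗ[k] V) (B : Cochain k V) (g' : T →ₗ[k] T) :
    wrapG (mark σ) g' ∘ₗ lieM 𝒱 B = wrapG (mark (σ ∘ₗ sgn 𝒱 1)) (g' ∘ₗ coder 𝒱 1 B) +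
      wrapG (σ ∘ₗ B ∘ₗ glue k V) g' := by
  have hm : ∀ τ : V →ₗ[k] V, σ ∘ₗ mark τ = mark (σ ∘ₗ τ) := fun τ => by
    refine ext_marked fun z a l => ?_
    simp [mark_tmul]
  rw [lieM, LinearMap.comp_add, LinearMap.comp_add, 
    wrapG_mark_comp_tri _ _ _ _ _ (counit_tsgn 𝒱 1), wrapG_mark_comp_tri _ _ _ _ _ (counit_tsgn 𝒱 1),
    wrapG_mark_comp_tri_zero _ _ _ _ _ (counit_coder 𝒱 1 B), add_zero, hm, LinearMap.comp_id]

variable {𝒱}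

theorem mark_parity {σ : V →ₗ[k] V} (hσ : sgn 𝒱 1 ∘ₗ σ = σ ∘ₗ sgn 𝒱 1) :
    sgn 𝒱 1 ∘ₗ mark σ = (-1 : k) ^ 0 • (mark σ ∘ₗ parM 𝒱) := by
  have h1 : ∀ x, TensorAlgebra.algebraMapInv (tsgn 𝒱 1 x) = TensorAlgebra.algebraMapInv x :=
    LinearMap.congr_fun (counit_tsgn 𝒱 1)
  have h2 : ∀ x, sgn 𝒱 1 (σ x) = σ (sgn 𝒱 1 x) := LinearMap.congr_fun hσ
  refine ext_marked fun z a l => ?_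
  simp [mark_tmul, parM, parC, h1, h2]

theorem glue_parity {A : Cochain k V} (hA : IsOddCochain 𝒱 A) :
    sgn 𝒱 1 ∘ₗ (A ∘ₗ glue k V) = (-1 : k) ^ 1 • ((A ∘ₗ glue k V) ∘ₗ parM 𝒱) := by
  rw [LinearMap.comp_assoc, glue_comp_parM, ← LinearMap.comp_assoc, hA]
  simp [LinearMap.comp_assoc, LinearMap.neg_comp]

theorem sgn_glue_parity {A : Cochain k V} (hA : IsOddCochain 𝒱 A) :
    sgn 𝒱 1 ∘ₗ (sgn 𝒱 1 ∘ₗ A ∘ₗ glue k V) =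
      (-1 : k) ^ 1 • ((sgn 𝒱 1 ∘ₗ A ∘ₗ glue k V) ∘ₗ parM 𝒱) := by
  rw [LinearMap.comp_assoc _ _ (sgn 𝒱 1), ← LinearMap.comp_smul, ← glue_parity hA]

theorem rTensor_comp_parM {h : T →ₗ[k] T} {γ : ℕ}
    (hh : par 𝒱 ∘ₗ h = (-1 : k) ^ γ • (h ∘ₗ par 𝒱)) :
    LinearMap.rTensor C h ∘ₗ parM 𝒱 = (-1 : k) ^ γ • (parM 𝒱 ∘ₗ LinearMap.rTensor C h) := by
  have h2 : ∀ x, tsgn 𝒱 1 (h x) = (-1 : k) ^ γ • h (tsgn 𝒱 1 x) := LinearMap.congr_fun hh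
  refine ext_marked fun z a l => ?_
  simp [parM, h2, ← TensorProduct.smul_tmul', smul_smul, ← mul_pow]

theorem glue_rTensor_parity {A : Cochain k V} (hA : IsOddCochain 𝒱 A) {h : T →ₗ[k] T} {γ : ℕ}
    (hh : par 𝒱 ∘ₗ h = (-1 : k) ^ γ • (h ∘ₗ par 𝒱)) :
    sgn 𝒱 1 ∘ₗ (A ∘ₗ glue k V ∘ₗ LinearMap.rTensor C h) =
      (-1 : k) ^ (γ + 1) • ((A ∘ₗ glue k V ∘ₗ LinearMap.rTensor C h) ∘ₗ parM 𝒱) := by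
  rw [← LinearMap.comp_assoc _ _ A, ← LinearMap.comp_assoc, glue_parity hA,
    LinearMap.comp_assoc _ _ (A ∘ₗ glue k V), rTensor_comp_parM hh]
  simp only [LinearMap.comp_smul, LinearMap.smul_comp, LinearMap.comp_assoc, smul_smul]
  rw [pow_add, mul_right_comm, ← mul_pow]
  simp

theorem id_parity : par 𝒱 ∘ₗ (.id : T →ₗ[k] T) = (-1 : k) ^ 0 • ((.id : T →ₗ[k] T) ∘ₗ par 𝒱) := by
  simp

theorem par_parity : par 𝒱 ∘ₗ par 𝒱 = (-1 : k) ^ 0 • (par 𝒱 ∘ₗ par 𝒱) := by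
  simp

theorem coder_parity {A : Cochain k V} (hA : IsOddCochain 𝒱 A) :
    par 𝒱 ∘ₗ coder 𝒱 1 A = (-1 : k) ^ 1 • (coder 𝒱 1 A ∘ₗ par 𝒱) := by
  rw [par_comp_coder hA]; module

theorem coder_par_parity {A : Cochain k V} (hA : IsOddCochain 𝒱 A) :
    par 𝒱 ∘ₗ (coder 𝒱 1 A ∘ₗ par 𝒱) = (-1 : k) ^ 1 • ((coder 𝒱 1 A ∘ₗ par 𝒱) ∘ₗ par 𝒱) := by
  rw [par_comp_coder_comp_par hA, LinearMap.comp_assoc, par_par, LinearMap.comp_id]; module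

theorem coder₂_parity {A B : Cochain k V} (hA : IsOddCochain 𝒱 A) (hB : IsOddCochain 𝒱 B) :
    par 𝒱 ∘ₗ coder₂ 𝒱 1 A 1 B = (-1 : k) ^ 0 • (coder₂ 𝒱 1 A 1 B ∘ₗ par 𝒱) := by
  rw [par_comp_coder₂ hA hB]; simp

theorem mark_comp_parM (σ : V →ₗ[k] V) : mark σ ∘ₗ parM 𝒱 = mark (σ ∘ₗ sgn 𝒱 1) := by
  have h1 : ∀ x, TensorAlgebra.algebraMapInv (tsgn 𝒱 1 x) = TensorAlgebra.algebraMapInv x :=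
    LinearMap.congr_fun (counit_tsgn 𝒱 1)
  refine ext_marked fun z a l => ?_
  simp [mark_tmul, parM, parC, h1]

variable [CharZero k]

theorem rot_comp_lam_even {Φ : T ⊗[k] C →ₗ[k] V}
    (hΦ : sgn 𝒱 1 ∘ₗ Φ = (-1 : k) ^ 0 • (Φ ∘ₗ parM 𝒱)) :
    rot 𝒱 ∘ₗ lam 𝒱 Φ .id = tri .id Φ .id ∘ₗ rot 𝒱 := by
  have := rot_comp_lam 𝒱 hasCoprod_id 0 (fun _ => 0) (fun _ => 0) hΦ (fun _ => id_parity)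
    (fun _ => id_parity)
  simpa [Module.End.one_eq_id] using this

theorem rot_comp_lam_odd {Φ : T ⊗[k] C →ₗ[k] V}
    (hΦ : sgn 𝒱 1 ∘ₗ Φ = (-1 : k) ^ 1 • (Φ ∘ₗ parM 𝒱)) :
    rot 𝒱 ∘ₗ lam 𝒱 Φ .id = tri (par 𝒱) Φ .id ∘ₗ rot 𝒱 := by
  have := rot_comp_lam 𝒱 hasCoprod_id 1 (fun _ => 0) (fun _ => 0) hΦ (fun _ => id_parity)
    (fun _ => id_parity)
  simpa [Module.End.one_eq_id] using this

theorem rot_comp_lam_mark_coder {B : Cochain k V} (hB : IsOddCochain 𝒱 B) :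
    rot 𝒱 ∘ₗ lam 𝒱 (mark (sgn 𝒱 1)) (coder 𝒱 1 B) =
      (tri (par 𝒱) (mark (sgn 𝒱 1)) (coder 𝒱 1 B) + tri (coder 𝒱 1 B) (mark .id) .id) ∘ₗ
        rot 𝒱 := by
  have := rot_comp_lam 𝒱 (hasCoprod_coder 𝒱 B) 0 (fun i => i.elim 0 fun _ => 1)
    (fun i => i.elim 1 fun _ => 0) (mark_parity (σ := sgn 𝒱 1) rfl)
    (by rintro (_ | _); exacts [par_parity, coder_parity hB])
    (by rintro (_ | _); exacts [coder_parity hB, id_parity])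
  rw [this]
  simp [Module.End.one_eq_id, mark_comp_parM, sgn_sgn, par_par, Fintype.sum_option, add_comm]

/-- Insertion in a cyclic word does not depend on where the word is cut. The rotation separates the
insertions away from `a₀` into those to the right and those to the left of it; the insertions around
`a₀` keep their form. -/
theorem rot_comp_lie {B : Cochain k V} (hB : IsOddCochain 𝒱 B) :
    rot 𝒱 ∘ₗ lie 𝒱 1 B = lieM 𝒱 B ∘ₗ rot 𝒱 := by
  rw [lie_eq, LinearMap.comp_add, rot_comp_lam_mark_coder hB, rot_comp_lam_odd (glue_parity hB),
    lieM, LinearMap.add_comp _ (tri (par 𝒱) (B ∘ₗ glue k V) .id)]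

theorem rot_comp_contr {m A : Cochain k V} (hm : IsOddCochain 𝒱 m) (hA : IsOddCochain 𝒱 A) :
    rot 𝒱 ∘ₗ contr 𝒱 m 1 A =
      tri .id (m ∘ₗ glue k V ∘ₗ LinearMap.rTensor C (coder 𝒱 1 A)) .id ∘ₗ rot 𝒱 := by
  rw [contr_eq, rot_comp_lam_even]
  simpa [pow_add] using glue_rTensor_parity hm (coder_parity hA)

/-- The rotated part contains neither insertion, both, or only that of `B`. In the last case the odd
operator of `B` moves past that of `A`, whence the minus sign. -/
theorem rot_comp_lam_mark_coder₂ {A B : Cochain k V} (hA : IsOddCochain 𝒱 A)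
    (hB : IsOddCochain 𝒱 B) :
    rot 𝒱 ∘ₗ lam 𝒱 (mark .id) (coder₂ 𝒱 1 A 1 B) =
      (tri .id (mark .id) (coder₂ 𝒱 1 A 1 B) + tri (coder₂ 𝒱 1 A 1 B) (mark .id) .id +
       tri (-(coder 𝒱 1 B ∘ₗ par 𝒱)) (mark (sgn 𝒱 1)) (coder 𝒱 1 A)) ∘ₗ rot 𝒱 := by
  have := rot_comp_lam 𝒱 (hasCoprod_coder₂ 𝒱 A B) 0
    (fun i => i.elim 0 fun i => i.elim 1 fun _ => 0)
    (fun i => i.elim 0 fun i => i.elim 1 fun _ => 0) (mark_parity (σ := .id) rfl)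
    (by rintro (_ | _ | _); exacts [id_parity, coder_par_parity hA, coder₂_parity hA hB])
    (by rintro (_ | _ | _); exacts [coder₂_parity hA hB, coder_parity hB, id_parity])
  rw [this]
  rw [tri_neg_left]
  congr 1
  simp [Module.End.one_eq_id, mark_comp_parM, LinearMap.comp_assoc, par_par, Fintype.sum_option]
  module

theorem rot_comp_lam_sgn_coder {A B : Cochain k V} (hA : IsOddCochain 𝒱 A)
    (hB : IsOddCochain 𝒱 B) :
    rot 𝒱 ∘ₗ lam 𝒱 (sgn 𝒱 1 ∘ₗ A ∘ₗ glue k V) (coder 𝒱 1 B) =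
      (tri .id (sgn 𝒱 1 ∘ₗ A ∘ₗ glue k V) (coder 𝒱 1 B) +
        tri (coder 𝒱 1 B ∘ₗ par 𝒱) (A ∘ₗ glue k V) .id) ∘ₗ rot 𝒱 := by
  have := rot_comp_lam 𝒱 (hasCoprod_coder 𝒱 B) 1 (fun i => i.elim 0 fun _ => 1)
    (fun i => i.elim 1 fun _ => 0) (sgn_glue_parity hA)
    (by rintro (_ | _); exacts [par_parity, coder_parity hB])
    (by rintro (_ | _); exacts [coder_parity hB, id_parity])
  have h' : (sgn 𝒱 1 ∘ₗ A ∘ₗ glue k V) ∘ₗ parM 𝒱 = -(A ∘ₗ glue k V) := by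
    have := sgn_glue_parity hA
    rw [← LinearMap.comp_assoc, sgn_sgn, LinearMap.id_comp] at this
    conv_rhs => rw [this]
    module
  rw [this]
  congr 1
  have h2 : (par 𝒱 : Module.End k T) ^ 2 = LinearMap.id := by rw [pow_two]; exact par_par 𝒱
  simp [Module.End.one_eq_id, h', tri_neg_mid, par_par, Fintype.sum_option, h2]
  module

end ChainOperators

/-! ### Cartan calculus: commutators of Lie derivatives with contractions -/

section Cartan

variable {k V : Type*} [Field k] [CharZero k] [AddCommGroup V] [Module k V]
variable (𝒱 : ℤ → Submodule k V) [DirectSum.Decomposition 𝒱]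

local notation "T" => TensorAlgebra k V
local notation "C" => Chain k V
local infixl:70 "⋆" => star

/-- The sum of all terms `± (Q(U(z), a, u), v)` over the splittings `w = u v z` of the chain
`(a, w)`. -/
def ins (Q : Cochain k V) (U : T →ₗ[k] T) : Module.End k C :=
  lam 𝒱 (Q ∘ₗ glue k V ∘ₗ LinearMap.rTensor C U) .id

omit [CharZero k]

theorem lam_add_left (Φ Φ' : T ⊗[k] C →ₗ[k] V) (g : T →ₗ[k] T) :
    lam 𝒱 (Φ + Φ') g = lam 𝒱 Φ g + lam 𝒱 Φ' g := by
  simp [lam, wrapG_add_left, LinearMap.add_comp]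

theorem lam_add_right (Φ : T ⊗[k] C →ₗ[k] V) (g g' : T →ₗ[k] T) :
    lam 𝒱 Φ (g + g') = lam 𝒱 Φ g + lam 𝒱 Φ g' := by
  simp [lam, wrapG_add_right, LinearMap.add_comp]

theorem lam_neg_left (Φ : T ⊗[k] C →ₗ[k] V) (g : T →ₗ[k] T) :
    lam 𝒱 (-Φ) g = -lam 𝒱 Φ g := by
  simp [lam, wrapG_neg_left, LinearMap.neg_comp]

theorem lam_neg_right (Φ : T ⊗[k] C →ₗ[k] V) (g : T →ₗ[k] T) :
    lam 𝒱 Φ (-g) = -lam 𝒱 Φ g := by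
  simp [lam, wrapG_neg_right, LinearMap.neg_comp]

theorem ins_add_left (Q Q' : Cochain k V) (U : T →ₗ[k] T) :
    ins 𝒱 (Q + Q') U = ins 𝒱 Q U + ins 𝒱 Q' U := by
  simp only [ins, LinearMap.add_comp, lam_add_left]

theorem ins_add_right (Q : Cochain k V) (U U' : T →ₗ[k] T) :
    ins 𝒱 Q (U + U') = ins 𝒱 Q U + ins 𝒱 Q U' := by
  simp only [ins, LinearMap.rTensor_add, LinearMap.comp_add, lam_add_left]

theorem ins_neg_right (Q : Cochain k V) (U : T →ₗ[k] T) :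
    ins 𝒱 Q (-U) = -ins 𝒱 Q U := by
  rw [eq_neg_iff_add_eq_zero, ← ins_add_right]
  simp [ins, lam, wrapG_zero_left]

theorem contr_eq_ins (Q : Cochain k V) (p : ℤ) (A : Cochain k V) :
    contr 𝒱 Q p A = ins 𝒱 Q (coder 𝒱 p A) := contr_eq 𝒱 Q p A

omit [DirectSum.Decomposition 𝒱] in
theorem mon_zero_mid (f g : T →ₗ[k] T) : mon f (0 : T ⊗[k] C →ₗ[k] V) g = 0 := by
  simp [mon, tri, wrapG]

omit [DirectSum.Decomposition 𝒱] in
theorem mon_mark_id (h : T →ₗ[k] T) :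
    mon h (mark .id) .id = glue k V ∘ₗ LinearMap.rTensor C h := by
  rw [mon, tri_mark, TensorProduct.map_id]; rfl

theorem mon_mark_par (h : T →ₗ[k] T) : mon (h ∘ₗ par 𝒱) (mark (sgn 𝒱 1)) (par 𝒱) =
    glue k V ∘ₗ LinearMap.rTensor C h ∘ₗ parM 𝒱 := by
  rw [mon, tri_mark]
  congr 1
  refine ext_marked fun z a l => ?_
  simp [parM, parC]

theorem ins_eq (Q : Cochain k V) (U : T →ₗ[k] T) :
    ins 𝒱 Q U = lam 𝒱 (Q ∘ₗ mon U (mark .id) .id) .id := by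
  rw [mon_mark_id]; rfl

variable {𝒱}

theorem IsOddCochain.comp_par {A : Cochain k V} (hA : IsOddCochain 𝒱 A) :
    A ∘ₗ par 𝒱 = -(sgn 𝒱 1 ∘ₗ A) := by
  rw [hA, neg_neg]

variable [CharZero k]

theorem lie_comp_lie {A B : Cochain k V} (hA : IsOddCochain 𝒱 A) (hB : IsOddCochain 𝒱 B) :
    lie 𝒱 1 A ∘ₗ lie 𝒱 1 B = lam 𝒱 (mark .id) (coder 𝒱 1 A ∘ₗ coder 𝒱 1 B) +
      lam 𝒱 (sgn 𝒱 1 ∘ₗ B ∘ₗ glue k V) (coder 𝒱 1 A) -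
      lam 𝒱 (sgn 𝒱 1 ∘ₗ A ∘ₗ glue k V) (coder 𝒱 1 B) +
      lam 𝒱 (circ 𝒱 A 1 B ∘ₗ glue k V) .id := by
  rw [lie_eq 𝒱 1 A, lam, lam, ← LinearMap.add_comp, LinearMap.comp_assoc, rot_comp_lie hB,
    ← LinearMap.comp_assoc, LinearMap.add_comp, wrapG_mark_comp_lieM, wrapG_glue_comp_lieM,
    sgn_sgn, hA.comp_par, LinearMap.neg_comp, wrapG_neg_left]
  simp only [lam, LinearMap.add_comp, LinearMap.neg_comp, LinearMap.id_comp, LinearMap.comp_assoc]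
  abel

/-- The Lie derivatives along odd cochains satisfy `[L_A, L_B] = L_{[A, B]}`. -/
theorem lie_anticomm {A B : Cochain k V} (hA : IsOddCochain 𝒱 A) (hB : IsOddCochain 𝒱 B) :
    lie 𝒱 1 A * lie 𝒱 1 B + lie 𝒱 1 B * lie 𝒱 1 A =
      lie 𝒱 0 (circ 𝒱 A 1 B + circ 𝒱 B 1 A) := by
  rw [Module.End.mul_eq_comp, Module.End.mul_eq_comp, lie_comp_lie hA hB, lie_comp_lie hB hA,
    lie_eq, sgn_even 𝒱 (p := 0) (by decide), ← coder_anticomm hA hB, LinearMap.add_comp, lam_add_right,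
    lam_add_left]
  abel

/-- Here `Q` and `U` are odd, so `ins 𝒱 Q U` is even and the rotated pieces acquire no parity
operator; `lie_comp_ins_odd` is the counterpart for even `U`. -/
theorem lie_comp_ins_even {Q : Cochain k V} {U : T →ₗ[k] T} (hQ : IsOddCochain 𝒱 Q)
    (hU : par 𝒱 ∘ₗ U = (-1 : k) ^ 1 • (U ∘ₗ par 𝒱)) (P : Cochain k V) :
    lie 𝒱 1 P ∘ₗ ins 𝒱 Q U =
      lam 𝒱 (sgn 𝒱 1 ∘ₗ Q ∘ₗ glue k V ∘ₗ LinearMap.rTensor C U) (coder 𝒱 1 P) +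
      lam 𝒱 (P ∘ₗ mon .id (Q ∘ₗ glue k V ∘ₗ LinearMap.rTensor C U) .id) .id := by
  have h0 : sgn 𝒱 1 ∘ₗ (Q ∘ₗ glue k V ∘ₗ LinearMap.rTensor C U) =
      (-1 : k) ^ 0 • ((Q ∘ₗ glue k V ∘ₗ LinearMap.rTensor C U) ∘ₗ parM 𝒱) := by
    simpa using glue_rTensor_parity hQ hU
  rw [lie_eq 𝒱 1 P, lam, lam, ← LinearMap.add_comp, LinearMap.comp_assoc, ins,
    rot_comp_lam_even h0, ← LinearMap.comp_assoc, LinearMap.add_comp,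
    wrapG_mark_comp_tri _ _ _ _ _ (LinearMap.comp_id _), wrapG_glue_comp_tri_id,
    LinearMap.add_comp, LinearMap.comp_id]
  rfl

theorem lie_comp_ins_odd {Q : Cochain k V} {U : T →ₗ[k] T} (hQ : IsOddCochain 𝒱 Q)
    (hU : par 𝒱 ∘ₗ U = (-1 : k) ^ 0 • (U ∘ₗ par 𝒱)) (P : Cochain k V) :
    lie 𝒱 1 P ∘ₗ ins 𝒱 Q U =
      lam 𝒱 (sgn 𝒱 1 ∘ₗ Q ∘ₗ glue k V ∘ₗ LinearMap.rTensor C U) (coder 𝒱 1 P) +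
      lam 𝒱 (P ∘ₗ mon (par 𝒱) (Q ∘ₗ glue k V ∘ₗ LinearMap.rTensor C U) .id) .id := by
  rw [lie_eq 𝒱 1 P, lam, lam, ← LinearMap.add_comp, LinearMap.comp_assoc, ins,
    rot_comp_lam_odd (glue_rTensor_parity hQ hU), ← LinearMap.comp_assoc, LinearMap.add_comp,
    wrapG_mark_comp_tri _ _ _ _ _ (counit_tsgn 𝒱 1), wrapG_glue_comp_tri_id,
    LinearMap.add_comp, LinearMap.comp_id]
  rfl

theorem ins_comp_lie (Q : Cochain k V) (U : T →ₗ[k] T) {P : Cochain k V}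
    (hP : IsOddCochain 𝒱 P) : ins 𝒱 Q U ∘ₗ lie 𝒱 1 P =
      lam 𝒱 (Q ∘ₗ glue k V ∘ₗ LinearMap.rTensor C U ∘ₗ parM 𝒱) (coder 𝒱 1 P) +
      lam 𝒱 (Q ∘ₗ mon (U ∘ₗ par 𝒱) (mark (sgn 𝒱 1)) (coder 𝒱 1 P)) .id +
      ins 𝒱 Q (U ∘ₗ coder 𝒱 1 P) +
      lam 𝒱 (Q ∘ₗ mon (U ∘ₗ par 𝒱) (P ∘ₗ glue k V) .id) .id := by
  rw [ins, lam, LinearMap.comp_assoc, rot_comp_lie hP, ← LinearMap.comp_assoc, lieM,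
    LinearMap.comp_add, LinearMap.comp_add, wrapG_glue_rTensor_comp_tri,
    wrapG_glue_rTensor_comp_tri, wrapG_glue_rTensor_comp_tri, wrapG_glue_comp_tri_coder,
    wrapG_glue_comp_tri_id, wrapG_glue_comp_tri_id, mon_mark_par, ins_eq, LinearMap.id_comp]
  simp only [LinearMap.add_comp]
  rfl

omit [CharZero k] in
theorem ins_circ_coder (Q P B : Cochain k V) : ins 𝒱 (circ 𝒱 Q 1 P) (coder 𝒱 1 B) =
    ins 𝒱 Q (coder 𝒱 1 P ∘ₗ coder 𝒱 1 B) +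
    lam 𝒱 (Q ∘ₗ mon (par 𝒱 ∘ₗ coder 𝒱 1 B) (mark (sgn 𝒱 1)) (coder 𝒱 1 P)) .id +
    lam 𝒱 (Q ∘ₗ mon (par 𝒱 ∘ₗ coder 𝒱 1 B) (P ∘ₗ glue k V) .id) .id +
    lam 𝒱 (Q ∘ₗ mon .id (P ∘ₗ glue k V ∘ₗ LinearMap.rTensor C (coder 𝒱 1 B)) .id) .id := by
  rw [ins, circ, LinearMap.comp_assoc _ _ Q, ← LinearMap.comp_assoc _ _ (coder 𝒱 1 P),
    coder_comp_glue, ins_eq]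
  simp only [LinearMap.add_comp, mon_comp_rTensor_coder,
    mark_comp_rTensor_zero _ (counit_coder 𝒱 1 B), mon_zero_mid, zero_add, par_par,
    LinearMap.comp_add, lam_add_left, LinearMap.comp_assoc]
  abel

omit [CharZero k] in
theorem ins_circ_coder₂ (Q P : Cochain k V) {A B : Cochain k V} (hA : IsOddCochain 𝒱 A)
    (hB : IsOddCochain 𝒱 B) : ins 𝒱 (circ 𝒱 Q 1 P) (coder₂ 𝒱 1 A 1 B) =
    ins 𝒱 Q (coder 𝒱 1 P ∘ₗ coder₂ 𝒱 1 A 1 B) +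
    lam 𝒱 (Q ∘ₗ mon (coder₂ 𝒱 1 A 1 B ∘ₗ par 𝒱) (mark (sgn 𝒱 1)) (coder 𝒱 1 P)) .id +
    lam 𝒱 (Q ∘ₗ mon (coder₂ 𝒱 1 A 1 B ∘ₗ par 𝒱) (P ∘ₗ glue k V) .id) .id +
    lam 𝒱 (Q ∘ₗ mon (par 𝒱)
      (P ∘ₗ glue k V ∘ₗ LinearMap.rTensor C (coder₂ 𝒱 1 A 1 B)) .id) .id -
    lam 𝒱 (Q ∘ₗ mon (coder 𝒱 1 A)
      (P ∘ₗ glue k V ∘ₗ LinearMap.rTensor C (coder 𝒱 1 B)) .id) .id := by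
  rw [ins, circ, LinearMap.comp_assoc _ _ Q, ← LinearMap.comp_assoc _ _ (coder 𝒱 1 P),
    coder_comp_glue, ins_eq]
  simp only [LinearMap.add_comp, mon_comp_rTensor_coder₂, par_comp_coder_comp_par hA,
    mark_comp_rTensor_zero _ (counit_coder 𝒱 1 B), mon_neg_left, par_comp_coder₂ hA hB,
    mark_comp_rTensor_zero _ (counit_coder₂ 𝒱 1 A 1 B), mon_zero_mid, zero_add,
    LinearMap.comp_add, lam_add_left, LinearMap.comp_assoc, LinearMap.comp_neg, lam_neg_left]
  abel

/-- Insertions of `P` to the right of the arguments of `Q` cancel. The others complete `Q ∘ P` and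
`[P, B]`, except for the terms in which one of `P`, `Q` takes `B` and `a₀` and its value is an
argument of the other. These are antisymmetric in `P` and `Q`, so they disappear on symmetrization.
-/
theorem lie_commute_contr {P Q B : Cochain k V} (hP : IsOddCochain 𝒱 P) (hQ : IsOddCochain 𝒱 Q)
    (hB : IsOddCochain 𝒱 B) :
    lie 𝒱 1 P ∘ₗ contr 𝒱 Q 1 B - contr 𝒱 Q 1 B ∘ₗ lie 𝒱 1 P =
      lam 𝒱 (P ∘ₗ mon .id (Q ∘ₗ glue k V ∘ₗ LinearMap.rTensor C (coder 𝒱 1 B)) .id) .id -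
      lam 𝒱 (Q ∘ₗ mon .id (P ∘ₗ glue k V ∘ₗ LinearMap.rTensor C (coder 𝒱 1 B)) .id) .id +
      contr 𝒱 (circ 𝒱 Q 1 P) 1 B - contr 𝒱 Q 0 (circ 𝒱 P 1 B + circ 𝒱 B 1 P) := by
  have h0 : sgn 𝒱 1 ∘ₗ Q ∘ₗ glue k V ∘ₗ LinearMap.rTensor C (coder 𝒱 1 B) =
      Q ∘ₗ glue k V ∘ₗ LinearMap.rTensor C (coder 𝒱 1 B) ∘ₗ parM 𝒱 := by
    simpa [LinearMap.comp_assoc] using glue_rTensor_parity hQ (coder_parity hB)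
  rw [contr_eq_ins, contr_eq_ins, contr_eq_ins, lie_comp_ins_even hQ (coder_parity hB),
    ins_comp_lie _ _ hP, ins_circ_coder, ← coder_anticomm hP hB, h0, par_comp_coder hB,
    ins_add_right]
  simp only [mon_neg_left, LinearMap.comp_neg, lam_neg_left]
  abel

/-- `[L_P, i_B]` for contractions `i_B` formed with `Q`, symmetrized in `P` and `Q`. -/
theorem lie_commute_contr_symm {P Q B : Cochain k V} (hP : IsOddCochain 𝒱 P)
    (hQ : IsOddCochain 𝒱 Q) (hB : IsOddCochain 𝒱 B) :
    (lie 𝒱 1 P * contr 𝒱 Q 1 B - contr 𝒱 Q 1 B * lie 𝒱 1 P) +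
      (lie 𝒱 1 Q * contr 𝒱 P 1 B - contr 𝒱 P 1 B * lie 𝒱 1 Q) =
      contr 𝒱 (circ 𝒱 P 1 Q + circ 𝒱 Q 1 P) 1 B -
      contr 𝒱 Q 0 (circ 𝒱 P 1 B + circ 𝒱 B 1 P) -
      contr 𝒱 P 0 (circ 𝒱 Q 1 B + circ 𝒱 B 1 Q) := by
  simp only [Module.End.mul_eq_comp]
  rw [lie_commute_contr hP hQ hB, lie_commute_contr hQ hP hB, contr_eq_ins 𝒱 (_ + _),
    ins_add_left, ← contr_eq_ins, ← contr_eq_ins]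
  abel

/-- The inner contraction makes its value the new marked letter, and the outer one inserts `A` to
the left of it. The same terms occur in `ins_circ_coder₂`. -/
theorem contr_comp_contr (Q A : Cochain k V) {P B : Cochain k V} (hP : IsOddCochain 𝒱 P)
    (hB : IsOddCochain 𝒱 B) : contr 𝒱 Q 1 A ∘ₗ contr 𝒱 P 1 B =
      lam 𝒱 (Q ∘ₗ mon (coder 𝒱 1 A)
        (P ∘ₗ glue k V ∘ₗ LinearMap.rTensor C (coder 𝒱 1 B)) .id) .id := by
  rw [contr_eq 𝒱 Q, lam, LinearMap.comp_assoc, rot_comp_contr hP hB, ← LinearMap.comp_assoc,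
    wrapG_glue_rTensor_comp_tri, wrapG_glue_comp_tri_id]
  rfl

/-- When `P` is an argument of `Q` and takes `B` and `a₀` but not `A`, the result is a product of
contractions; when it takes `A` and `B` but not `a₀`, the result is the contraction by the brace. As
for `lie_commute_contr`, the first two terms are antisymmetric in `P` and `Q`. -/
theorem lie_anticomm_ins {P Q A B : Cochain k V} (hP : IsOddCochain 𝒱 P)
    (hQ : IsOddCochain 𝒱 Q) (hA : IsOddCochain 𝒱 A) (hB : IsOddCochain 𝒱 B) :
    lie 𝒱 1 P ∘ₗ ins 𝒱 Q (coder₂ 𝒱 1 A 1 B) + ins 𝒱 Q (coder₂ 𝒱 1 A 1 B) ∘ₗ lie 𝒱 1 P =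
      lam 𝒱 (P ∘ₗ mon (par 𝒱)
        (Q ∘ₗ glue k V ∘ₗ LinearMap.rTensor C (coder₂ 𝒱 1 A 1 B)) .id) .id -
      lam 𝒱 (Q ∘ₗ mon (par 𝒱)
        (P ∘ₗ glue k V ∘ₗ LinearMap.rTensor C (coder₂ 𝒱 1 A 1 B)) .id) .id +
      ins 𝒱 (circ 𝒱 Q 1 P) (coder₂ 𝒱 1 A 1 B) + contr 𝒱 Q 1 A ∘ₗ contr 𝒱 P 1 B -
      contr 𝒱 Q 1 (brace₂ 𝒱 P 1 A 1 B) -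
      ins 𝒱 Q (coder₂ 𝒱 0 (circ 𝒱 P 1 A + circ 𝒱 A 1 P) 1 B) +
      ins 𝒱 Q (coder₂ 𝒱 1 A 0 (circ 𝒱 P 1 B + circ 𝒱 B 1 P)) := by
  have h0 : sgn 𝒱 1 ∘ₗ Q ∘ₗ glue k V ∘ₗ LinearMap.rTensor C (coder₂ 𝒱 1 A 1 B) =
      -(Q ∘ₗ glue k V ∘ₗ LinearMap.rTensor C (coder₂ 𝒱 1 A 1 B) ∘ₗ parM 𝒱) := by
    simpa [LinearMap.comp_assoc] using glue_rTensor_parity hQ (coder₂_parity hA hB)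
  rw [lie_comp_ins_odd hQ (coder₂_parity hA hB), ins_comp_lie _ _ hP, ins_circ_coder₂ _ _ hA hB,
    contr_comp_contr _ _ hP hB, h0, coder_comp_coder₂ hP hA hB, contr_eq_ins]
  simp only [lam_neg_left, sub_eq_add_neg, ins_add_right, ins_neg_right]
  abel

/-- The homotopy between `i_A i_B` and `i_{A ∪ B}`, for contractions formed with `Q` and `P`,
symmetrized in `P` and `Q`. -/
theorem lie_anticomm_ins_symm {P Q A B : Cochain k V} (hP : IsOddCochain 𝒱 P)
    (hQ : IsOddCochain 𝒱 Q) (hA : IsOddCochain 𝒱 A) (hB : IsOddCochain 𝒱 B) :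
    (lie 𝒱 1 P * ins 𝒱 Q (coder₂ 𝒱 1 A 1 B) + ins 𝒱 Q (coder₂ 𝒱 1 A 1 B) * lie 𝒱 1 P) +
    (lie 𝒱 1 Q * ins 𝒱 P (coder₂ 𝒱 1 A 1 B) + ins 𝒱 P (coder₂ 𝒱 1 A 1 B) * lie 𝒱 1 Q) =
      ins 𝒱 (circ 𝒱 P 1 Q + circ 𝒱 Q 1 P) (coder₂ 𝒱 1 A 1 B) +
      (contr 𝒱 Q 1 A * contr 𝒱 P 1 B - contr 𝒱 Q 1 (brace₂ 𝒱 P 1 A 1 B) -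
        ins 𝒱 Q (coder₂ 𝒱 0 (circ 𝒱 P 1 A + circ 𝒱 A 1 P) 1 B) +
        ins 𝒱 Q (coder₂ 𝒱 1 A 0 (circ 𝒱 P 1 B + circ 𝒱 B 1 P))) +
      (contr 𝒱 P 1 A * contr 𝒱 Q 1 B - contr 𝒱 P 1 (brace₂ 𝒱 Q 1 A 1 B) -
        ins 𝒱 P (coder₂ 𝒱 0 (circ 𝒱 Q 1 A + circ 𝒱 A 1 Q) 1 B) +
        ins 𝒱 P (coder₂ 𝒱 1 A 0 (circ 𝒱 Q 1 B + circ 𝒱 B 1 Q))) := by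
  simp only [Module.End.mul_eq_comp]
  rw [lie_anticomm_ins hP hQ hA hB, lie_anticomm_ins hQ hP hA hB, ins_add_left]
  abel

end Cartan

/-! ### The Lie derivative along a cup product -/

section CupLie

variable {k V : Type*} [Field k] [AddCommGroup V] [Module k V]
variable (𝒱 : ℤ → Submodule k V) [DirectSum.Decomposition 𝒱]

local notation "T" => TensorAlgebra k V
local notation "C" => Chain k V
local infixl:70 "⋆" => star

/-- The homotopy in the formula for `L_{A ∪ B}`. -/
def cupLieHomotopy (A B : Cochain k V) : Module.End k (Chain k V) :=
  lam 𝒱 (mark .id) (coder₂ 𝒱 1 A 1 B) - lam 𝒱 (sgn 𝒱 1 ∘ₗ A ∘ₗ glue k V) (coder 𝒱 1 B) +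
    contr 𝒱 A 1 B

/-- The contribution of `X = [m, A]` to the formula for `L_{A ∪ B}`. -/
def cupLieDefectLeft (X B : Cochain k V) : Module.End k (Chain k V) :=
  lam 𝒱 (mark (sgn 𝒱 1)) (coder₂ 𝒱 0 X 1 B) + lam 𝒱 (sgn 𝒱 1 ∘ₗ X ∘ₗ glue k V) (coder 𝒱 1 B) +
    contr 𝒱 X 1 B

/-- The contribution of `Y = [m, B]` to the formula for `L_{A ∪ B}`. -/
def cupLieDefectRight (A Y : Cochain k V) : Module.End k (Chain k V) :=
  lam 𝒱 (mark (sgn 𝒱 1)) (coder₂ 𝒱 1 A 0 Y) + lam 𝒱 (A ∘ₗ glue k V) (coder 𝒱 0 Y) +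
    contr 𝒱 A 0 Y

variable {𝒱}

theorem comp_mark (σ τ : V →ₗ[k] V) : σ ∘ₗ mark τ = mark (σ ∘ₗ τ) := by
  refine ext_marked fun z a l => ?_
  simp [mark_tmul]

variable [CharZero k]

theorem lie_eq_comp_rot (A : Cochain k V) : lie 𝒱 1 A =
    (wrapG (mark (sgn 𝒱 1)) (coder 𝒱 1 A) + wrapG (A ∘ₗ glue k V) .id) ∘ₗ rot 𝒱 := by
  rw [lie_eq, LinearMap.add_comp]; rfl

theorem lie_comp_lam_mark_coder₂ {A B : Cochain k V} (hA : IsOddCochain 𝒱 A)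
    (hB : IsOddCochain 𝒱 B) (m : Cochain k V) :
    lie 𝒱 1 m ∘ₗ lam 𝒱 (mark .id) (coder₂ 𝒱 1 A 1 B) =
      lam 𝒱 (mark (sgn 𝒱 1)) (coder 𝒱 1 m ∘ₗ coder₂ 𝒱 1 A 1 B) +
      lam 𝒱 (m ∘ₗ glue k V) (coder₂ 𝒱 1 A 1 B) +
      lam 𝒱 (m ∘ₗ mon .id (mark .id) (coder 𝒱 1 A ∘ₗ par 𝒱)) (coder 𝒱 1 B) +
      lam 𝒱 (m ∘ₗ mon .id (mark .id) (coder₂ 𝒱 1 A 1 B)) .id +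
      lam 𝒱 (m ∘ₗ mon (coder₂ 𝒱 1 A 1 B) (mark .id) .id) .id -
      lam 𝒱 (m ∘ₗ mon (coder 𝒱 1 B ∘ₗ par 𝒱) (mark (sgn 𝒱 1)) (par 𝒱)) (coder 𝒱 1 A) -
      lam 𝒱 (m ∘ₗ mon (coder 𝒱 1 B ∘ₗ par 𝒱) (mark (sgn 𝒱 1)) (coder 𝒱 1 A)) .id := by
  have h0 : (TensorAlgebra.algebraMapInv (R := k) (M := V)).toLinearMap ∘ₗ
      (-(coder 𝒱 1 B ∘ₗ par 𝒱)) = 0 := by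
    rw [LinearMap.comp_neg, ← LinearMap.comp_assoc, counit_coder, LinearMap.zero_comp, neg_zero]
  rw [lie_eq_comp_rot, LinearMap.comp_assoc, rot_comp_lam_mark_coder₂ hA hB,
    ← LinearMap.comp_assoc]
  simp only [LinearMap.comp_add, LinearMap.add_comp _ (wrapG _ _)]
  rw [wrapG_mark_comp_tri _ _ _ _ _ (LinearMap.comp_id _),
    wrapG_mark_comp_tri_zero _ _ _ _ _ (counit_coder₂ 𝒱 1 A 1 B),
    wrapG_mark_comp_tri_zero _ _ _ _ _ h0, wrapG_glue_comp_tri_coder₂, wrapG_glue_comp_tri_id,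
    wrapG_glue_comp_tri_coder, comp_mark, ← id_comp_glue]
  simp only [mon_neg_left, LinearMap.comp_neg, wrapG_neg_left, LinearMap.id_comp,
    LinearMap.comp_id, LinearMap.add_comp, LinearMap.neg_comp, LinearMap.zero_comp, lam]
  abel

theorem lie_comp_lam_sgn_coder {A B : Cochain k V} (hA : IsOddCochain 𝒱 A)
    (hB : IsOddCochain 𝒱 B) (m : Cochain k V) :
    lie 𝒱 1 m ∘ₗ lam 𝒱 (sgn 𝒱 1 ∘ₗ A ∘ₗ glue k V) (coder 𝒱 1 B) =
      lam 𝒱 (A ∘ₗ glue k V) (coder 𝒱 1 m ∘ₗ coder 𝒱 1 B) +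
      lam 𝒱 (m ∘ₗ mon .id (sgn 𝒱 1 ∘ₗ A ∘ₗ glue k V) (par 𝒱)) (coder 𝒱 1 B) +
      lam 𝒱 (m ∘ₗ mon .id (sgn 𝒱 1 ∘ₗ A ∘ₗ glue k V) (coder 𝒱 1 B)) .id +
      lam 𝒱 (m ∘ₗ mon (coder 𝒱 1 B ∘ₗ par 𝒱) (A ∘ₗ glue k V) .id) .id := by
  have h0 : (TensorAlgebra.algebraMapInv (R := k) (M := V)).toLinearMap ∘ₗ
      (coder 𝒱 1 B ∘ₗ par 𝒱) = 0 := by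
    rw [← LinearMap.comp_assoc, counit_coder, LinearMap.zero_comp]
  have hs : sgn 𝒱 1 ∘ₗ sgn 𝒱 1 ∘ₗ A ∘ₗ glue k V = A ∘ₗ glue k V := by
    rw [← LinearMap.comp_assoc, sgn_sgn, LinearMap.id_comp]
  rw [lie_eq_comp_rot, LinearMap.comp_assoc, rot_comp_lam_sgn_coder hA hB,
    ← LinearMap.comp_assoc (rot 𝒱)]
  simp only [LinearMap.comp_add, LinearMap.add_comp _ (wrapG _ _)]
  rw [wrapG_mark_comp_tri _ _ _ _ _ (LinearMap.comp_id _),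
    wrapG_mark_comp_tri_zero _ _ _ _ _ h0, wrapG_glue_comp_tri_coder, wrapG_glue_comp_tri_id, hs]
  simp only [LinearMap.id_comp, LinearMap.add_comp, LinearMap.zero_comp, lam]
  abel

theorem lam_mark_coder₂_comp_lie (A B : Cochain k V) {m : Cochain k V} (hm : IsOddCochain 𝒱 m) :
    lam 𝒱 (mark .id) (coder₂ 𝒱 1 A 1 B) ∘ₗ lie 𝒱 1 m =
      lam 𝒱 (mark (sgn 𝒱 1)) (coder₂ 𝒱 1 A 1 B ∘ₗ coder 𝒱 1 m) +
      lam 𝒱 (m ∘ₗ glue k V) (coder₂ 𝒱 1 A 1 B) := by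
  rw [lam, LinearMap.comp_assoc, rot_comp_lie hm, ← LinearMap.comp_assoc, wrapG_mark_comp_lieM,
    LinearMap.add_comp]
  rfl

theorem lam_sgn_coder_comp_lie {A m : Cochain k V} (B : Cochain k V) (hA : IsOddCochain 𝒱 A)
    (hm : IsOddCochain 𝒱 m) :
    lam 𝒱 (sgn 𝒱 1 ∘ₗ A ∘ₗ glue k V) (coder 𝒱 1 B) ∘ₗ lie 𝒱 1 m =
      -lam 𝒱 (A ∘ₗ glue k V) (coder 𝒱 1 B ∘ₗ coder 𝒱 1 m) +
      lam 𝒱 (sgn 𝒱 1 ∘ₗ circ 𝒱 A 1 m ∘ₗ glue k V) (coder 𝒱 1 B) := by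
  have h : (sgn 𝒱 1 ∘ₗ A) ∘ₗ par 𝒱 = -A := by
    rw [LinearMap.comp_assoc, hA.comp_par, LinearMap.comp_neg, ← LinearMap.comp_assoc, sgn_sgn,
      LinearMap.id_comp]
  rw [lam, LinearMap.comp_assoc _ _ (wrapG _ _), rot_comp_lie hm, ← LinearMap.comp_assoc _ _ (wrapG _ _),
    ← LinearMap.comp_assoc (glue k V), wrapG_glue_comp_lieM, h]
  simp only [LinearMap.add_comp, LinearMap.neg_comp, wrapG_neg_left, lam, circ,
    LinearMap.comp_assoc]

omit [CharZero k] in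
theorem coder_comp_par_comp_glue (A : Cochain k V) : (coder 𝒱 1 A ∘ₗ par 𝒱) ∘ₗ glue k V =
    mon .id (mark .id) (coder 𝒱 1 A ∘ₗ par 𝒱) +
      mon (coder 𝒱 1 A ∘ₗ par 𝒱) (mark (sgn 𝒱 1)) (par 𝒱) +
      mon .id ((A ∘ₗ par 𝒱) ∘ₗ glue k V) (par 𝒱) := by
  rw [coder_comp_par, star_comp_glue, star_comp_glue, LinearMap.comp_assoc, ι_comp_eq_mon,
    id_comp_glue, tsgn_comp_glue]
  simp only [lact_mon, ract_mon, lact_add, star_unitOp, unitOp_star]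
  abel

omit [CharZero k] in
theorem sgn_circ_comp_glue {A m : Cochain k V} (hA : IsOddCochain 𝒱 A) (hm : IsOddCochain 𝒱 m) :
    sgn 𝒱 1 ∘ₗ circ 𝒱 m 1 A ∘ₗ glue k V =
      m ∘ₗ mon .id (mark .id) (coder 𝒱 1 A ∘ₗ par 𝒱) +
      m ∘ₗ glue k V ∘ₗ LinearMap.rTensor C (coder 𝒱 1 A) ∘ₗ parM 𝒱 -
      m ∘ₗ mon .id (sgn 𝒱 1 ∘ₗ A ∘ₗ glue k V) (par 𝒱) := by
  have h : sgn 𝒱 1 ∘ₗ circ 𝒱 m 1 A = m ∘ₗ (coder 𝒱 1 A ∘ₗ par 𝒱) := by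
    rw [circ, ← LinearMap.comp_assoc, hm, LinearMap.neg_comp, LinearMap.comp_assoc,
      par_comp_coder hA, LinearMap.comp_neg, neg_neg]
  rw [← LinearMap.comp_assoc _ _ (sgn 𝒱 1), h, LinearMap.comp_assoc _ _ m,
    coder_comp_par_comp_glue, mon_mark_par, hA.comp_par, LinearMap.neg_comp, mon_neg_mid]
  simp only [LinearMap.comp_add, LinearMap.comp_neg, LinearMap.comp_assoc, sub_eq_add_neg]

/-- In effect the right hand side contains `i_B L_A` instead of `L_A i_B`, at the price of a
contraction by `[A, B]`. In this form all operators can be expanded to `lam` and compared term by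
term; `lie_brace₂` then restores the order. -/
theorem lie_brace₂_aux {m A B : Cochain k V} (hm : IsOddCochain 𝒱 m) (hA : IsOddCochain 𝒱 A)
    (hB : IsOddCochain 𝒱 B) :
    lie 𝒱 1 (brace₂ 𝒱 m 1 A 1 B) = contr 𝒱 m 1 A ∘ₗ lie 𝒱 1 B + lie 𝒱 1 A ∘ₗ contr 𝒱 m 1 B +
      ((lie 𝒱 1 m ∘ₗ lam 𝒱 (mark .id) (coder₂ 𝒱 1 A 1 B) -
        lam 𝒱 (mark .id) (coder₂ 𝒱 1 A 1 B) ∘ₗ lie 𝒱 1 m) -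
      (lie 𝒱 1 m ∘ₗ lam 𝒱 (sgn 𝒱 1 ∘ₗ A ∘ₗ glue k V) (coder 𝒱 1 B) -
        lam 𝒱 (sgn 𝒱 1 ∘ₗ A ∘ₗ glue k V) (coder 𝒱 1 B) ∘ₗ lie 𝒱 1 m)) -
      (lie 𝒱 1 A ∘ₗ contr 𝒱 m 1 B - contr 𝒱 m 1 B ∘ₗ lie 𝒱 1 A) -
      contr 𝒱 m 0 (circ 𝒱 A 1 B + circ 𝒱 B 1 A) -
      lam 𝒱 (mark (sgn 𝒱 1)) (coder₂ 𝒱 0 (circ 𝒱 m 1 A + circ 𝒱 A 1 m) 1 B) +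
      lam 𝒱 (mark (sgn 𝒱 1)) (coder₂ 𝒱 1 A 0 (circ 𝒱 m 1 B + circ 𝒱 B 1 m)) +
      lam 𝒱 (A ∘ₗ glue k V) (coder 𝒱 0 (circ 𝒱 m 1 B + circ 𝒱 B 1 m)) -
      lam 𝒱 (sgn 𝒱 1 ∘ₗ (circ 𝒱 m 1 A + circ 𝒱 A 1 m) ∘ₗ glue k V) (coder 𝒱 1 B) := by
  have h0 : sgn 𝒱 1 ∘ₗ m ∘ₗ glue k V ∘ₗ LinearMap.rTensor C (coder 𝒱 1 B) =
      m ∘ₗ glue k V ∘ₗ LinearMap.rTensor C (coder 𝒱 1 B) ∘ₗ parM 𝒱 := by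
    simpa [LinearMap.comp_assoc] using glue_rTensor_parity hm (coder_parity hB)
  rw [lie_commute_contr hA hm hB, lie_comp_lam_mark_coder₂ hA hB, lam_mark_coder₂_comp_lie A B hm,
    lie_comp_lam_sgn_coder hA hB, lam_sgn_coder_comp_lie B hA hm,
    contr_eq_ins 𝒱 m 1 A, contr_eq_ins 𝒱 m 1 B, ins_comp_lie _ _ hB,
    lie_comp_ins_even hm (coder_parity hB), lie_eq, brace₂, LinearMap.comp_assoc _ _ m,
    coder₂_comp_glue, contr_eq_ins 𝒱 (circ 𝒱 m 1 A), ins_circ_coder, ← brace₂,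
    coder_comp_coder₂ hm hA hB, ← coder_anticomm hm hB, h0, hA.comp_par,
    par_comp_coder hB, LinearMap.add_comp (glue k V) (circ 𝒱 A 1 m) (circ 𝒱 m 1 A),
    LinearMap.comp_add _ _ (sgn 𝒱 1), sgn_circ_comp_glue hA hm, mon_mark_par]
  simp only [sub_eq_add_neg, LinearMap.comp_add, lam_add_left, lam_add_right, lam_neg_left,
    lam_neg_right, LinearMap.comp_neg, LinearMap.neg_comp, mon_neg_left, mon_neg_mid,
    LinearMap.comp_assoc]
  abel

/-- The Lie derivative along a cup product. -/
theorem lie_brace₂ {m A B : Cochain k V} (hm : IsOddCochain 𝒱 m) (hA : IsOddCochain 𝒱 A)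
    (hB : IsOddCochain 𝒱 B) :
    lie 𝒱 1 (brace₂ 𝒱 m 1 A 1 B) = contr 𝒱 m 1 A * lie 𝒱 1 B + lie 𝒱 1 A * contr 𝒱 m 1 B +
      (lie 𝒱 1 m * cupLieHomotopy 𝒱 A B - cupLieHomotopy 𝒱 A B * lie 𝒱 1 m) -
      cupLieDefectLeft 𝒱 (circ 𝒱 m 1 A + circ 𝒱 A 1 m) B +
      cupLieDefectRight 𝒱 A (circ 𝒱 m 1 B + circ 𝒱 B 1 m) := by
  have h := lie_commute_contr_symm hm hA hB
  rw [lie_brace₂_aux hm hA hB, cupLieHomotopy, cupLieDefectLeft, cupLieDefectRight]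
  simp only [← Module.End.mul_eq_comp] at h ⊢
  -- This is the symmetrized Cartan formula for the pair `m`, `A`, solved for the contraction by
  -- `[A, B]`. Its commutator of `L_m` with the contraction formed with `A` accounts for the last
  -- term of the homotopy.
  have h' : contr 𝒱 m 0 (circ 𝒱 A 1 B + circ 𝒱 B 1 A) = contr 𝒱 (circ 𝒱 m 1 A + circ 𝒱 A 1 m) 1 B -
      contr 𝒱 A 0 (circ 𝒱 m 1 B + circ 𝒱 B 1 m) -
      ((lie 𝒱 1 m * contr 𝒱 A 1 B - contr 𝒱 A 1 B * lie 𝒱 1 m) +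
      (lie 𝒱 1 A * contr 𝒱 m 1 B - contr 𝒱 m 1 B * lie 𝒱 1 A)) := by
    rw [h]; abel
  rw [h']
  simp only [mul_sub, mul_add, sub_mul, add_mul]
  abel

end CupLie

/-! ### Multilinear operations on power series -/

section Convolution

open Finset.HasAntidiagonal (antidiagonal mem_antidiagonal)

variable {N : ℕ} {X Y Z U X' Y' : Type*}

theorem sum_antidiagonal_swap {A : Type*} [AddCommMonoid A] [Finset.HasAntidiagonal A]
    [AddCommMonoid U] (ν : A) (F : A → A → U) :
    ∑ e ∈ antidiagonal ν, F e.1 e.2 = ∑ e ∈ antidiagonal ν, F e.2 e.1 :=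
  Finset.sum_nbij' Prod.swap Prod.swap (by simp [add_comm])
    (by simp [add_comm]) (fun _ _ => rfl) (fun _ _ => rfl)
    fun _ _ => rfl

theorem sum_antidiagonal_assoc {A : Type*} [AddCommMonoid A] [Finset.HasAntidiagonal A]
    [AddCommMonoid U] (ν : A) (F : A → A → A → U) :
    ∑ e ∈ antidiagonal ν, ∑ e' ∈ antidiagonal e.1, F e'.1 e'.2 e.2 =
      ∑ e ∈ antidiagonal ν, ∑ e' ∈ antidiagonal e.2, F e.1 e'.1 e'.2 := by
  rw [Finset.sum_sigma', Finset.sum_sigma']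
  refine Finset.sum_bij' (fun x _ => ⟨(x.2.1, x.2.2 + x.1.2), (x.2.2, x.1.2)⟩)
    (fun x _ => ⟨(x.1.1 + x.2.1, x.2.2), (x.1.1, x.2.1)⟩) ?_ ?_ ?_ ?_ ?_ <;>
  simp +contextual only [Finset.mem_sigma, mem_antidiagonal, Sigma.forall, Prod.forall, and_imp]
  · rintro a b c d rfl rfl; simp [add_assoc]
  · rintro a b c d rfl rfl; simp [add_assoc]
  · rintro a b c d rfl rfl; trivial
  · rintro a b c d rfl rfl; trivial
  · intros; trivial

theorem sum_antidiagonal_comm {A : Type*} [AddCommMonoid A] [Finset.HasAntidiagonal A]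
    [AddCommMonoid U] (ν : A) (F : A → A → A → U) :
    ∑ e ∈ antidiagonal ν, ∑ e' ∈ antidiagonal e.2, F e.1 e'.1 e'.2 =
      ∑ e ∈ antidiagonal ν, ∑ e' ∈ antidiagonal e.2, F e'.1 e.1 e'.2 := by
  rw [← sum_antidiagonal_assoc ν F, ← sum_antidiagonal_assoc ν fun a b c => F b a c]
  exact Finset.sum_congr rfl fun e _ => sum_antidiagonal_swap e.1 fun a b => F a b e.2

/-- Biadditive operations. -/
structure IsBiadditive [AddCommGroup X] [AddCommGroup Y] [AddCommGroup Z] (B : X → Y → Z) :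
    Prop where
  add_left : ∀ x x' y, B (x + x') y = B x y + B x' y
  add_right : ∀ x y y', B x (y + y') = B x y + B x y'

section Biadditive

variable [AddCommGroup X] [AddCommGroup Y] [AddCommGroup Z] {B : X → Y → Z}

theorem IsBiadditive.sum_left (hB : IsBiadditive B) {ι : Type*} (s : Finset ι) (f : ι → X) (y : Y) :
    B (∑ i ∈ s, f i) y = ∑ i ∈ s, B (f i) y :=
  map_sum (AddMonoidHom.mk' (fun x => B x y) fun x x' => hB.add_left x x' y) f s

theorem IsBiadditive.sum_right (hB : IsBiadditive B) {ι : Type*} (s : Finset ι) (x : X)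
    (f : ι → Y) : B x (∑ i ∈ s, f i) = ∑ i ∈ s, B x (f i) :=
  map_sum (AddMonoidHom.mk' (fun y => B x y) fun y y' => hB.add_right x y y') f s

theorem IsBiadditive.zero_left (hB : IsBiadditive B) (y : Y) : B 0 y = 0 := by
  simpa using hB.sum_left (∅ : Finset ℕ) 0 y

theorem IsBiadditive.zero_right (hB : IsBiadditive B) (x : X) : B x 0 = 0 := by
  simpa using hB.sum_right (∅ : Finset ℕ) x 0

theorem IsBiadditive.nsmul_left (hB : IsBiadditive B) (n : ℕ) (x : X) (y : Y) :
    B (n • x) y = n • B x y :=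
  map_nsmul (AddMonoidHom.mk' (fun x => B x y) fun x x' => hB.add_left x x' y) n x

theorem IsBiadditive.nsmul_right (hB : IsBiadditive B) (n : ℕ) (x : X) (y : Y) :
    B x (n • y) = n • B x y :=
  map_nsmul (AddMonoidHom.mk' (fun y => B x y) fun y y' => hB.add_right x y y') n y

theorem IsBiadditive.conv (hB : IsBiadditive B) :
    IsBiadditive (conv B : MvPowerSeries (Fin N) X → MvPowerSeries (Fin N) Y →
      MvPowerSeries (Fin N) Z) where
  add_left f f' g := funext fun ν => by
    change ∑ _ ∈ _, B (_ + _) _ = (∑ _ ∈ _, _) + ∑ _ ∈ _, _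
    simp only [hB.add_left, Finset.sum_add_distrib]
  add_right f g g' := funext fun ν => by
    change ∑ _ ∈ _, B _ (_ + _) = (∑ _ ∈ _, _) + ∑ _ ∈ _, _
    simp only [hB.add_right, Finset.sum_add_distrib]

end Biadditive

/-- The extension of a trilinear operation to power series. -/
def conv₃ [AddCommMonoid U] (G : X → Y → Z → U) (f : MvPowerSeries (Fin N) X)
    (g : MvPowerSeries (Fin N) Y) (h : MvPowerSeries (Fin N) Z) : MvPowerSeries (Fin N) U :=
  fun ν => ∑ e ∈ antidiagonal ν, ∑ a ∈ antidiagonal e.2, G (f e.1) (g a.1) (h a.2)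

/-- The extension of a quadrilinear operation to power series. -/
def conv₄ [AddCommMonoid U] (G : X' → X → Y → Z → U) (l : MvPowerSeries (Fin N) X')
    (f : MvPowerSeries (Fin N) X) (g : MvPowerSeries (Fin N) Y) (h : MvPowerSeries (Fin N) Z) :
    MvPowerSeries (Fin N) U :=
  fun ν => ∑ e ∈ antidiagonal ν, conv₃ (G (l e.1)) f g h e.2

variable (f : MvPowerSeries (Fin N) X) (g : MvPowerSeries (Fin N) Y) (h : MvPowerSeries (Fin N) Z)
  (l : MvPowerSeries (Fin N) X')

theorem conv_swap [AddCommMonoid U] (B : X → Y → U) :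
    conv B f g = conv (fun y x => B x y) g f :=
  funext fun ν => sum_antidiagonal_swap ν fun a b => B (f a) (g b)

theorem conv₃_swap_left [AddCommMonoid U] (G : X → Y → Z → U) :
    conv₃ G f g h = conv₃ (fun y x z => G x y z) g f h :=
  funext fun ν => sum_antidiagonal_comm ν fun a b c => G (f a) (g b) (h c)

theorem conv₃_swap_right [AddCommMonoid U] (G : X → Y → Z → U) :
    conv₃ G f g h = conv₃ (fun x z y => G x y z) f h g :=
  funext fun _ => Finset.sum_congr rfl fun e _ =>
    sum_antidiagonal_swap e.2 fun a b => G (f e.1) (g a) (h b)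

theorem conv₄_swap_left [AddCommMonoid U] (G : X' → X → Y → Z → U) :
    conv₄ G l f g h = conv₄ (fun x l y z => G l x y z) f l g h :=
  funext fun ν => sum_antidiagonal_comm ν fun a b c =>
    ∑ e' ∈ antidiagonal c, G (l a) (f b) (g e'.1) (h e'.2)

theorem conv₄_swap_mid [AddCommMonoid U] (G : X' → X → Y → Z → U) :
    conv₄ G l f g h = conv₄ (fun l y x z => G l x y z) l g f h :=
  funext fun _ => Finset.sum_congr rfl fun e _ => congrFun (conv₃_swap_left f g h (G (l e.1))) e.2

theorem conv₄_swap_right [AddCommMonoid U] (G : X' → X → Y → Z → U) :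
    conv₄ G l f g h = conv₄ (fun l x z y => G l x y z) l f h g :=
  funext fun _ => Finset.sum_congr rfl fun e _ => congrFun (conv₃_swap_right f g h (G (l e.1))) e.2

/-- Once both sides are convolutions of the same series, an identity need only be checked on
coefficients, where the parity assumptions are available. -/
theorem conv_congr [AddCommMonoid U] {B B' : X → Y → U}
    (H : ∀ a b, B (f a) (g b) = B' (f a) (g b)) : conv B f g = conv B' f g :=
  funext fun _ => Finset.sum_congr rfl fun _ _ => H _ _

theorem conv₃_congr [AddCommMonoid U] {G G' : X → Y → Z → U}
    (H : ∀ a b c, G (f a) (g b) (h c) = G' (f a) (g b) (h c)) : conv₃ G f g h = conv₃ G' f g h :=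
  funext fun _ => Finset.sum_congr rfl fun _ _ => Finset.sum_congr rfl fun _ _ => H _ _ _

theorem conv₄_congr [AddCommMonoid U] {G G' : X' → X → Y → Z → U}
    (H : ∀ d a b c, G (l d) (f a) (g b) (h c) = G' (l d) (f a) (g b) (h c)) :
    conv₄ G l f g h = conv₄ G' l f g h :=
  funext fun _ => Finset.sum_congr rfl fun _ _ => congrFun (conv₃_congr f g h (H _)) _

section Additivity

variable [AddCommGroup U]

theorem conv_add (B B' : X → Y → U) :
    conv (fun x y => B x y + B' x y) f g = conv B f g + conv B' f g :=
  funext fun _ => Finset.sum_add_distrib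

theorem conv₃_add (G G' : X → Y → Z → U) :
    conv₃ (fun x y z => G x y z + G' x y z) f g h = conv₃ G f g h + conv₃ G' f g h :=
  funext fun ν => by
    refine Eq.trans ?_ Finset.sum_add_distrib
    simp only [conv₃, Finset.sum_add_distrib]

theorem conv₃_sub (G G' : X → Y → Z → U) :
    conv₃ (fun x y z => G x y z - G' x y z) f g h = conv₃ G f g h - conv₃ G' f g h :=
  funext fun ν => by
    refine Eq.trans ?_ (Finset.sum_sub_distrib ..)
    simp only [conv₃, Finset.sum_sub_distrib]

theorem conv₄_add (G G' : X' → X → Y → Z → U) :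
    conv₄ (fun w x y z => G w x y z + G' w x y z) l f g h = conv₄ G l f g h + conv₄ G' l f g h :=
  funext fun ν => by
    refine Eq.trans ?_ Finset.sum_add_distrib
    simp only [conv₄, conv₃, Finset.sum_add_distrib]

theorem conv₄_sub (G G' : X' → X → Y → Z → U) :
    conv₄ (fun w x y z => G w x y z - G' w x y z) l f g h = conv₄ G l f g h - conv₄ G' l f g h :=
  funext fun ν => by
    refine Eq.trans ?_ (Finset.sum_sub_distrib ..)
    simp only [conv₄, conv₃, Finset.sum_sub_distrib]

end Additivity

section Composition

variable [AddCommGroup U] {W : Type*} [AddCommGroup W]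

theorem map_conv {Z : Type*} [AddCommGroup Z] (φ : Z →+ U) (B : X → Y → Z) :
    (fun ν => φ (conv B f g ν)) = conv (fun x y => φ (B x y)) f g :=
  funext fun _ => map_sum φ _ _

theorem map_conv₃ {W : Type*} [AddCommGroup W] (φ : W →+ U) (G : X → Y → Z → W) :
    (fun ν => φ (conv₃ G f g h ν)) = conv₃ (fun x y z => φ (G x y z)) f g h :=
  funext fun _ => by simp only [conv₃, map_sum]

theorem conv₃_zero_left {G : W → Y → Z → U}
    (hG : ∀ y z w w', G (w + w') y z = G w y z + G w' y z) : conv₃ G 0 g h = 0 :=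
  funext fun _ => Finset.sum_eq_zero fun _ _ => Finset.sum_eq_zero fun _ _ =>
    map_zero (AddMonoidHom.mk' (fun w => G w _ _) fun w w' => hG _ _ w w')

theorem conv_conv_left [AddCommGroup Z] {B : W → Z → U} (hB : IsBiadditive B) (B' : X → Y → W) :
    conv B (conv B' f g) h = conv₃ (fun x y z => B (B' x y) z) f g h := by
  funext ν
  simp only [conv, conv₃, hB.sum_left]
  exact sum_antidiagonal_assoc ν fun a b c => B (B' (f a) (g b)) (h c)

theorem conv_conv_right [AddCommGroup X] {B : X → W → U} (hB : IsBiadditive B) (B' : Y → Z → W) :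
    conv B f (conv B' g h) = conv₃ (fun x y z => B x (B' y z)) f g h := by
  funext ν
  simp only [conv, conv₃, hB.sum_right]

theorem conv_conv₃_right [AddCommGroup X'] {B : X' → W → U} (hB : IsBiadditive B) (G : X → Y → Z → W) :
    conv B l (conv₃ G f g h) = conv₄ (fun w x y z => B w (G x y z)) l f g h := by
  funext ν
  simp only [conv, conv₃, conv₄, hB.sum_right]

theorem conv_conv₃_left [AddCommGroup X'] {B : W → X' → U} (hB : IsBiadditive B) (G : X → Y → Z → W) :
    conv B (conv₃ G f g h) l = conv₄ (fun x y z w => B (G x y z) w) f g h l := by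
  rw [conv_swap, conv_conv₃_right _ _ _ _ ⟨fun a b c => hB.add_right c a b,
    fun a b c => hB.add_left b c a⟩, conv₄_swap_left, conv₄_swap_mid, conv₄_swap_right]

theorem conv₃_conv_left {G : W → Y → Z → U}
    (hG : ∀ y z w w', G (w + w') y z = G w y z + G w' y z) (B : X' → X → W) :
    conv₃ G (conv B l f) g h = conv₄ (fun w x y z => G (B w x) y z) l f g h := by
  have hs : ∀ (y z) (s : Finset ((Fin N →₀ ℕ) × (Fin N →₀ ℕ))) (φ : _ → W),
      G (∑ i ∈ s, φ i) y z = ∑ i ∈ s, G (φ i) y z := fun y z s φ =>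
    map_sum (AddMonoidHom.mk' (fun w => G w y z) fun w w' => hG y z w w') φ s
  funext ν
  rw [conv₄]
  simp only [conv₃]
  rw [← sum_antidiagonal_assoc ν fun a b c => ∑ e ∈ antidiagonal c, G (B (l a) (f b)) (g e.1) (h e.2)]
  refine Finset.sum_congr rfl fun e _ => ?_
  rw [Finset.sum_comm]
  simp only [conv, hs]

theorem conv₃_conv_mid {G : X → W → Z → U}
    (hG : ∀ x z w w', G x (w + w') z = G x w z + G x w' z) (B : X' → Y → W) :
    conv₃ G f (conv B l g) h = conv₄ (fun x w y z => G x (B w y) z) f l g h := by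
  rw [conv₃_swap_left, conv₃_conv_left _ _ _ _ hG, conv₄_swap_mid, conv₄_swap_left]

theorem conv₃_conv_right {G : X → Y → W → U}
    (hG : ∀ x y w w', G x y (w + w') = G x y w + G x y w') (B : X' → Z → W) :
    conv₃ G f g (conv B l h) = conv₄ (fun x y w z => G x y (B w z)) f g l h := by
  rw [conv₃_swap_right, conv₃_conv_mid _ _ _ _ hG, conv₄_swap_right, conv₄_swap_mid,
    conv₄_swap_right]

theorem conv_conv_conv {W' : Type*} [AddCommGroup W'] {B : W → W' → U} (hB : IsBiadditive B)
    (B₁ : X' → X → W) (B₂ : Y → Z → W') : conv B (conv B₁ l f) (conv B₂ g h) =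
      conv₄ (fun w x y z => B (B₁ w x) (B₂ y z)) l f g h := by
  funext ν
  simp only [conv, conv₃, conv₄, hB.sum_left, hB.sum_right]
  rw [← sum_antidiagonal_assoc ν fun a b c => ∑ e ∈ antidiagonal c,
    B (B₁ (l a) (f b)) (B₂ (g e.1) (h e.2))]

end Composition

section Derivatives

variable [AddCommGroup X] [AddCommGroup Y] [AddCommGroup Z]

/-- The exponent `e.1` is shifted by one in the direction `j`; the terms on the left that are not
reached have `e.1 j = 0` and vanish. -/
theorem sum_antidiagonal_single (F : (Fin N →₀ ℕ) → (Fin N →₀ ℕ) → Z) (ν : Fin N →₀ ℕ) (j : Fin N) :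
    ∑ e ∈ antidiagonal (ν + Finsupp.single j 1), (e.1 : Fin N →₀ ℕ) j • F e.1 e.2 =
      ∑ e ∈ antidiagonal ν, (e.1 j + 1) • F (e.1 + Finsupp.single j 1) e.2 := by
  symm
  refine Finset.sum_of_injOn (fun e => (e.1 + Finsupp.single j 1, e.2)) ?_ ?_ ?_ ?_
  · rintro ⟨a, b⟩ - ⟨c, d⟩ -; simp
  · rintro ⟨a, b⟩ h
    simp only [Finset.mem_coe, mem_antidiagonal] at h ⊢
    rw [← h, add_right_comm]
  · rintro ⟨a, b⟩ h h'
    rcases Nat.eq_zero_or_pos (a j) with h0 | h0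
    · simp [h0]
    · refine absurd ⟨(a - Finsupp.single j 1, b), ?_, ?_⟩ h'
      · have ha : a - Finsupp.single j 1 + Finsupp.single j 1 = a :=
          tsub_add_cancel_of_le (by simpa [Nat.one_le_iff_ne_zero, Nat.pos_iff_ne_zero] using h0)
        simp only [Finset.mem_coe, mem_antidiagonal] at h ⊢
        rw [← ha, add_right_comm] at h
        exact add_right_cancel h
      · simp only [Prod.mk.injEq, and_true]
        exact tsub_add_cancel_of_le (by simpa [Nat.one_le_iff_ne_zero, Nat.pos_iff_ne_zero] using h0)
  · rintro ⟨a, b⟩ -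
    simp

/-- The factor `ν j + 1` is the sum of the `j`-th components of the two exponents, and each summand
differentiates one of the factors. -/
theorem pd_conv {B : X → Y → Z} (hB : IsBiadditive B) (f : MvPowerSeries (Fin N) X)
    (g : MvPowerSeries (Fin N) Y) (j : Fin N) :
    pd j (conv B f g) = conv B (pd j f) g + conv B f (pd j g) := by
  funext ν
  have h1 := sum_antidiagonal_single (fun a b => B (f a) (g b)) ν j
  have h2 := sum_antidiagonal_single (fun a b => B (f b) (g a)) ν j
  rw [sum_antidiagonal_swap _ fun a b => a j • B (f b) (g a),
    sum_antidiagonal_swap ν fun a b => (a j + 1) • B (f b) (g (a + Finsupp.single j 1))] at h2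
  refine Eq.trans ?_ (Finset.sum_add_distrib (M := Z))
  simp only [pd, hB.nsmul_left, hB.nsmul_right]
  rw [Finset.sum_add_distrib, ← h1, ← h2, conv, ← Finset.sum_add_distrib, Finset.smul_sum]
  refine Finset.sum_congr rfl fun e he => ?_
  rw [← add_smul]
  congr 1
  have := DFunLike.congr_fun (mem_antidiagonal.1 he) j
  simpa using this.symm

theorem pd_zero (j : Fin N) : pd j (0 : MvPowerSeries (Fin N) X) = 0 :=
  funext fun _ => smul_zero _

theorem pd_map (φ : X →+ Y) (f : MvPowerSeries (Fin N) X) (j : Fin N) :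
    pd j (fun ν => φ (f ν) : MvPowerSeries (Fin N) Y) = fun ν => φ (pd j f ν) :=
  funext fun _ => (map_nsmul φ _ _).symm

end Derivatives

theorem mul_eq_conv {R : Type*} [Ring R] (f g : MvPowerSeries (Fin N) R) :
    f * g = conv (fun x y => x * y) f g := by
  ext ν
  rw [MvPowerSeries.coeff_mul]; rfl

theorem isBiadditive_mul {R : Type*} [Ring R] : IsBiadditive (fun x y : R => x * y) :=
  ⟨add_mul, mul_add⟩

end Convolution

/-! ### Additivity of the operations, and their dependence on parity only -/

section Additivity

variable {k V : Type*} [Field k] [AddCommGroup V] [Module k V]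
variable (𝒱 : ℤ → Submodule k V) [DirectSum.Decomposition 𝒱]

local notation "T" => TensorAlgebra k V
local notation "C" => Chain k V
local infixl:70 "⋆" => star

theorem coder_add (p : ℤ) (A B : Cochain k V) :
    coder 𝒱 p (A + B) = coder 𝒱 p A + coder 𝒱 p B := by
  simp only [coder_eq, LinearMap.comp_add, add_star, star_add]

theorem coder_smul (p : ℤ) (r : k) (A : Cochain k V) :
    coder 𝒱 p (r • A) = r • coder 𝒱 p A := by
  simp only [coder, LinearMap.comp_smul, TensorProduct.map_smul_left, TensorProduct.map_smul_right,
    LinearMap.smul_comp]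

theorem coder₂_add_left (p q : ℤ) (A A' B : Cochain k V) :
    coder₂ 𝒱 p (A + A') q B = coder₂ 𝒱 p A q B + coder₂ 𝒱 p A' q B := by
  simp only [coder₂_eq, LinearMap.comp_add, LinearMap.add_comp, add_star, star_add]

theorem coder₂_add_right (p q : ℤ) (A B B' : Cochain k V) :
    coder₂ 𝒱 p A q (B + B') = coder₂ 𝒱 p A q B + coder₂ 𝒱 p A q B' := by
  simp only [coder₂_eq, coder_add, star_add]

theorem lie_add (p : ℤ) (A B : Cochain k V) : lie 𝒱 p (A + B) = lie 𝒱 p A + lie 𝒱 p B := by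
  simp only [lie, coder_add, TensorProduct.map_add_right, wrap_eq_wrapG, LinearMap.add_comp,
    wrapG_add_left]
  abel

theorem lie_smul (p : ℤ) (r : k) (A : Cochain k V) : lie 𝒱 p (r • A) = r • lie 𝒱 p A := by
  simp only [lie, coder_smul, TensorProduct.map_smul_right, wrap, LinearMap.smul_comp,
    LinearMap.rTensor_smul, smul_add]

theorem isBiadditive_circ (p : ℤ) : IsBiadditive (fun A B => circ 𝒱 A p B) where
  add_left _ _ _ := LinearMap.add_comp _ _ _
  add_right _ _ _ := by simp only [circ, coder_add, LinearMap.comp_add]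

theorem isBiadditive_contr (p : ℤ) : IsBiadditive (fun A B => contr 𝒱 A p B) where
  add_left _ _ _ := by simp only [contr_eq_ins, ins_add_left]
  add_right _ _ _ := by simp only [contr_eq_ins, coder_add, ins_add_right]

theorem isBiadditive_circ_add_circ :
    IsBiadditive (fun A B => circ 𝒱 A 1 B + circ 𝒱 B 1 A) where
  add_left _ _ _ := by
    simp only [(isBiadditive_circ 𝒱 1).add_left, (isBiadditive_circ 𝒱 1).add_right]; abel
  add_right _ _ _ := by
    simp only [(isBiadditive_circ 𝒱 1).add_left, (isBiadditive_circ 𝒱 1).add_right]; abel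

theorem isBiadditive_cupLieDefectLeft : IsBiadditive (cupLieDefectLeft 𝒱) where
  add_left _ _ _ := by
    simp only [cupLieDefectLeft, coder₂_add_left, lam_add_right, LinearMap.comp_add,
      LinearMap.add_comp, lam_add_left, (isBiadditive_contr 𝒱 1).add_left]
    abel
  add_right _ _ _ := by
    simp only [cupLieDefectLeft, coder₂_add_right, coder_add, lam_add_right,
      (isBiadditive_contr 𝒱 1).add_right]
    abel

theorem isBiadditive_cupLieDefectRight : IsBiadditive (cupLieDefectRight 𝒱) where
  add_left _ _ _ := by
    simp only [cupLieDefectRight, coder₂_add_left, lam_add_right,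
      LinearMap.add_comp, lam_add_left, (isBiadditive_contr 𝒱 0).add_left]
    abel
  add_right _ _ _ := by
    simp only [cupLieDefectRight, coder₂_add_right, coder_add, lam_add_right,
      (isBiadditive_contr 𝒱 0).add_right]
    abel

theorem brace₂_add_left (p q : ℤ) (Q Q' A B : Cochain k V) :
    brace₂ 𝒱 (Q + Q') p A q B = brace₂ 𝒱 Q p A q B + brace₂ 𝒱 Q' p A q B :=
  LinearMap.add_comp _ _ _

theorem brace₂_add_mid (p q : ℤ) (Q A A' B : Cochain k V) :
    brace₂ 𝒱 Q p (A + A') q B = brace₂ 𝒱 Q p A q B + brace₂ 𝒱 Q p A' q B := by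
  simp only [brace₂, coder₂_add_left, LinearMap.comp_add]

theorem brace₂_add_right (p q : ℤ) (Q A B B' : Cochain k V) :
    brace₂ 𝒱 Q p A q (B + B') = brace₂ 𝒱 Q p A q B + brace₂ 𝒱 Q p A q B' := by
  simp only [brace₂, coder₂_add_right, LinearMap.comp_add]

variable {p q : ℤ} (hp : Odd p) (hq : Odd q)
include hp

theorem coder_odd (A : Cochain k V) : coder 𝒱 p A = coder 𝒱 1 A := by
  rw [coder_eq, coder_eq, tsgn_odd 𝒱 hp]

theorem lie_odd (A : Cochain k V) : lie 𝒱 p A = lie 𝒱 1 A := by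
  rw [lie, lie, coder_odd 𝒱 hp, sgn_odd 𝒱 hp]

theorem contr_odd (Q A : Cochain k V) : contr 𝒱 Q p A = contr 𝒱 Q 1 A := by
  rw [contr, contr, coder_odd 𝒱 hp]

include hq

theorem brace₂_odd (Q A B : Cochain k V) : brace₂ 𝒱 Q p A q B = brace₂ 𝒱 Q 1 A 1 B := by
  rw [brace₂, brace₂, coder₂_one_one, coder₂_eq, coder_odd 𝒱 hq, tsgn_odd 𝒱 hq,
    tsgn_even 𝒱 (hp.add_odd hq)]

end Additivity

/-! ### The Cartan calculus for families -/

section SeriesIdentities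

variable {k V : Type*} [Field k] [AddCommGroup V] [Module k V]
variable (𝒱 : ℤ → Submodule k V) [DirectSum.Decomposition 𝒱] {N : ℕ}

/-- Power series of cochains of odd degree. -/
def IsOddS (A : MvPowerSeries (Fin N) (Cochain k V)) : Prop := ∀ ν, IsOddCochain 𝒱 (A ν)

/-- The commutator `[A, B]` of two power series of cochains of odd degree. -/
def bracketS (A B : MvPowerSeries (Fin N) (Cochain k V)) : MvPowerSeries (Fin N) (Cochain k V) :=
  conv (fun A B => circ 𝒱 A 1 B + circ 𝒱 B 1 A) A B

/-- The brace `m{A, B}` of power series of cochains of odd degree. -/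
def braceS (m A B : MvPowerSeries (Fin N) (Cochain k V)) : MvPowerSeries (Fin N) (Cochain k V) :=
  conv₃ (fun m A B => brace₂ 𝒱 m 1 A 1 B) m A B

/-- The homotopy between `i_A i_B` and `i_{A ∪ B}`. -/
def contrHomotopyS (m A B : MvPowerSeries (Fin N) (Cochain k V)) :
    MvPowerSeries (Fin N) (Module.End k (Chain k V)) :=
  conv₃ (fun m A B => ins 𝒱 m (coder₂ 𝒱 1 A 1 B)) m A B

/-- The homotopy in the formula for `L_{A ∪ B}`. -/
def lieHomotopyS (A B : MvPowerSeries (Fin N) (Cochain k V)) :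
    MvPowerSeries (Fin N) (Module.End k (Chain k V)) :=
  conv (cupLieHomotopy 𝒱) A B

variable {𝒱} {m A B : MvPowerSeries (Fin N) (Cochain k V)}

/-- The prefactor `(-1)^(p - 1)` is `1` for odd `p`, and the remaining signs only see the parities
of `p` and `q`. -/
theorem cupS_odd {p q : ℤ} (hp : Odd p) (hq : Odd q) : cupS 𝒱 m p A q B = braceS 𝒱 m A B := by
  funext ν
  rw [cupS, (hp.sub_odd odd_one).neg_one_zpow, one_smul]
  simp only [brace₂_odd 𝒱 hp hq]
  rfl

theorem lieS_odd {p : ℤ} (hp : Odd p) : lieS 𝒱 p A = lieS 𝒱 1 A :=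
  funext fun _ => lie_odd 𝒱 hp _

theorem contrS_odd {p : ℤ} (hp : Odd p) : contrS 𝒱 m p A = contrS 𝒱 m 1 A := by
  simp only [contrS, contr_odd 𝒱 hp]

theorem bracketS_eq : bracketS 𝒱 A B =
    conv (fun A B => circ 𝒱 A 1 B) A B + conv (fun A B => circ 𝒱 A 1 B) B A := by
  rw [bracketS, conv_add, conv_swap B A]

/-- The derivative of the Maurer-Cartan equation: for a family of structures, `∂m/∂t_j` is a cocycle
of `[m, -]`. -/
theorem pd_bracketS_self (j : Fin N) :
    pd j (conv (fun A B => circ 𝒱 A 1 B) m m) = bracketS 𝒱 m (pd j m) := by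
  rw [pd_conv (isBiadditive_circ 𝒱 1), bracketS_eq, add_comm]

/-- This is `circ_brace₂` with `m` for both `P` and `Q`. The term with `m ∘ m` is retained, because
the formula is applied to the deformed `m` before the Maurer-Cartan equation is known for it. -/
theorem bracketS_braceS (hm : IsOddS 𝒱 m) (hA : IsOddS 𝒱 A) (hB : IsOddS 𝒱 B) :
    bracketS 𝒱 m (braceS 𝒱 m A B) =
      conv₃ (fun m A B => brace₂ 𝒱 m 1 A 1 B) (conv (fun A B => circ 𝒱 A 1 B) m m) A B -
      conv₃ (fun m A B => brace₂ 𝒱 m 0 A 1 B) m (bracketS 𝒱 m A) B +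
      conv₃ (fun m A B => brace₂ 𝒱 m 1 A 0 B) m A (bracketS 𝒱 m B) := by
  have e1 : conv (fun A B => circ 𝒱 A 1 B) m (braceS 𝒱 m A B) =
      conv₄ (fun Q P A B => circ 𝒱 Q 1 (brace₂ 𝒱 P 1 A 1 B)) m m A B :=
    conv_conv₃_right _ _ _ _ (isBiadditive_circ 𝒱 1) _
  have e2 : conv (fun A B => circ 𝒱 A 1 B) (braceS 𝒱 m A B) m =
      conv₄ (fun Q P A B => circ 𝒱 (brace₂ 𝒱 Q 1 A 1 B) 1 P) m m A B := by
    rw [conv₄_swap_mid, conv₄_swap_right]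
    exact conv_conv₃_left _ _ _ _ (isBiadditive_circ 𝒱 1) _
  have e3 : conv₃ (fun m A B => brace₂ 𝒱 m 1 A 1 B) (conv (fun A B => circ 𝒱 A 1 B) m m) A B =
      conv₄ (fun Q P A B => brace₂ 𝒱 (circ 𝒱 Q 1 P) 1 A 1 B) m m A B :=
    conv₃_conv_left (G := fun m A B => brace₂ 𝒱 m 1 A 1 B) _ _ _ _
      (fun _ _ _ _ => brace₂_add_left ..) _
  have e4 : conv₃ (fun m A B => brace₂ 𝒱 m 0 A 1 B) m (bracketS 𝒱 m A) B =
      conv₄ (fun Q P A B => brace₂ 𝒱 Q 0 (circ 𝒱 P 1 A + circ 𝒱 A 1 P) 1 B) m m A B :=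
    conv₃_conv_mid (G := fun m A B => brace₂ 𝒱 m 0 A 1 B) _ _ _ _
      (fun _ _ _ _ => brace₂_add_mid ..) _
  have e5 : conv₃ (fun m A B => brace₂ 𝒱 m 1 A 0 B) m A (bracketS 𝒱 m B) =
      conv₄ (fun Q P A B => brace₂ 𝒱 Q 1 A 0 (circ 𝒱 P 1 B + circ 𝒱 B 1 P)) m m A B := by
    rw [conv₄_swap_mid]
    exact conv₃_conv_right (G := fun m A B => brace₂ 𝒱 m 1 A 0 B) _ _ _ _
      (fun _ _ _ _ => brace₂_add_right ..) _
  rw [bracketS_eq, e1, e2, e3, e4, e5, ← conv₄_sub, ← conv₄_add, ← conv₄_add]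
  refine conv₄_congr _ _ _ _ fun d a b c => ?_
  rw [← circ_brace₂ _ (hm a) (hA b) (hB c), add_comm]

variable (𝒱) in
theorem isBiadditive_lie_mul (p : ℤ) : IsBiadditive (fun P (x : Module.End k (Chain k V)) =>
    lie 𝒱 p P * x) :=
  ⟨fun _ _ _ => by simp only [lie_add, add_mul], fun _ _ _ => mul_add _ _ _⟩

variable (𝒱) in
theorem isBiadditive_mul_lie (p : ℤ) : IsBiadditive (fun (x : Module.End k (Chain k V)) P =>
    x * lie 𝒱 p P) :=
  ⟨fun _ _ _ => add_mul _ _ _, fun _ _ _ => by simp only [lie_add, mul_add]⟩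

theorem lieS_mul (m : MvPowerSeries (Fin N) (Cochain k V))
    (U : MvPowerSeries (Fin N) (Module.End k (Chain k V))) :
    lieS 𝒱 1 m * U = conv (fun P x => lie 𝒱 1 P * x) m U := mul_eq_conv _ _

theorem mul_lieS (m : MvPowerSeries (Fin N) (Cochain k V))
    (U : MvPowerSeries (Fin N) (Module.End k (Chain k V))) :
    U * lieS 𝒱 1 m = conv (fun x P => x * lie 𝒱 1 P) U m := mul_eq_conv _ _

theorem lieS_mul_contrS (m A m' : MvPowerSeries (Fin N) (Cochain k V)) :
    lieS 𝒱 1 m' * contrS 𝒱 m 1 A = conv₃ (fun P Q A => lie 𝒱 1 P * contr 𝒱 Q 1 A) m' m A :=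
  (lieS_mul _ _).trans (conv_conv_right _ _ _ (isBiadditive_lie_mul 𝒱 1) _)

theorem contrS_mul_lieS (m A m' : MvPowerSeries (Fin N) (Cochain k V)) :
    contrS 𝒱 m 1 A * lieS 𝒱 1 m' = conv₃ (fun P Q A => contr 𝒱 Q 1 A * lie 𝒱 1 P) m' m A := by
  rw [conv₃_swap_left, conv₃_swap_right]
  exact (mul_lieS _ _).trans (conv_conv_left _ _ _ (isBiadditive_mul_lie 𝒱 1) _)

/-- The two copies of `f` may be exchanged, so twice an operation on them is its symmetrization. In
this way the identities symmetrized in `P` and `Q` are applied to `P = Q = m`. -/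
theorem conv₃_self_add {X Y U : Type*} [AddCommGroup U] (G : X → X → Y → U)
    (f : MvPowerSeries (Fin N) X) (g : MvPowerSeries (Fin N) Y) :
    conv₃ G f f g + conv₃ G f f g = conv₃ (fun x y z => G x y z + G y x z) f f g := by
  rw [conv₃_add, conv₃_swap_left f f g fun x y z => G y x z]

theorem conv₄_self_add {X Y Z U : Type*} [AddCommGroup U] (G : X → X → Y → Z → U)
    (f : MvPowerSeries (Fin N) X) (g : MvPowerSeries (Fin N) Y) (h : MvPowerSeries (Fin N) Z) :
    conv₄ G f f g h + conv₄ G f f g h = conv₄ (fun x y z w => G x y z w + G y x z w) f f g h := by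
  rw [conv₄_add, conv₄_swap_left f g h f fun x y z w => G y x z w]

theorem eq_of_add_self_eq (k : Type*) [Field k] [CharZero k] {U : Type*} [AddCommGroup U]
    [Module k U] {x y : MvPowerSeries (Fin N) U} (h : x + x = y + y) : x = y := by
  funext ν
  have : x ν + x ν = y ν + y ν := congrFun h ν
  rw [← two_smul k, ← two_smul k] at this
  exact smul_right_injective _ (two_ne_zero (α := k)) this

variable [CharZero k]

theorem lieS_anticomm (hm : IsOddS 𝒱 m) (hA : IsOddS 𝒱 A) (h : bracketS 𝒱 m A = 0) :
    lieS 𝒱 1 m * lieS 𝒱 1 A + lieS 𝒱 1 A * lieS 𝒱 1 m = 0 := by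
  have h2 : lieS 𝒱 1 A * lieS 𝒱 1 m = conv (fun y x => lie 𝒱 1 x * lie 𝒱 1 y) m A :=
    (lieS_mul _ _).trans (conv_swap _ _ _)
  have h3 : lieS 𝒱 0 (bracketS 𝒱 m A) =
      conv (fun x y => lie 𝒱 0 (circ 𝒱 x 1 y + circ 𝒱 y 1 x)) m A :=
    map_conv _ _ (AddMonoidHom.mk' (lie 𝒱 0) (lie_add 𝒱 0)) _
  have h1 : lieS 𝒱 1 m * lieS 𝒱 1 A = conv (fun x y => lie 𝒱 1 x * lie 𝒱 1 y) m A :=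
    mul_eq_conv _ _
  rw [h1, h2, ← conv_add]
  refine (conv_congr _ _ fun a b => lie_anticomm (hm a) (hA b)).trans (h3.symm.trans ?_)
  rw [h]
  exact funext fun _ => map_zero (AddMonoidHom.mk' (lie 𝒱 0) (lie_add 𝒱 0))

/-- For `P = Q = m`, `lie_commute_contr_symm` gives twice the commutator, and each term on its right
hand side contains `[m, m]` or `[m, A]`. -/
theorem lieS_commute_contrS (hm : IsOddS 𝒱 m) (hA : IsOddS 𝒱 A)
    (hmm : conv (fun A B => circ 𝒱 A 1 B) m m = 0) (h : bracketS 𝒱 m A = 0) :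
    Commute (lieS 𝒱 1 m) (contrS 𝒱 m 1 A) := by
  have hmm' : bracketS 𝒱 m m = 0 := by rw [bracketS_eq, hmm, add_zero]
  have hc := isBiadditive_contr 𝒱
  have h1 : conv₃ (fun P Q A => contr 𝒱 (circ 𝒱 P 1 Q + circ 𝒱 Q 1 P) 1 A) m m A = 0 :=
    (conv_conv_left _ _ _ (hc 1) _).symm.trans
      ((congrArg (conv _ · A) hmm').trans ((hc 1).conv.zero_left A))
  have h2 : conv₃ (fun P Q A => contr 𝒱 P 0 (circ 𝒱 Q 1 A + circ 𝒱 A 1 Q)) m m A = 0 :=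
    (conv_conv_right _ _ _ (hc 0) _).symm.trans
      ((congrArg _ h).trans ((hc 0).conv.zero_right m))
  have h3 : conv₃ (fun P Q A => contr 𝒱 Q 0 (circ 𝒱 P 1 A + circ 𝒱 A 1 P)) m m A = 0 := by
    rwa [conv₃_swap_left]
  rw [commute_iff_eq, ← sub_eq_zero]
  refine eq_of_add_self_eq k ?_
  have h8 := conv₃_congr m m A
    (G := fun P Q A => lie 𝒱 1 P * contr 𝒱 Q 1 A - contr 𝒱 Q 1 A * lie 𝒱 1 P +
      (lie 𝒱 1 Q * contr 𝒱 P 1 A - contr 𝒱 P 1 A * lie 𝒱 1 Q))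
    (G' := fun P Q A => contr 𝒱 (circ 𝒱 P 1 Q + circ 𝒱 Q 1 P) 1 A -
      contr 𝒱 Q 0 (circ 𝒱 P 1 A + circ 𝒱 A 1 P) - contr 𝒱 P 0 (circ 𝒱 Q 1 A + circ 𝒱 A 1 Q))
    fun a b c => lie_commute_contr_symm (hm a) (hm b) (hA c)
  rw [lieS_mul_contrS, contrS_mul_lieS, ← conv₃_sub, conv₃_self_add, h8, conv₃_sub, conv₃_sub, h1, h2, h3]
  simp

/-- The defects in `lie_brace₂` are linear in `[m, A]` and `[m, B]`, so they vanish for cocycles. -/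
theorem lieS_braceS (hm : IsOddS 𝒱 m) (hA : IsOddS 𝒱 A) (hB : IsOddS 𝒱 B)
    (hmA : bracketS 𝒱 m A = 0) (hmB : bracketS 𝒱 m B = 0) :
    lieS 𝒱 1 (braceS 𝒱 m A B) = contrS 𝒱 m 1 A * lieS 𝒱 1 B + lieS 𝒱 1 A * contrS 𝒱 m 1 B +
      (lieS 𝒱 1 m * lieHomotopyS 𝒱 A B - lieHomotopyS 𝒱 A B * lieS 𝒱 1 m) := by
  have h1 : lieS 𝒱 1 m * lieHomotopyS 𝒱 A B =
      conv₃ (fun P A B => lie 𝒱 1 P * cupLieHomotopy 𝒱 A B) m A B :=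
    (lieS_mul _ _).trans (conv_conv_right _ _ _ (isBiadditive_lie_mul 𝒱 1) _)
  have h2 : lieHomotopyS 𝒱 A B * lieS 𝒱 1 m =
      conv₃ (fun P A B => cupLieHomotopy 𝒱 A B * lie 𝒱 1 P) m A B := by
    rw [conv₃_swap_left, conv₃_swap_right]
    exact (mul_lieS _ _).trans (conv_conv_left _ _ _ (isBiadditive_mul_lie 𝒱 1) _)
  have h3 : conv₃ (fun m A B => cupLieDefectLeft 𝒱 (circ 𝒱 m 1 A + circ 𝒱 A 1 m) B) m A B = 0 :=
    (conv_conv_left _ _ _ (isBiadditive_cupLieDefectLeft 𝒱) _).symm.trans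
      ((congrArg (conv _ · B) hmA).trans ((isBiadditive_cupLieDefectLeft 𝒱).conv.zero_left B))
  have h4 : conv₃ (fun m A B => cupLieDefectRight 𝒱 A (circ 𝒱 m 1 B + circ 𝒱 B 1 m)) m A B = 0 := by
    rw [conv₃_swap_left]
    exact (conv_conv_right _ _ _ (isBiadditive_cupLieDefectRight 𝒱) _).symm.trans
      ((congrArg _ hmB).trans ((isBiadditive_cupLieDefectRight 𝒱).conv.zero_right A))
  have h5 : lieS 𝒱 1 (braceS 𝒱 m A B) =
      conv₃ (fun m A B => lie 𝒱 1 (brace₂ 𝒱 m 1 A 1 B)) m A B :=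
    map_conv₃ _ _ _ (AddMonoidHom.mk' (lie 𝒱 1) (lie_add 𝒱 1)) _
  have h6 : lieS 𝒱 1 A * contrS 𝒱 m 1 B =
      conv₃ (fun m A B => lie 𝒱 1 A * contr 𝒱 m 1 B) m A B := by
    rw [lieS_mul_contrS, conv₃_swap_left]
  have h7 : contrS 𝒱 m 1 A * lieS 𝒱 1 B =
      conv₃ (fun m A B => contr 𝒱 m 1 A * lie 𝒱 1 B) m A B :=
    (mul_lieS _ _).trans (conv_conv_left _ _ _ (isBiadditive_mul_lie 𝒱 1) _)
  rw [h5, h6, h7, h1, h2]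
  have h8 := conv₃_congr m A B (G := fun m A B => lie 𝒱 1 (brace₂ 𝒱 m 1 A 1 B))
    (G' := fun m A B => contr 𝒱 m 1 A * lie 𝒱 1 B + lie 𝒱 1 A * contr 𝒱 m 1 B +
      (lie 𝒱 1 m * cupLieHomotopy 𝒱 A B - cupLieHomotopy 𝒱 A B * lie 𝒱 1 m) -
      cupLieDefectLeft 𝒱 (circ 𝒱 m 1 A + circ 𝒱 A 1 m) B +
      cupLieDefectRight 𝒱 A (circ 𝒱 m 1 B + circ 𝒱 B 1 m))
    fun a b c => lie_brace₂ (hm a) (hA b) (hB c)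
  rw [h8, conv₃_add, conv₃_sub, conv₃_add, conv₃_add, conv₃_sub, h3, h4, sub_zero, add_zero]

/-- Twice the identity is `lie_anticomm_ins_symm` for `P = Q = m`; the terms with `[m, m]`, `[m, A]`
and `[m, B]` drop out. -/
theorem contrS_braceS (hm : IsOddS 𝒱 m) (hA : IsOddS 𝒱 A) (hB : IsOddS 𝒱 B)
    (hmm : conv (fun A B => circ 𝒱 A 1 B) m m = 0)
    (hmA : bracketS 𝒱 m A = 0) (hmB : bracketS 𝒱 m B = 0) :
    contrS 𝒱 m 1 (braceS 𝒱 m A B) = contrS 𝒱 m 1 A * contrS 𝒱 m 1 B -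
      (lieS 𝒱 1 m * contrHomotopyS 𝒱 m A B + contrHomotopyS 𝒱 m A B * lieS 𝒱 1 m) := by
  have hmm' : bracketS 𝒱 m m = 0 := by rw [bracketS_eq, hmm, add_zero]
  have h1 : lieS 𝒱 1 m * contrHomotopyS 𝒱 m A B =
      conv₄ (fun P Q A B => lie 𝒱 1 P * ins 𝒱 Q (coder₂ 𝒱 1 A 1 B)) m m A B :=
    (lieS_mul _ _).trans (conv_conv₃_right _ _ _ _ (isBiadditive_lie_mul 𝒱 1) _)
  have h2 : contrHomotopyS 𝒱 m A B * lieS 𝒱 1 m =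
      conv₄ (fun P Q A B => ins 𝒱 Q (coder₂ 𝒱 1 A 1 B) * lie 𝒱 1 P) m m A B := by
    rw [conv₄_swap_left, conv₄_swap_mid, conv₄_swap_right]
    exact (mul_lieS _ _).trans (conv_conv₃_left _ _ _ _ (isBiadditive_mul_lie 𝒱 1) _)
  have h3 : contrS 𝒱 m 1 A * contrS 𝒱 m 1 B =
      conv₄ (fun P Q A B => contr 𝒱 Q 1 A * contr 𝒱 P 1 B) m m A B := by
    rw [conv₄_swap_left, conv₄_swap_mid]
    exact (mul_eq_conv _ _).trans (conv_conv_conv _ _ _ _ isBiadditive_mul _ _)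
  have h4 : contrS 𝒱 m 1 (braceS 𝒱 m A B) =
      conv₄ (fun P Q A B => contr 𝒱 Q 1 (brace₂ 𝒱 P 1 A 1 B)) m m A B := by
    rw [conv₄_swap_left]
    exact conv_conv₃_right _ _ _ _ (isBiadditive_contr 𝒱 1) _
  have h5 : conv₄ (fun P Q A B => ins 𝒱 (circ 𝒱 P 1 Q + circ 𝒱 Q 1 P) (coder₂ 𝒱 1 A 1 B))
      m m A B = 0 := by
    have := conv₃_conv_left (G := fun Q A B => ins 𝒱 Q (coder₂ 𝒱 1 A 1 B)) m A B m
      (fun _ _ _ _ => ins_add_left ..) (fun A B => circ 𝒱 A 1 B + circ 𝒱 B 1 A)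
    rw [← this, ← bracketS, hmm']
    exact conv₃_zero_left _ _ (fun _ _ _ _ => ins_add_left ..)
  have h6 : conv₄ (fun Q P A B => ins 𝒱 Q (coder₂ 𝒱 0 (circ 𝒱 P 1 A + circ 𝒱 A 1 P) 1 B))
      m m A B = 0 := by
    have H : ∀ Q B A A', ins 𝒱 Q (coder₂ 𝒱 0 (A + A') 1 B) =
        ins 𝒱 Q (coder₂ 𝒱 0 A 1 B) + ins 𝒱 Q (coder₂ 𝒱 0 A' 1 B) := fun _ _ _ _ => by
      rw [coder₂_add_left, ins_add_right]
    have := conv₃_conv_mid (G := fun Q A B => ins 𝒱 Q (coder₂ 𝒱 0 A 1 B)) m A B m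
      H (fun A B => circ 𝒱 A 1 B + circ 𝒱 B 1 A)
    rw [← this, ← bracketS, hmA, conv₃_swap_left]
    exact conv₃_zero_left (G := fun A Q B => ins 𝒱 Q (coder₂ 𝒱 0 A 1 B)) _ _ H
  have h7 : conv₄ (fun Q P A B => ins 𝒱 Q (coder₂ 𝒱 1 A 0 (circ 𝒱 P 1 B + circ 𝒱 B 1 P)))
      m m A B = 0 := by
    have H : ∀ Q A B B', ins 𝒱 Q (coder₂ 𝒱 1 A 0 (B + B')) =
        ins 𝒱 Q (coder₂ 𝒱 1 A 0 B) + ins 𝒱 Q (coder₂ 𝒱 1 A 0 B') := fun _ _ _ _ => by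
      rw [coder₂_add_right, ins_add_right]
    have := conv₃_conv_right (G := fun Q A B => ins 𝒱 Q (coder₂ 𝒱 1 A 0 B)) m A B m
      H (fun A B => circ 𝒱 A 1 B + circ 𝒱 B 1 A)
    rw [conv₄_swap_mid, ← this, ← bracketS, hmB, conv₃_swap_right, conv₃_swap_left]
    exact conv₃_zero_left (G := fun B Q A => ins 𝒱 Q (coder₂ 𝒱 1 A 0 B)) _ _
      fun _ _ _ _ => H ..
  have h8 : lieS 𝒱 1 m * contrHomotopyS 𝒱 m A B + contrHomotopyS 𝒱 m A B * lieS 𝒱 1 m =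
      contrS 𝒱 m 1 A * contrS 𝒱 m 1 B - contrS 𝒱 m 1 (braceS 𝒱 m A B) := by
    have hD : contrS 𝒱 m 1 A * contrS 𝒱 m 1 B - contrS 𝒱 m 1 (braceS 𝒱 m A B) =
        conv₄ (fun P Q A B => contr 𝒱 Q 1 A * contr 𝒱 P 1 B - contr 𝒱 Q 1 (brace₂ 𝒱 P 1 A 1 B) -
          ins 𝒱 Q (coder₂ 𝒱 0 (circ 𝒱 P 1 A + circ 𝒱 A 1 P) 1 B) +
          ins 𝒱 Q (coder₂ 𝒱 1 A 0 (circ 𝒱 P 1 B + circ 𝒱 B 1 P))) m m A B := by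
      rw [conv₄_add, conv₄_sub, conv₄_sub, h3, h4, conv₄_swap_left m A B m fun P Q A B =>
        ins 𝒱 Q (coder₂ 𝒱 0 (circ 𝒱 P 1 A + circ 𝒱 A 1 P) 1 B), h6, conv₄_swap_left m A B m
        fun P Q A B => ins 𝒱 Q (coder₂ 𝒱 1 A 0 (circ 𝒱 P 1 B + circ 𝒱 B 1 P)), h7, sub_zero,
        add_zero]
    have h9 := conv₄_congr m A B m
      (G := fun P Q A B => lie 𝒱 1 P * ins 𝒱 Q (coder₂ 𝒱 1 A 1 B) +
        ins 𝒱 Q (coder₂ 𝒱 1 A 1 B) * lie 𝒱 1 P +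
        (lie 𝒱 1 Q * ins 𝒱 P (coder₂ 𝒱 1 A 1 B) + ins 𝒱 P (coder₂ 𝒱 1 A 1 B) * lie 𝒱 1 Q))
      (G' := fun P Q A B => ins 𝒱 (circ 𝒱 P 1 Q + circ 𝒱 Q 1 P) (coder₂ 𝒱 1 A 1 B) +
        (contr 𝒱 Q 1 A * contr 𝒱 P 1 B - contr 𝒱 Q 1 (brace₂ 𝒱 P 1 A 1 B) -
          ins 𝒱 Q (coder₂ 𝒱 0 (circ 𝒱 P 1 A + circ 𝒱 A 1 P) 1 B) +
          ins 𝒱 Q (coder₂ 𝒱 1 A 0 (circ 𝒱 P 1 B + circ 𝒱 B 1 P))) +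
        (contr 𝒱 P 1 A * contr 𝒱 Q 1 B - contr 𝒱 P 1 (brace₂ 𝒱 Q 1 A 1 B) -
          ins 𝒱 P (coder₂ 𝒱 0 (circ 𝒱 Q 1 A + circ 𝒱 A 1 Q) 1 B) +
          ins 𝒱 P (coder₂ 𝒱 1 A 0 (circ 𝒱 Q 1 B + circ 𝒱 B 1 Q))))
      fun d a b c => lie_anticomm_ins_symm (hm d) (hm a) (hA b) (hB c)
    refine eq_of_add_self_eq k ?_
    rw [h1, h2, ← conv₄_add, conv₄_self_add, h9, hD, conv₄_self_add]
    simp only [add_assoc]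
    rw [conv₄_add, h5, zero_add]
  rw [h8]
  abel

end SeriesIdentities

/-! ### Degrees of operators on words and chains -/

section Degrees

variable {k V : Type*} [Field k] [AddCommGroup V] [Module k V]
variable (𝒱 : ℤ → Submodule k V) [DirectSum.Decomposition 𝒱]

local notation "T" => TensorAlgebra k V
local notation "C" => Chain k V
local infixl:70 "⋆" => star

omit [DirectSum.Decomposition 𝒱] in
/-- The words of degree `q`. -/
def wordDeg (q : ℤ) : Submodule k (TensorAlgebra k V) :=
  Submodule.span k {x | ∃ l : List (Σ i : ℤ, 𝒱 i), degList 𝒱 l = q ∧ x = homWord 𝒱 l}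

/-- Operators on words that are homogeneous of degree `r`. -/
def IsHomWordOp (r : ℤ) (f : T →ₗ[k] T) : Prop :=
  ∀ l, f (homWord 𝒱 l) ∈ wordDeg 𝒱 (degList 𝒱 l + r)

/-- Maps from marked words to `V` that are homogeneous of degree `r`. -/
def IsHomMark (r : ℤ) (Φ : T ⊗[k] C →ₗ[k] V) : Prop :=
  ∀ (z : List (Σ i : ℤ, 𝒱 i)) (a : Σ i : ℤ, 𝒱 i) (l : List (Σ i : ℤ, 𝒱 i)),
    Φ (homWord 𝒱 z ⊗ₜ ((a.2 : V) ⊗ₜ homWord 𝒱 l)) ∈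
      𝒱 (degList 𝒱 z + (a.1 + degList 𝒱 l) + r)

variable {𝒱}

section Words

omit [DirectSum.Decomposition 𝒱]

theorem homWord_mem (l : List (Σ i : ℤ, 𝒱 i)) : homWord 𝒱 l ∈ wordDeg 𝒱 (degList 𝒱 l) :=
  Submodule.subset_span ⟨l, rfl, rfl⟩

theorem map_mem_of_wordDeg {X : Type*} [AddCommGroup X] [Module k X] {f : T →ₗ[k] X} {q : ℤ}
    {S : Submodule k X} (h : ∀ l, degList 𝒱 l = q → f (homWord 𝒱 l) ∈ S) {x : T}
    (hx : x ∈ wordDeg 𝒱 q) : f x ∈ S := by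
  have : wordDeg 𝒱 q ≤ S.comap f := Submodule.span_le.2 (by rintro _ ⟨l, hl, rfl⟩; exact h l hl)
  exact this hx

theorem IsHomCochain.mem {r : ℤ} {A : Cochain k V} (hA : IsHomCochain 𝒱 r A) {q : ℤ} {x : T}
    (hx : x ∈ wordDeg 𝒱 q) : A x ∈ 𝒱 (q + r) :=
  map_mem_of_wordDeg (fun l hl => hl ▸ hA l) hx

theorem wordDeg_mul {p q : ℤ} {x y : T} (hx : x ∈ wordDeg 𝒱 p) (hy : y ∈ wordDeg 𝒱 q) :
    x * y ∈ wordDeg 𝒱 (p + q) := by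
  refine map_mem_of_wordDeg (f := LinearMap.mulRight k y) (fun l hl => ?_) hx
  refine map_mem_of_wordDeg (f := LinearMap.mulLeft k (homWord 𝒱 l)) (fun l' hl' => ?_) hy
  rw [LinearMap.mulLeft_apply, ← homWord_append, ← hl, ← hl', ← degList_append]
  exact homWord_mem _

theorem ι_mem_wordDeg {i : ℤ} {a : V} (ha : a ∈ 𝒱 i) : TensorAlgebra.ι k a ∈ wordDeg 𝒱 i := by
  simpa [homWord, word, degList] using homWord_mem (𝒱 := 𝒱) [⟨i, a, ha⟩]

theorem tmul_mem_chainDeg {i j : ℤ} {a : V} {x : T} (ha : a ∈ 𝒱 i) (hx : x ∈ wordDeg 𝒱 j) :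
    a ⊗ₜ[k] x ∈ chainDeg 𝒱 (i + j) :=
  map_mem_of_wordDeg (f := TensorProduct.mk k V T a)
    (S := chainDeg 𝒱 (i + j))
    (fun l hl => Submodule.subset_span ⟨⟨i, ⟨a, ha⟩⟩, l, by rw [hl], rfl⟩) hx

theorem isHomWordOp_id : IsHomWordOp 𝒱 0 (.id : T →ₗ[k] T) := fun l => by
  simpa using homWord_mem l

theorem IsHomCochain.ι_comp {r : ℤ} {A : Cochain k V} (hA : IsHomCochain 𝒱 r A) :
    IsHomWordOp 𝒱 r (TensorAlgebra.ι k ∘ₗ A) := fun l => ι_mem_wordDeg (hA l)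

theorem IsHomWordOp.star {r s : ℤ} {f g : T →ₗ[k] T} (hf : IsHomWordOp 𝒱 r f)
    (hg : IsHomWordOp 𝒱 s g) : IsHomWordOp 𝒱 (r + s) (f ⋆ g) := fun l => by
  rw [AInf.star, LinearMap.comp_apply, LinearMap.comp_apply, deconc_homWord, map_spl, map_spl]
  refine spl_mem _ fun u v h => ?_
  rw [← h, degList_append, TensorProduct.map_tmul, LinearMap.mul'_apply, add_add_add_comm]
  exact wordDeg_mul (hf u) (hg v)

theorem IsHomCochain.comp {r s : ℤ} {A : Cochain k V} {f : T →ₗ[k] T} (hA : IsHomCochain 𝒱 r A)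
    (hf : IsHomWordOp 𝒱 s f) : IsHomCochain 𝒱 (s + r) (A ∘ₗ f) := fun l => by
  rw [← add_assoc]; exact hA.mem (hf l)

theorem IsHomCochain.glue_rTensor {r s : ℤ} {A : Cochain k V} {f : T →ₗ[k] T}
    (hA : IsHomCochain 𝒱 r A) (hf : IsHomWordOp 𝒱 s f) :
    IsHomMark 𝒱 (r + s) (A ∘ₗ glue k V ∘ₗ LinearMap.rTensor C f) := fun z a l => by
  have := hA.mem (wordDeg_mul (hf z) (wordDeg_mul (ι_mem_wordDeg a.2.2) (homWord_mem l)))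
  simp only [LinearMap.comp_apply, LinearMap.rTensor_tmul, glue_tmul]
  convert this using 2
  ring

theorem IsHomCochain.glue {r : ℤ} {A : Cochain k V} (hA : IsHomCochain 𝒱 r A) :
    IsHomMark 𝒱 r (A ∘ₗ glue k V) := by
  have := hA.glue_rTensor isHomWordOp_id
  rwa [LinearMap.rTensor_id, LinearMap.comp_id, add_zero] at this

end Words

theorem sgn_mem (p : ℤ) {i : ℤ} {a : V} (ha : a ∈ 𝒱 i) : sgn 𝒱 p a ∈ 𝒱 i := by
  rw [sgn_of_mem 𝒱 p i ha]; exact Submodule.smul_mem _ _ ha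

theorem isHomWordOp_tsgn (p : ℤ) : IsHomWordOp 𝒱 0 (tsgn 𝒱 p).toLinearMap := fun l => by
  rw [AlgHom.toLinearMap_apply, tsgn_homWord, add_zero]
  exact Submodule.smul_mem _ _ (homWord_mem l)

omit [DirectSum.Decomposition 𝒱] in
theorem isHomMark_mark {σ : V →ₗ[k] V} (h : ∀ i, ∀ a ∈ 𝒱 i, σ a ∈ 𝒱 i) :
    IsHomMark 𝒱 0 (mark σ) := fun z a l => by
  rw [mark_tmul]
  rcases z with _ | ⟨b, z⟩
  · rcases l with _ | ⟨c, l⟩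
    · simpa [homWord, degList] using h _ _ a.2.2
    · simp [homWord]
  · simp [homWord]

theorem IsHomMark.sgn_comp {r : ℤ} {Φ : T ⊗[k] C →ₗ[k] V} (h : IsHomMark 𝒱 r Φ) (p : ℤ) :
    IsHomMark 𝒱 r (sgn 𝒱 p ∘ₗ Φ) := fun z a l => sgn_mem p (h z a l)

theorem IsHomCochain.coder {r : ℤ} {A : Cochain k V} (hA : IsHomCochain 𝒱 r A) (p : ℤ) :
    IsHomWordOp 𝒱 r (coder 𝒱 p A) := by
  have := (isHomWordOp_tsgn (𝒱 := 𝒱) p).star (hA.ι_comp.star isHomWordOp_id)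
  rwa [← coder_eq, zero_add, add_zero] at this

theorem IsHomCochain.coder₂ {r s : ℤ} {A B : Cochain k V} (hA : IsHomCochain 𝒱 r A)
    (hB : IsHomCochain 𝒱 s B) (p q : ℤ) : IsHomWordOp 𝒱 (r + s) (coder₂ 𝒱 p A q B) := by
  have := (isHomWordOp_tsgn (𝒱 := 𝒱) (p + q)).star
    ((hA.comp (isHomWordOp_tsgn (𝒱 := 𝒱) q)).ι_comp.star (hB.coder q))
  rwa [← coder₂_eq, zero_add, zero_add] at this

theorem IsHomCochain.brace₂ {t r s : ℤ} {Q A B : Cochain k V} (hQ : IsHomCochain 𝒱 t Q)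
    (hA : IsHomCochain 𝒱 r A) (hB : IsHomCochain 𝒱 s B) (p q : ℤ) :
    IsHomCochain 𝒱 (r + s + t) (brace₂ 𝒱 Q p A q B) :=
  hQ.comp (hA.coder₂ hB p q)

/-- Links degrees to the parity operators, which are all that the identities above refer to. -/
theorem IsHomCochain.isOdd {r : ℤ} {A : Cochain k V} (hA : IsHomCochain 𝒱 r A) (hr : Odd r) :
    IsOddCochain 𝒱 A := by
  refine ext_homWord 𝒱 fun l => ?_
  rw [LinearMap.comp_apply, sgn_of_mem 𝒱 _ _ (hA l), LinearMap.neg_apply, LinearMap.comp_apply,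
    AlgHom.toLinearMap_apply, tsgn_homWord, map_smul, mul_add, zpow_add₀ (by simp), one_mul, one_mul,
    hr.neg_one_zpow]
  simp

section Operators

omit [DirectSum.Decomposition 𝒱] in
theorem IsHomOp.add {r : ℤ} {f g : Module.End k C} (hf : IsHomOp 𝒱 r f) (hg : IsHomOp 𝒱 r g) :
    IsHomOp 𝒱 r (f + g) := fun q x hx => add_mem (hf q x hx) (hg q x hx)

omit [DirectSum.Decomposition 𝒱] in
theorem IsHomOp.sub {r : ℤ} {f g : Module.End k C} (hf : IsHomOp 𝒱 r f) (hg : IsHomOp 𝒱 r g) :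
    IsHomOp 𝒱 r (f - g) := fun q x hx => sub_mem (hf q x hx) (hg q x hx)

omit [DirectSum.Decomposition 𝒱] in
theorem IsHomOp.smul {r : ℤ} {f : Module.End k C} (hf : IsHomOp 𝒱 r f) (c : k) :
    IsHomOp 𝒱 r (c • f) := fun q x hx => Submodule.smul_mem _ _ (hf q x hx)

omit [DirectSum.Decomposition 𝒱] in
theorem isHomOp_zero (r : ℤ) : IsHomOp 𝒱 r 0 := fun _ _ _ => zero_mem _

omit [DirectSum.Decomposition 𝒱] in
theorem IsHomOp.mul {r s : ℤ} {f g : Module.End k C} (hf : IsHomOp 𝒱 r f) (hg : IsHomOp 𝒱 s g) :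
    IsHomOp 𝒱 (r + s) (f * g) := fun q x hx => by
  rw [add_comm r, ← add_assoc]; exact hf _ _ (hg q x hx)

omit [DirectSum.Decomposition 𝒱] in
theorem isHomOp_of_forall {r : ℤ} {f : Module.End k C}
    (h : ∀ (a : Σ i : ℤ, 𝒱 i) (l : List (Σ i : ℤ, 𝒱 i)),
      f ((a.2 : V) ⊗ₜ homWord 𝒱 l) ∈ chainDeg 𝒱 (a.1 + degList 𝒱 l + r)) : IsHomOp 𝒱 r f := by
  intro q x hx
  have : chainDeg 𝒱 q ≤ (chainDeg 𝒱 (q + r)).comap f :=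
    Submodule.span_le.2 (by rintro _ ⟨a, l, rfl, rfl⟩; exact h a l)
  exact this hx

variable [CharZero k]

theorem IsHomMark.lam {r s : ℤ} {Φ : T ⊗[k] C →ₗ[k] V} {g : T →ₗ[k] T} (hΦ : IsHomMark 𝒱 r Φ)
    (hg : IsHomWordOp 𝒱 s g) : IsHomOp 𝒱 (r + s) (lam 𝒱 Φ g) :=
  isHomOp_of_forall fun a l => by
    rw [AInf.lam, LinearMap.comp_apply, rot_homChain 𝒱 a.2.2, map_spl]
    refine spl_mem _ fun u v h => ?_
    have hw : wrapG Φ g (homWord 𝒱 v ⊗ₜ ((a.2 : V) ⊗ₜ homWord 𝒱 u)) =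
        spl u fun x y => Φ (homWord 𝒱 v ⊗ₜ ((a.2 : V) ⊗ₜ homWord 𝒱 x)) ⊗ₜ g (homWord 𝒱 y) := by
      simp only [wrapG, LinearMap.comp_apply, LinearMap.lTensor_tmul, coact_homWord, tmul_spl,
        map_spl, LinearEquiv.coe_coe, TensorProduct.assoc_symm_tmul, TensorProduct.map_tmul]
    rw [map_smul, hw]
    refine Submodule.smul_mem _ _ (spl_mem _ fun x y h' => ?_)
    have := tmul_mem_chainDeg (hΦ v a x) (hg y)
    rw [← h, ← h', degList_append, degList_append]
    convert this using 2
    ring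

theorem IsHomCochain.lie {r : ℤ} {A : Cochain k V} (hA : IsHomCochain 𝒱 r A) :
    IsHomOp 𝒱 r (lie 𝒱 1 A) := by
  rw [lie_eq]
  refine IsHomOp.add ?_ ?_
  · simpa using (isHomMark_mark fun _ _ => sgn_mem 1).lam (hA.coder 1)
  · simpa using hA.glue.lam isHomWordOp_id

theorem IsHomCochain.ins {r s : ℤ} {Q : Cochain k V} {U : T →ₗ[k] T} (hQ : IsHomCochain 𝒱 r Q)
    (hU : IsHomWordOp 𝒱 s U) : IsHomOp 𝒱 (r + s) (ins 𝒱 Q U) := by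
  have := (hQ.glue_rTensor hU).lam isHomWordOp_id
  rw [add_zero] at this
  exact this

theorem IsHomCochain.contr {r s : ℤ} {Q A : Cochain k V} (hQ : IsHomCochain 𝒱 r Q)
    (hA : IsHomCochain 𝒱 s A) : IsHomOp 𝒱 (r + s) (contr 𝒱 Q 1 A) := by
  rw [contr_eq_ins]; exact hQ.ins (hA.coder 1)

theorem IsHomCochain.cupLieHomotopy {r s : ℤ} {A B : Cochain k V} (hA : IsHomCochain 𝒱 r A)
    (hB : IsHomCochain 𝒱 s B) : IsHomOp 𝒱 (r + s) (cupLieHomotopy 𝒱 A B) := by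
  refine IsHomOp.add (IsHomOp.sub ?_ ?_) (hA.contr hB)
  · simpa using (isHomMark_mark (σ := LinearMap.id) fun _ _ h => h).lam (hA.coder₂ hB 1 1)
  · exact (hA.glue.sgn_comp 1).lam (hB.coder 1)

end Operators

end Degrees

/-! ### Total degrees of power series -/

section SeriesDegrees

open Finset.HasAntidiagonal (antidiagonal mem_antidiagonal)

variable {k V : Type*} [Field k] [AddCommGroup V] [Module k V]
variable (𝒱 : ℤ → Submodule k V) [DirectSum.Decomposition 𝒱] {N : ℕ} {d : Fin N → ℤ}

theorem wt_add (μ ν : Fin N →₀ ℕ) : wt d (μ + ν) = wt d μ + wt d ν := by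
  simp [wt, add_mul, Finset.sum_add_distrib]

theorem wt_single (j : Fin N) : wt d (Finsupp.single j 1) = d j := by
  simp [wt, Finsupp.single_apply]

theorem even_wt (hd : ∀ i, Even (d i)) (ν : Fin N →₀ ℕ) : Even (wt d ν) :=
  Finset.even_sum _ fun i _ => (hd i).mul_left _

/-- Power series of cochains of total degree `r`. -/
def IsHomCochainS (d : Fin N → ℤ) (r : ℤ) (A : MvPowerSeries (Fin N) (Cochain k V)) : Prop :=
  ∀ ν, IsHomCochain 𝒱 (r - wt d ν) (A ν)

variable {𝒱} {r s t : ℤ}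

omit [DirectSum.Decomposition 𝒱] in
theorem IsHomCochain.add {A B : Cochain k V} (hA : IsHomCochain 𝒱 r A) (hB : IsHomCochain 𝒱 r B) :
    IsHomCochain 𝒱 r (A + B) := fun l => add_mem (hA l) (hB l)

omit [DirectSum.Decomposition 𝒱] in
theorem isHomCochain_zero : IsHomCochain 𝒱 r 0 := fun _ => zero_mem _

omit [DirectSum.Decomposition 𝒱] in
theorem IsHomCochain.smul {A : Cochain k V} (hA : IsHomCochain 𝒱 r A) (c : k) :
    IsHomCochain 𝒱 r (c • A) := fun l => Submodule.smul_mem _ _ (hA l)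

omit [DirectSum.Decomposition 𝒱] in
theorem IsHomCochain.sum {ι : Type*} {f : ι → Cochain k V} {S : Finset ι}
    (h : ∀ i ∈ S, IsHomCochain 𝒱 r (f i)) : IsHomCochain 𝒱 r (∑ i ∈ S, f i) :=
  Finset.sum_induction _ _ (fun _ _ => IsHomCochain.add) isHomCochain_zero h

omit [DirectSum.Decomposition 𝒱] in
theorem IsHomOp.sum {ι : Type*} {f : ι → Module.End k (Chain k V)} {S : Finset ι}
    (h : ∀ i ∈ S, IsHomOp 𝒱 r (f i)) : IsHomOp 𝒱 r (∑ i ∈ S, f i) :=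
  Finset.sum_induction _ _ (fun _ _ => IsHomOp.add) (isHomOp_zero r) h

theorem IsHomCochainS.isOddS {A : MvPowerSeries (Fin N) (Cochain k V)}
    (hA : IsHomCochainS 𝒱 d r A) (hd : ∀ i, Even (d i)) (hr : Odd r) : IsOddS 𝒱 A :=
  fun ν => (hA ν).isOdd (hr.sub_even (even_wt hd ν))

omit [DirectSum.Decomposition 𝒱] in
theorem IsHomCochainS.pd {A : MvPowerSeries (Fin N) (Cochain k V)} (hA : IsHomCochainS 𝒱 d r A)
    (j : Fin N) : IsHomCochainS 𝒱 d (r - d j) (pd j A) := fun ν => by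
  have := (hA (ν + Finsupp.single j 1)).smul ((ν j + 1 : ℕ) : k)
  rw [wt_add, wt_single, add_comm, ← sub_sub, Nat.cast_smul_eq_nsmul] at this
  exact this

theorem IsHomCochainS.braceS {m A B : MvPowerSeries (Fin N) (Cochain k V)}
    (hm : IsHomCochainS 𝒱 d t m) (hA : IsHomCochainS 𝒱 d r A) (hB : IsHomCochainS 𝒱 d s B) :
    IsHomCochainS 𝒱 d (r + s + t) (braceS 𝒱 m A B) := fun ν =>
  IsHomCochain.sum fun e he => IsHomCochain.sum fun e' he' => by
    have := (hm e.1).brace₂ (hA e'.1) (hB e'.2) 1 1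
    rw [← mem_antidiagonal.1 he, ← mem_antidiagonal.1 he', wt_add, wt_add]
    convert this using 1
    ring

variable {U W : MvPowerSeries (Fin N) (Module.End k (Chain k V))}

omit [DirectSum.Decomposition 𝒱] in
theorem IsHomOpS.add (hU : IsHomOpS 𝒱 d r U) (hW : IsHomOpS 𝒱 d r W) : IsHomOpS 𝒱 d r (U + W) :=
  fun ν => (hU ν).add (hW ν)

omit [DirectSum.Decomposition 𝒱] in
theorem IsHomOpS.sub (hU : IsHomOpS 𝒱 d r U) (hW : IsHomOpS 𝒱 d r W) : IsHomOpS 𝒱 d r (U - W) :=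
  fun ν => (hU ν).sub (hW ν)

omit [DirectSum.Decomposition 𝒱] in
theorem isHomOpS_zero : IsHomOpS 𝒱 d r 0 := fun _ => isHomOp_zero _

omit [DirectSum.Decomposition 𝒱] in
theorem IsHomOpS.sum {ι : Type*} {f : ι → MvPowerSeries (Fin N) (Module.End k (Chain k V))}
    {S : Finset ι} (h : ∀ i ∈ S, IsHomOpS 𝒱 d r (f i)) : IsHomOpS 𝒱 d r (∑ i ∈ S, f i) :=
  Finset.sum_induction _ _ (fun _ _ => IsHomOpS.add) isHomOpS_zero h

omit [DirectSum.Decomposition 𝒱] in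
theorem IsHomOpS.mul (hU : IsHomOpS 𝒱 d r U) (hW : IsHomOpS 𝒱 d s W) :
    IsHomOpS 𝒱 d (r + s) (U * W) := by
  rw [mul_eq_conv]
  refine fun ν => IsHomOp.sum fun e he => ?_
  have := (hU e.1).mul (hW e.2)
  rw [← mem_antidiagonal.1 he, wt_add]
  convert this using 1
  ring

omit [DirectSum.Decomposition 𝒱] in
theorem isHomOpS_one : IsHomOpS 𝒱 d 0 1 := fun ν => by
  classical
  have : (1 : MvPowerSeries (Fin N) (Module.End k (Chain k V))) ν = if ν = 0 then 1 else 0 :=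
    MvPowerSeries.coeff_one ..
  rw [this]
  split_ifs with h
  · subst h
    intro q x hx
    simpa [wt] using hx
  · exact isHomOp_zero _

omit [DirectSum.Decomposition 𝒱] in
theorem IsHomOpS.pd (hU : IsHomOpS 𝒱 d r U) (j : Fin N) : IsHomOpS 𝒱 d (r - d j) (pd j U) :=
  fun ν => by
  have := (hU (ν + Finsupp.single j 1)).smul ((ν j + 1 : ℕ) : k)
  rw [wt_add, wt_single, add_comm, ← sub_sub, Nat.cast_smul_eq_nsmul] at this
  exact this

variable [CharZero k] {m A B : MvPowerSeries (Fin N) (Cochain k V)}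

theorem IsHomCochainS.lieS (hA : IsHomCochainS 𝒱 d r A) : IsHomOpS 𝒱 d r (lieS 𝒱 1 A) :=
  fun ν => (hA ν).lie

theorem IsHomCochainS.contrS (hm : IsHomCochainS 𝒱 d t m) (hA : IsHomCochainS 𝒱 d r A) :
    IsHomOpS 𝒱 d (t + r) (contrS 𝒱 m 1 A) := fun ν => IsHomOp.sum fun e he => by
  have := (hm e.1).contr (hA e.2)
  rw [← mem_antidiagonal.1 he, wt_add]
  convert this using 1
  ring

theorem IsHomCochainS.lieHomotopyS (hA : IsHomCochainS 𝒱 d r A) (hB : IsHomCochainS 𝒱 d s B) :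
    IsHomOpS 𝒱 d (r + s) (lieHomotopyS 𝒱 A B) := fun ν => IsHomOp.sum fun e he => by
  have := (hA e.1).cupLieHomotopy (hB e.2)
  rw [← mem_antidiagonal.1 he, wt_add]
  convert this using 1
  ring

theorem IsHomCochainS.contrHomotopyS (hm : IsHomCochainS 𝒱 d t m) (hA : IsHomCochainS 𝒱 d r A)
    (hB : IsHomCochainS 𝒱 d s B) : IsHomOpS 𝒱 d (t + (r + s)) (contrHomotopyS 𝒱 m A B) :=
  fun ν => IsHomOp.sum fun e he => IsHomOp.sum fun e' he' => by
    have := (hm e.1).ins ((hA e'.1).coder₂ (hB e'.2) 1 1)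
    rw [← mem_antidiagonal.1 he, ← mem_antidiagonal.1 he', wt_add, wt_add]
    convert this using 1
    ring

end SeriesDegrees

/-! ### Orders of vanishing in `t₀` -/

section Truncation

open Finset.HasAntidiagonal (antidiagonal mem_antidiagonal)

variable {n : ℕ} {X Y Z : Type*}

/-- The power series `f` vanishes up to the order `s` in `t₀`. -/
def VanishesTo [Zero X] (s : ℕ) (f : MvPowerSeries (Fin (n + 1)) X) : Prop :=
  ∀ ν : Fin (n + 1) →₀ ℕ, ν 0 < s → f ν = 0

theorem eq_zero_of_vanishesTo [Zero X] {f : MvPowerSeries (Fin (n + 1)) X}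
    (h : ∀ s, VanishesTo s f) : f = 0 :=
  funext fun ν => h _ ν (Nat.lt_succ_self _)

theorem fst_zero_le {e : (Fin (n + 1) →₀ ℕ) × (Fin (n + 1) →₀ ℕ)} {ν : Fin (n + 1) →₀ ℕ}
    (h : e ∈ antidiagonal ν) : e.1 0 ≤ ν 0 := by
  rw [← mem_antidiagonal.1 h]; simp

theorem snd_zero_le {e : (Fin (n + 1) →₀ ℕ) × (Fin (n + 1) →₀ ℕ)} {ν : Fin (n + 1) →₀ ℕ}
    (h : e ∈ antidiagonal ν) : e.2 0 ≤ ν 0 := by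
  rw [← mem_antidiagonal.1 h]; simp

theorem exists_eq_add_single {ν : Fin (n + 1) →₀ ℕ} (h : ν 0 ≠ 0) :
    ∃ μ : Fin (n + 1) →₀ ℕ, ν = μ + Finsupp.single 0 1 ∧ ν 0 = μ 0 + 1 := by
  have h1 : ν - Finsupp.single 0 1 + Finsupp.single 0 1 = ν :=
    tsub_add_cancel_of_le (by simpa [Nat.one_le_iff_ne_zero] using h)
  refine ⟨ν - Finsupp.single 0 1, h1.symm, ?_⟩
  have h2 := DFunLike.congr_fun h1 0
  rw [Finsupp.add_apply, Finsupp.single_eq_same] at h2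
  exact h2.symm

theorem cons_zero_tail {ν : Fin (n + 1) →₀ ℕ} (h : ν 0 = 0) :
    Finsupp.cons 0 (Finsupp.tail ν) = ν := by
  rw [← h]; exact Finsupp.cons_tail ν

section Vanishing

variable [AddCommGroup X] [AddCommGroup Y] [AddCommGroup Z] {s : ℕ}

theorem VanishesTo.add {f g : MvPowerSeries (Fin (n + 1)) X} (hf : VanishesTo s f)
    (hg : VanishesTo s g) : VanishesTo s (f + g) := fun ν hν => by
  change f ν + g ν = 0; rw [hf ν hν, hg ν hν, add_zero]

theorem VanishesTo.sub {f g : MvPowerSeries (Fin (n + 1)) X} (hf : VanishesTo s f)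
    (hg : VanishesTo s g) : VanishesTo s (f - g) := fun ν hν => by
  change f ν - g ν = 0; rw [hf ν hν, hg ν hν, sub_zero]

theorem VanishesTo.sum {ι : Type*} {S : Finset ι} {f : ι → MvPowerSeries (Fin (n + 1)) X}
    (h : ∀ i ∈ S, VanishesTo s (f i)) : VanishesTo s (∑ i ∈ S, f i) :=
  Finset.sum_induction _ _ (fun _ _ => VanishesTo.add) (fun _ _ => rfl) h

omit [AddCommGroup X] in
theorem VanishesTo.conv_right {B : X → Y → Z} (hB : ∀ x, B x 0 = 0)
    (f : MvPowerSeries (Fin (n + 1)) X) {g : MvPowerSeries (Fin (n + 1)) Y} (hg : VanishesTo s g) :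
    VanishesTo s (conv B f g) := fun ν hν => Finset.sum_eq_zero fun e he => by
  rw [hg _ ((snd_zero_le he).trans_lt hν), hB]

omit [AddCommGroup Y] [AddCommGroup Z] in
theorem VanishesTo.conv₃_left {W : Type*} [AddCommGroup W] {G : X → Y → Z → W}
    (hG : ∀ y z, G 0 y z = 0) {f : MvPowerSeries (Fin (n + 1)) X}
    (g : MvPowerSeries (Fin (n + 1)) Y) (h : MvPowerSeries (Fin (n + 1)) Z)
    (hf : VanishesTo s f) : VanishesTo s (conv₃ G f g h) := fun ν hν =>
  Finset.sum_eq_zero fun e he => Finset.sum_eq_zero fun e' he' => by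
    rw [hf _ ((fst_zero_le he).trans_lt hν), hG]

/-- Derivatives by `t_1, …, t_n` do not touch the exponent of `t₀`, so no order is lost. -/
theorem VanishesTo.pd_succ {f : MvPowerSeries (Fin (n + 1)) X} (hf : VanishesTo s f) (j : Fin n) :
    VanishesTo s (pd j.succ f) := fun ν hν => by
  have : f (ν + Finsupp.single j.succ 1) = 0 := hf _ (by simpa using hν)
  rw [pd, this, smul_zero]

/-- Induction on the order in `t₀`. -/
theorem eq_zero_of_pd_zero {k : Type*} [Field k] [CharZero k] [Module k X]
    {f : MvPowerSeries (Fin (n + 1)) X} (h0 : atZero f = 0)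
    (h : ∀ s, VanishesTo s f → VanishesTo s (pd 0 f)) : f = 0 := by
  refine eq_zero_of_vanishesTo fun s => ?_
  induction s with
  | zero => exact fun ν hν => absurd hν (Nat.not_lt_zero _)
  | succ s ih =>
    intro ν hν
    by_cases h1 : ν 0 = 0
    · rw [← cons_zero_tail h1]; exact congrFun h0 _
    · obtain ⟨μ, rfl, hμ⟩ := exists_eq_add_single h1
      have := h s ih μ (by omega)
      rw [pd, ← Nat.cast_smul_eq_nsmul k] at this
      -- The factor `μ 0 + 1` produced by the derivative is invertible in characteristic zero.
      exact (smul_eq_zero.1 this).resolve_left (Nat.cast_ne_zero.2 (Nat.succ_ne_zero (μ 0)))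

omit [AddCommGroup X] [AddCommGroup Y] in
theorem atZero_conv (B : X → Y → Z) (f : MvPowerSeries (Fin (n + 1)) X)
    (g : MvPowerSeries (Fin (n + 1)) Y) : atZero (conv B f g) = conv B (atZero f) (atZero g) := by
  funext ν
  refine (Finset.sum_nbij' (fun e => (Finsupp.cons 0 e.1, Finsupp.cons 0 e.2))
    (fun e => (Finsupp.tail e.1, Finsupp.tail e.2)) ?_ ?_ ?_ ?_ ?_).symm
  · rintro ⟨a, b⟩ h
    rw [mem_antidiagonal] at h ⊢
    rw [← h]
    ext i
    refine Fin.cases ?_ (fun i => ?_) i <;> simp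
  · rintro ⟨a, b⟩ h
    rw [mem_antidiagonal] at h ⊢
    ext i
    have := DFunLike.congr_fun h i.succ
    simpa [Finsupp.tail_apply] using this
  · rintro ⟨a, b⟩ -
    simp
  · rintro ⟨a, b⟩ h
    have h0 := DFunLike.congr_fun (mem_antidiagonal.1 h) 0
    simp only [Finsupp.coe_add, Pi.add_apply, Finsupp.cons_zero, Nat.add_eq_zero_iff] at h0
    simp only [cons_zero_tail h0.1, cons_zero_tail h0.2]
  · rintro ⟨a, b⟩ -
    rfl

end Vanishing

end Truncation

/-! ### Inner deformations are families of `A_∞`-structures -/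

section InnerDeformation

open Finset.HasAntidiagonal (antidiagonal mem_antidiagonal)

variable {k V : Type*} [Field k] [AddCommGroup V] [Module k V]
variable (𝒱 : ℤ → Submodule k V) [DirectSum.Decomposition 𝒱] {n : ℕ}

/-- The coefficients of `A` of order less than `s` in `t₀` are uncurved and have the degrees
they have in a series of total degree `r`. -/
def IsHomCochainTo (s : ℕ) (d : Fin (n + 1) → ℤ) (r : ℤ)
    (A : MvPowerSeries (Fin (n + 1)) (Cochain k V)) : Prop :=
  ∀ ν : Fin (n + 1) →₀ ℕ, ν 0 < s → IsHomCochain 𝒱 (r - wt d ν) (A ν) ∧ IsUncurved (A ν)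

variable {𝒱} {s : ℕ} {d : Fin (n + 1) → ℤ} {r r' t : ℤ}

/-- On the empty word the only splitting applies `A` to the empty word. -/
theorem brace₂_one (p q : ℤ) (Q : Cochain k V) {A : Cochain k V} (B : Cochain k V)
    (hA : IsUncurved A) : IsUncurved (brace₂ 𝒱 Q p A q B) := by
  have : coder₂ 𝒱 p A q B 1 = 0 := by
    rw [coder₂_eq, ← word_nil, star_word, spl_nil, star_word, spl_nil]
    simp only [word_nil, LinearMap.comp_apply, AlgHom.toLinearMap_apply, map_one]
    rw [show A 1 = 0 from hA, map_zero, zero_mul, mul_zero]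
  rw [IsUncurved, brace₂, LinearMap.comp_apply, this, map_zero]

omit [DirectSum.Decomposition 𝒱] in
theorem IsHomCochainTo.pd_succ {A : MvPowerSeries (Fin (n + 1)) (Cochain k V)}
    (hA : IsHomCochainTo 𝒱 s d r A) (j : Fin n) :
    IsHomCochainTo 𝒱 s d (r - d j.succ) (pd j.succ A) := fun ν hν => by
  obtain ⟨h1, h2⟩ := hA (ν + Finsupp.single j.succ 1) (by simpa using hν)
  replace h1 := h1.smul ((ν j.succ + 1 : ℕ) : k)
  rw [wt_add, wt_single, add_comm, ← sub_sub, Nat.cast_smul_eq_nsmul] at h1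
  refine ⟨h1, ?_⟩
  rw [IsUncurved] at h2
  rw [IsUncurved, pd, LinearMap.smul_apply, h2, smul_zero]

theorem IsHomCochainTo.braceS {m A B : MvPowerSeries (Fin (n + 1)) (Cochain k V)}
    (hm : IsHomCochainTo 𝒱 s d t m) (hA : IsHomCochainTo 𝒱 s d r A)
    (hB : IsHomCochainTo 𝒱 s d r' B) :
    IsHomCochainTo 𝒱 s d (r + r' + t) (braceS 𝒱 m A B) := fun ν hν => by
  have h : ∀ e ∈ antidiagonal ν, ∀ e' ∈ antidiagonal e.2,
      e.1 0 < s ∧ e'.1 0 < s ∧ e'.2 0 < s := fun e he e' he' => by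
    have := fst_zero_le he; have := snd_zero_le he; have := fst_zero_le he'
    have := snd_zero_le he'; omega
  refine ⟨IsHomCochain.sum fun e he => IsHomCochain.sum fun e' he' => ?_, ?_⟩
  · have := (hm e.1 (h e he e' he').1).1.brace₂ (hA e'.1 (h e he e' he').2.1).1
      (hB e'.2 (h e he e' he').2.2).1 1 1
    rw [← mem_antidiagonal.1 he, ← mem_antidiagonal.1 he', wt_add, wt_add]
    convert this using 1
    ring
  · rw [IsUncurved, AInf.braceS, conv₃, LinearMap.sum_apply]
    refine Finset.sum_eq_zero fun e he => ?_
    rw [LinearMap.sum_apply]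
    exact Finset.sum_eq_zero fun e' he' => brace₂_one _ _ _ _ (hA e'.1 (h e he e' he').2.1).2

omit [DirectSum.Decomposition 𝒱] in
theorem IsHomCochainTo.sum {ι : Type*} {S : Finset ι}
    {f : ι → MvPowerSeries (Fin (n + 1)) (Cochain k V)}
    (h : ∀ i ∈ S, IsHomCochainTo 𝒱 s d r (f i)) : IsHomCochainTo 𝒱 s d r (∑ i ∈ S, f i) := by
  refine Finset.sum_induction _ _ (fun A B hA hB ν hν => ?_) (fun ν hν => ?_) h
  · obtain ⟨h1, h2⟩ := hA ν hν
    obtain ⟨h3, h4⟩ := hB ν hν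
    rw [IsUncurved] at h2 h4
    refine ⟨h1.add h3, ?_⟩
    change A ν 1 + B ν 1 = 0
    rw [h2, h4, add_zero]
  · exact ⟨isHomCochain_zero, rfl⟩

variable {d : Fin n → ℤ} {p : ℤ}

theorem wt_cons (b : ℤ) {ν : Fin (n + 1) →₀ ℕ} (h : ν 0 = 0) :
    wt (Fin.cons b d) ν = wt d (Finsupp.tail ν) := by
  simp [wt, Fin.sum_univ_succ, h, Finsupp.tail_apply]

theorem cupDeg_singleton (j : Fin n) : cupDeg d [j] = 1 - d j := by simp [cupDeg]

theorem cupDeg_cons_cons (j j' : Fin n) (J : List (Fin n)) :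
    cupDeg d (j :: j' :: J) = (1 - d j) + cupDeg d (j' :: J) + 1 := by
  simp [cupDeg]; ring

theorem odd_cupDeg (hd : ∀ i, Even (d i)) (j : Fin n) (J : List (Fin n)) :
    Odd (cupDeg d (j :: J)) := by
  induction J generalizing j with
  | nil => rw [cupDeg_singleton]; exact odd_one.sub_even (hd j)
  | cons j' J ih =>
    rw [cupDeg_cons_cons]
    exact ((odd_one.sub_even (hd j)).add_odd (ih j')).add_one

theorem cupMon_cons_cons (hd : ∀ i, Even (d i)) (m : MvPowerSeries (Fin (n + 1)) (Cochain k V))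
    (j j' : Fin n) (J : List (Fin n)) : cupMon 𝒱 d m (j :: j' :: J) =
      braceS 𝒱 m (pd j.succ m) (cupMon 𝒱 d m (j' :: J)) := by
  rw [cupMon, cupS_odd (odd_one.sub_even (hd j)) (odd_cupDeg hd j' J)]

variable {m : MvPowerSeries (Fin (n + 1)) (Cochain k V)}

theorem IsHomCochainTo.cupMon (hd : ∀ i, Even (d i)) (hm : IsHomCochainTo 𝒱 s (Fin.cons (1 - p) d) 1 m)
    (j : Fin n) (J : List (Fin n)) :
    IsHomCochainTo 𝒱 s (Fin.cons (1 - p) d) (cupDeg d (j :: J)) (cupMon 𝒱 d m (j :: J)) := by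
  induction J generalizing j with
  | nil =>
    rw [cupDeg_singleton]
    exact hm.pd_succ j
  | cons j' J ih =>
    rw [cupDeg_cons_cons, cupMon_cons_cons hd]
    exact hm.braceS (hm.pd_succ j) (ih j')

theorem list_ofFn_succ {l : ℕ} (J : Fin (l + 1) → Fin n) :
    List.ofFn J = J 0 :: List.ofFn fun i => J i.succ := List.ofFn_succ

variable {L : ℕ} {c : (l : ℕ) → (Fin (l + 1) → Fin n) → MvPowerSeries (Fin n) k}

theorem wt_of_incl_ne_zero (hc : IsHomPoly d p L c) {l : ℕ} (hl : l < L) (J : Fin (l + 1) → Fin n)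
    {ν : Fin (n + 1) →₀ ℕ} (h : incl (c l J) ν ≠ 0) :
    wt (Fin.cons (1 - p) d) ν + cupDeg d (List.ofFn J) = p := by
  rw [incl] at h
  split_ifs at h with h0
  · rw [wt_cons _ h0]
    exact hc l hl J _ h
  · exact absurd rfl h

theorem IsHomCochainTo.cupPoly (hd : ∀ i, Even (d i)) (hc : IsHomPoly d p L c)
    (hm : IsHomCochainTo 𝒱 s (Fin.cons (1 - p) d) 1 m) :
    IsHomCochainTo 𝒱 s (Fin.cons (1 - p) d) p (cupPoly 𝒱 d L c m) := by
  refine IsHomCochainTo.sum fun l hl => IsHomCochainTo.sum fun J _ ν hν => ?_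
  have hJ := hm.cupMon hd (J 0) (List.ofFn fun i => J i.succ)
  rw [← list_ofFn_succ] at hJ
  refine ⟨IsHomCochain.sum fun e he => ?_, ?_⟩
  · by_cases h0 : incl (c l J) e.1 = 0
    · simp only [h0, zero_smul]; exact isHomCochain_zero
    · have := (hJ e.2 ((snd_zero_le he).trans_lt hν)).1.smul (incl (c l J) e.1)
      rw [← mem_antidiagonal.1 he, wt_add]
      convert this using 1
      have := wt_of_incl_ne_zero hc (Finset.mem_range.1 hl) J h0
      omega
  · rw [IsUncurved, conv, LinearMap.sum_apply]
    refine Finset.sum_eq_zero fun e he => ?_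
    have := (hJ e.2 ((snd_zero_le he).trans_lt hν)).2
    rw [IsUncurved] at this
    rw [LinearMap.smul_apply, this, smul_zero]

/-- Induction on the length of the monomial: by `bracketS_braceS` the bracket is a sum of terms
containing `m ∘ m`, the bracket with `m_(j)`, or the bracket with the shorter monomial. The bracket
with `m_(j)` is `∂_j (m ∘ m)`, which vanishes to the same order in `t₀`. -/
theorem VanishesTo.bracketS_cupMon (hd : ∀ i, Even (d i)) (hm : IsOddS 𝒱 m)
    (hc : ∀ j J, IsOddS 𝒱 (cupMon 𝒱 d m (j :: J)))
    (h : VanishesTo s (conv (fun A B => circ 𝒱 A 1 B) m m)) (j : Fin n) (J : List (Fin n)) :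
    VanishesTo s (bracketS 𝒱 m (cupMon 𝒱 d m (j :: J))) := by
  have h1 : ∀ j : Fin n, VanishesTo s (bracketS 𝒱 m (pd j.succ m)) := fun j => by
    rw [← pd_bracketS_self]; exact h.pd_succ j
  induction J generalizing j with
  | nil => exact h1 j
  | cons j' J ih =>
    rw [cupMon_cons_cons hd, bracketS_braceS hm (show IsOddS 𝒱 (pd j.succ m) from hc j []) (hc j' J)]
    refine VanishesTo.add (VanishesTo.sub ?_ ?_) ?_
    · exact h.conv₃_left (fun _ _ => LinearMap.zero_comp _) _ _
    · rw [conv₃_swap_left]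
      refine (h1 j).conv₃_left (fun A B => ?_) _ _
      simpa using brace₂_add_mid 𝒱 0 1 A 0 0 B
    · rw [conv₃_swap_right, conv₃_swap_left]
      refine (ih j').conv₃_left (fun Q A => ?_) _ _
      simpa using brace₂_add_right 𝒱 1 0 Q A 0 0

theorem bracketS_smul (f : MvPowerSeries (Fin (n + 1)) k)
    (m A : MvPowerSeries (Fin (n + 1)) (Cochain k V)) :
    bracketS 𝒱 m (conv (fun (x : k) (A : Cochain k V) => x • A) f A) =
      conv (fun (x : k) (A : Cochain k V) => x • A) f (bracketS 𝒱 m A) := by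
  have hs : IsBiadditive (fun (x : k) (A : Cochain k V) => x • A) := ⟨add_smul, smul_add⟩
  have e1 : conv (fun (x : k) (A : Cochain k V) => x • A) f (bracketS 𝒱 m A) =
      conv₃ (fun x m A => x • (circ 𝒱 m 1 A + circ 𝒱 A 1 m)) f m A :=
    conv_conv_right _ _ _ hs _
  have e2 : bracketS 𝒱 m (conv (fun (x : k) (A : Cochain k V) => x • A) f A) =
      conv₃ (fun x m A => circ 𝒱 m 1 (x • A) + circ 𝒱 (x • A) 1 m) f m A := by
    rw [conv₃_swap_left]
    exact conv_conv_right _ _ _ (isBiadditive_circ_add_circ 𝒱) _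
  rw [e1, e2]
  refine conv₃_congr _ _ _ fun a b c => ?_
  simp only [circ, coder_smul, LinearMap.comp_smul, LinearMap.smul_comp, smul_add]

theorem VanishesTo.bracketS_cupPoly
    (h : ∀ j J, VanishesTo s (bracketS 𝒱 m (cupMon 𝒱 d m (j :: J)))) :
    VanishesTo s (bracketS 𝒱 m (cupPoly 𝒱 d L c m)) := by
  have hb := (isBiadditive_circ_add_circ 𝒱).conv (N := n + 1)
  rw [cupPoly, bracketS, hb.sum_right]
  refine VanishesTo.sum fun l _ => ?_
  rw [hb.sum_right]
  refine VanishesTo.sum fun J _ => ?_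
  rw [← bracketS, bracketS_smul, list_ofFn_succ]
  exact (h _ _).conv_right (fun _ => smul_zero _) _

variable [CharZero k] {m' : MvPowerSeries (Fin (n + 1)) (Cochain k V)}
  {m : MvPowerSeries (Fin n) (Cochain k V)}

/-- The flow determines the coefficients of order `s` in `t₀`, for `s ≥ 1`, from those of `Ψ[m']` of
order `s - 1`, which involve `m'` only up to that order. The degree `1 - p` of `t₀` compensates the
degree `p` of `Ψ`. -/
theorem IsInnerDeformation.isHomCochainTo (hd : ∀ i, Even (d i)) (hc : IsHomPoly d p L c)
    (hm : IsAInfFamily 𝒱 d m) (hm' : IsInnerDeformation 𝒱 d L c m m') (s : ℕ) :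
    IsHomCochainTo 𝒱 s (Fin.cons (1 - p) d) 1 m' := by
  induction s with
  | zero => exact fun ν hν => absurd hν (Nat.not_lt_zero _)
  | succ s ih =>
    intro ν hν
    by_cases h1 : ν 0 = 0
    · have : m' ν = m (Finsupp.tail ν) := by
        rw [← hm'.initial, atZero, cons_zero_tail h1]
      rw [this, wt_cons _ h1]
      exact ⟨hm.degree _, hm.uncurved _⟩
    · obtain ⟨μ, rfl, hμ⟩ := exists_eq_add_single h1
      have h2 : ((μ 0 + 1 : ℕ) : k) ≠ 0 := Nat.cast_ne_zero.2 (Nat.succ_ne_zero (μ 0))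
      have h3 : m' (μ + Finsupp.single 0 1) = ((μ 0 + 1 : ℕ) : k)⁻¹ • cupPoly 𝒱 d L c m' μ := by
        rw [← hm'.flow, pd, ← Nat.cast_smul_eq_nsmul k, smul_smul, inv_mul_cancel₀ h2, one_smul]
      obtain ⟨h4, h5⟩ := ih.cupPoly hd hc μ (by omega)
      rw [h3, wt_add, wt_single]
      refine ⟨?_, ?_⟩
      · convert h4.smul _ using 1
        simp only [Fin.cons_zero]
        ring
      · rw [IsUncurved] at h5 ⊢
        rw [LinearMap.smul_apply, h5, smul_zero]

/-- The `t₀`-derivative of `m' ∘ m'` is `[m', Ψ[m']]`, which vanishes to every order to which `m' ∘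
m'` does; with the initial condition this gives zero by induction on the order. -/
theorem IsInnerDeformation.isAInfFamily (hd : ∀ i, Even (d i)) (hp : Even (1 - p))
    (hc : IsHomPoly d p L c)
    (hm : IsAInfFamily 𝒱 d m) (hm' : IsInnerDeformation 𝒱 d L c m m') :
    IsAInfFamily 𝒱 (Fin.cons (1 - p) d) m' := by
  have h := hm'.isHomCochainTo hd hc hm
  have hd' : ∀ i, Even ((Fin.cons (1 - p) d : Fin (n + 1) → ℤ) i) := Fin.cases hp hd
  have hodd : IsOddS 𝒱 m' := IsHomCochainS.isOddS (d := Fin.cons (1 - p) d) (r := 1)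
    (fun ν => (h _ ν (Nat.lt_succ_self _)).1) hd' odd_one
  have hJ : ∀ j J, IsOddS 𝒱 (cupMon 𝒱 d m' (j :: J)) := fun j J =>
    IsHomCochainS.isOddS (d := Fin.cons (1 - p) d)
      (fun ν => ((h _).cupMon hd j J ν (Nat.lt_succ_self _)).1) hd' (odd_cupDeg hd j J)
  refine ⟨fun ν => (h _ ν (Nat.lt_succ_self _)).2, fun ν => (h _ ν (Nat.lt_succ_self _)).1, ?_⟩
  refine eq_zero_of_pd_zero (k := k) ?_ fun s hs => ?_
  · rw [atZero_conv, hm'.initial, hm.maurerCartan]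
  · rw [pd_bracketS_self, hm'.flow]
    exact VanishesTo.bracketS_cupPoly fun j J => hs.bracketS_cupMon hd hodd hJ j J

end InnerDeformation

/-! ### Scalar coefficients and derivatives of Lie derivatives -/

section Scalars

variable {k V : Type*} [Field k] [AddCommGroup V] [Module k V] {N : ℕ}

/-- The multiplication by a power series of scalars, as a power series of operators. -/
def scalarS (k V : Type*) [Field k] [AddCommGroup V] [Module k V] {N : ℕ}
    (f : MvPowerSeries (Fin N) k) : MvPowerSeries (Fin N) (Module.End k (Chain k V)) :=
  MvPowerSeries.map (algebraMap k (Module.End k (Chain k V))) f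

theorem scalarS_apply (f : MvPowerSeries (Fin N) k) (ν : Fin N →₀ ℕ) :
    scalarS k V f ν = algebraMap k (Module.End k (Chain k V)) (f ν) :=
  MvPowerSeries.coeff_map (algebraMap k (Module.End k (Chain k V))) ν f

theorem scalarS_commute (f : MvPowerSeries (Fin N) k)
    (U : MvPowerSeries (Fin N) (Module.End k (Chain k V))) : Commute (scalarS k V f) U := by
  rw [commute_iff_eq, mul_eq_conv, mul_eq_conv, conv_swap]
  refine conv_congr _ _ fun a b => ?_
  rw [scalarS_apply]
  exact Algebra.commutes _ _

variable {𝒱 : ℤ → Submodule k V} {d : Fin N → ℤ} {r s : ℤ}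

theorem isHomOpS_scalarS {f : MvPowerSeries (Fin N) k} (h : ∀ ν, f ν ≠ 0 → wt d ν = r) :
    IsHomOpS 𝒱 d r (scalarS k V f) := fun ν => by
  rw [scalarS_apply]
  by_cases h0 : f ν = 0
  · rw [h0, map_zero]; exact isHomOp_zero _
  · rw [h ν h0, sub_self]
    intro q x hx
    rw [add_zero]
    exact Submodule.smul_mem _ _ hx

theorem IsHomOpS.of_eq {U : MvPowerSeries (Fin N) (Module.End k (Chain k V))}
    (hU : IsHomOpS 𝒱 d r U) (h : r = s) : IsHomOpS 𝒱 d s U := h ▸ hU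

variable [DirectSum.Decomposition 𝒱]

variable (𝒱) in
theorem lieS_add (p : ℤ) (A B : MvPowerSeries (Fin N) (Cochain k V)) :
    lieS 𝒱 p (A + B) = lieS 𝒱 p A + lieS 𝒱 p B := funext fun _ => lie_add ..

variable (𝒱) in
theorem lieS_sum (p : ℤ) {ι : Type*} (S : Finset ι) (f : ι → MvPowerSeries (Fin N) (Cochain k V)) :
    lieS 𝒱 p (∑ i ∈ S, f i) = ∑ i ∈ S, lieS 𝒱 p (f i) :=
  map_sum (AddMonoidHom.mk' (lieS 𝒱 p) (lieS_add 𝒱 p)) f S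

variable (𝒱) in
theorem lieS_smul (p : ℤ) (f : MvPowerSeries (Fin N) k) (A : MvPowerSeries (Fin N) (Cochain k V)) :
    lieS 𝒱 p (conv (fun (x : k) (A : Cochain k V) => x • A) f A) =
      scalarS k V f * lieS 𝒱 p A := by
  have : lieS 𝒱 p (conv (fun (x : k) (A : Cochain k V) => x • A) f A) =
      conv (fun x A => lie 𝒱 p (x • A)) f A :=
    map_conv _ _ (AddMonoidHom.mk' (lie 𝒱 p) (lie_add 𝒱 p)) _
  rw [this, mul_eq_conv]
  refine funext fun ν => Finset.sum_congr rfl fun e _ => ?_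
  change lie 𝒱 p (f e.1 • A e.2) = scalarS k V f e.1 * lie 𝒱 p (A e.2)
  rw [scalarS_apply, lie_smul, Algebra.smul_def]

variable (𝒱) in
theorem pd_lieS (p : ℤ) (A : MvPowerSeries (Fin N) (Cochain k V)) (j : Fin N) :
    pd j (lieS 𝒱 p A) = lieS 𝒱 p (pd j A) :=
  pd_map (AddMonoidHom.mk' (lie 𝒱 p) (lie_add 𝒱 p)) A j

theorem pd_mul (U W : MvPowerSeries (Fin N) (Module.End k (Chain k V))) (j : Fin N) :
    pd j (U * W) = pd j U * W + U * pd j W := by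
  simp only [mul_eq_conv]
  exact pd_conv isBiadditive_mul _ _ _

end Scalars

/-! ### The algebra of homotopies in an abstract ring -/

section RemoveNth

variable {R ι : Type*} [Ring R]

/-- The sum `∑ₛ i_{j₁} ⋯ (omit iⱼₛ) ⋯ i_{jₗ} L_{jₛ}`. -/
def leibnizSum (i l : ι → R) : List ι → R
  | [] => 0
  | j :: J => i j * leibnizSum i l J + (J.map i).prod * l j

/-- Either the head is the omitted factor, which is `s = 0`, or it stays in front and the omission
happens in the tail. -/
theorem leibnizSum_ofFn (i l : ι → R) {n : ℕ} (J : Fin (n + 1) → ι) :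
    leibnizSum i l (List.ofFn J) =
      ∑ s, (List.ofFn fun r => i (J (Fin.succAbove s r))).prod * l (J s) := by
  induction n with
  | zero => simp [leibnizSum]
  | succ n ih =>
    rw [List.ofFn_succ, leibnizSum, ih, add_comm, Finset.mul_sum, List.map_ofFn]
    conv_rhs => rw [Fin.sum_univ_succ]
    refine congrArg₂ _ rfl (Finset.sum_congr rfl fun s _ => ?_)
    rw [List.ofFn_succ (n := n), List.prod_cons, mul_assoc]
    simp

variable {D x y Q E F H K S W X Y Z : R}

/-- In this and the next two lemmas `D` stands for `L_m`, `x` for the first contraction, `y` for a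
Lie derivative and `Q` for a product of contractions. Here `[y, -]` is a derivation, and homotopies
may be multiplied by elements commuting with `D`. -/
theorem commutator_mul_eq (h1 : y * x - x * y = D * F - F * D) (hx : D * x = x * D)
    (hQ : D * Q = Q * D) (h : y * Q - Q * y = D * E - E * D) :
    y * (x * Q) - x * Q * y = D * (x * E + F * Q) - (x * E + F * Q) * D := by
  linear_combination (norm := noncomm_ring) x * h + h1 * Q - hx * E - F * hQ

theorem homotopy_mul_eq (h1 : X = x * Y - (D * K + K * D)) (h : Y = Q - (D * H + H * D))
    (hx : D * x = x * D) :
    X = x * Q - (D * (K + x * H) + (K + x * H) * D) := by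
  linear_combination (norm := noncomm_ring) h1 + x * h + hx * H

/-- Since `y` anticommutes with `D`, the error `-y (D H + H D)` from replacing `Z` by `Q` equals `D
(y H) - (y H) D`; the last homotopy `E` moves `y` to the right of `Q`. -/
theorem homotopy_leibniz_eq (h1 : X = x * Y + y * Z + (D * K - K * D))
    (hY : Y = S + (D * W - W * D)) (hZ : Z = Q - (D * H + H * D))
    (h : y * Q - Q * y = D * E - E * D) (hx : D * x = x * D) (hy : D * y + y * D = 0) :
    X = x * S + Q * y + (D * (K + x * W + y * H + E) - (K + x * W + y * H + E) * D) := by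
  linear_combination (norm := noncomm_ring) h1 + x * hY + y * hZ + h - hx * W - hy * H

theorem commutator_eq_of_commute (h : y * x + D * F = F * D + x * y) :
    y * x - x * y = D * -F - -F * D := by
  linear_combination (norm := noncomm_ring) h

end RemoveNth

/-! ### Homotopies for cup monomials -/

section Homotopies

variable {k V : Type*} [Field k] [CharZero k] [AddCommGroup V] [Module k V]
variable (𝒱 : ℤ → Submodule k V) [DirectSum.Decomposition 𝒱] {n : ℕ}

/-- The contraction by `∂m/∂tⱼ`. -/
def contrD (m : MvPowerSeries (Fin (n + 1)) (Cochain k V)) (j : Fin n) :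
    MvPowerSeries (Fin (n + 1)) (Module.End k (Chain k V)) :=
  contrS 𝒱 m 1 (pd j.succ m)

/-- The Lie derivative along `∂m/∂tⱼ`. -/
def lieD (m : MvPowerSeries (Fin (n + 1)) (Cochain k V)) (j : Fin n) :
    MvPowerSeries (Fin (n + 1)) (Module.End k (Chain k V)) :=
  lieS 𝒱 1 (pd j.succ m)

variable {𝒱} {d : Fin n → ℤ} {b : ℤ} {m : MvPowerSeries (Fin (n + 1)) (Cochain k V)}

theorem cupDeg_cons (j : Fin n) (J : List (Fin n)) : cupDeg d (j :: J) = 2 - d j + cupDeg d J := by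
  simp [cupDeg]; ring

variable (hd : ∀ i, Even (d i)) (hb : Even b) (hm : IsAInfFamily 𝒱 (Fin.cons b d) m)
include hd hb hm

omit [CharZero k] in
theorem isOddS_of_family : IsOddS 𝒱 m :=
  IsHomCochainS.isOddS (d := Fin.cons b d) (r := 1) hm.degree (Fin.cases hb hd) odd_one

omit [CharZero k] hd hb in
theorem isHomCochainS_pd (j : Fin n) :
    IsHomCochainS 𝒱 (Fin.cons b d) (1 - d j) (pd j.succ m) :=
  IsHomCochainS.pd (d := Fin.cons b d) (r := 1) hm.degree j.succ

omit [CharZero k] hb in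
theorem isHomCochainS_cupMon (j : Fin n) (J : List (Fin n)) :
    IsHomCochainS 𝒱 (Fin.cons b d) (cupDeg d (j :: J)) (cupMon 𝒱 d m (j :: J)) := by
  induction J generalizing j with
  | nil => rw [cupDeg_singleton]; exact isHomCochainS_pd hm j
  | cons j' J ih =>
    rw [cupDeg_cons_cons, cupMon_cons_cons hd]
    exact IsHomCochainS.braceS hm.degree (isHomCochainS_pd hm j) (ih j')

omit [CharZero k] in
theorem isOddS_cupMon (j : Fin n) (J : List (Fin n)) : IsOddS 𝒱 (cupMon 𝒱 d m (j :: J)) :=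
  (isHomCochainS_cupMon hd hm j J).isOddS (Fin.cases hb hd) (odd_cupDeg hd j J)

omit [CharZero k] in
theorem bracketS_cupMon (j : Fin n) (J : List (Fin n)) :
    bracketS 𝒱 m (cupMon 𝒱 d m (j :: J)) = 0 :=
  eq_zero_of_vanishesTo fun _ => VanishesTo.bracketS_cupMon hd (isOddS_of_family hd hb hm)
    (isOddS_cupMon hd hb hm) (fun ν _ => congrFun hm.maurerCartan ν) j J

omit hd hb in
theorem isHomOpS_lieD (j : Fin n) : IsHomOpS 𝒱 (Fin.cons b d) (1 - d j) (lieD 𝒱 m j) :=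
  (isHomCochainS_pd hm j).lieS

omit hd hb in
theorem isHomOpS_contrD (j : Fin n) : IsHomOpS 𝒱 (Fin.cons b d) (2 - d j) (contrD 𝒱 m j) :=
  (IsHomCochainS.contrS hm.degree (isHomCochainS_pd hm j)).of_eq (by ring)

omit hd hb in
theorem isHomOpS_contrD_prod (J : List (Fin n)) :
    IsHomOpS 𝒱 (Fin.cons b d) (cupDeg d J + 1) (J.map (contrD 𝒱 m)).prod := by
  induction J with
  | nil => exact isHomOpS_one
  | cons j J ih =>
    rw [List.map_cons, List.prod_cons]
    exact ((isHomOpS_contrD hm j).mul ih).of_eq (by rw [cupDeg_cons]; ring)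

theorem lieS_commute_contrD (j : Fin n) : Commute (lieS 𝒱 1 m) (contrD 𝒱 m j) :=
  lieS_commute_contrS (isOddS_of_family hd hb hm) (isOddS_cupMon hd hb hm j []) hm.maurerCartan
    (bracketS_cupMon hd hb hm j [])

theorem lieS_commute_contrD_prod (J : List (Fin n)) :
    Commute (lieS 𝒱 1 m) (J.map (contrD 𝒱 m)).prod :=
  Commute.list_prod_right _ _ fun x hx => by
    obtain ⟨j, -, rfl⟩ := List.mem_map.1 hx
    exact lieS_commute_contrD hd hb hm j

/-- Differentiating `[L_m, i_{m_(j)}] = 0` by `t_i` gives `[L_{m_(i)}, i_{m_(j)}] + [L_m, ∂_i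
i_{m_(j)}] = 0`, which exhibits the homotopy without further combinatorics. -/
theorem lieD_mul_contrD_sub (i j : Fin n) :
    lieD 𝒱 m i * contrD 𝒱 m j - contrD 𝒱 m j * lieD 𝒱 m i =
      lieS 𝒱 1 m * -pd i.succ (contrD 𝒱 m j) - -pd i.succ (contrD 𝒱 m j) * lieS 𝒱 1 m := by
  have h := congrArg (pd i.succ) (lieS_commute_contrD hd hb hm j).eq
  rw [pd_mul, pd_mul, pd_lieS] at h
  exact commutator_eq_of_commute h

theorem exists_lieD_contrD_prod (i : Fin n) (J : List (Fin n)) :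
    ∃ E, IsHomOpS 𝒱 (Fin.cons b d) (cupDeg d J + 1 - d i) E ∧
      lieD 𝒱 m i * (J.map (contrD 𝒱 m)).prod - (J.map (contrD 𝒱 m)).prod * lieD 𝒱 m i =
        lieS 𝒱 1 m * E - E * lieS 𝒱 1 m := by
  induction J with
  | nil => exact ⟨0, isHomOpS_zero, by simp⟩
  | cons j J ih =>
    obtain ⟨E, hE, h⟩ := ih
    have h1 := lieD_mul_contrD_sub hd hb hm i j
    have h2 := lieS_commute_contrD hd hb hm j
    have h3 := lieS_commute_contrD_prod hd hb hm J
    have h4 : IsHomOpS 𝒱 (Fin.cons b d) (2 - d j - d i) (-pd i.succ (contrD 𝒱 m j)) := by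
      rw [← zero_sub]
      exact isHomOpS_zero.sub ((isHomOpS_contrD hm j).pd i.succ)
    refine ⟨contrD 𝒱 m j * E + -pd i.succ (contrD 𝒱 m j) * (J.map (contrD 𝒱 m)).prod,
      IsHomOpS.add ?_ ?_, ?_⟩
    · exact ((isHomOpS_contrD hm j).mul hE).of_eq (by rw [cupDeg_cons]; ring)
    · exact (h4.mul (isHomOpS_contrD_prod hm J)).of_eq (by rw [cupDeg_cons]; ring)
    · rw [List.map_cons, List.prod_cons]
      exact commutator_mul_eq h1 h2.eq h3.eq h

/-- `contrS_braceS` splits off the first factor, and its contraction commutes with `L_m`, so the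
homotopy of the tail can be multiplied by it. -/
theorem exists_contrS_cupMon (j : Fin n) (J : List (Fin n)) :
    ∃ H, IsHomOpS 𝒱 (Fin.cons b d) (cupDeg d (j :: J)) H ∧
      contrS 𝒱 m 1 (cupMon 𝒱 d m (j :: J)) = ((j :: J).map (contrD 𝒱 m)).prod -
        (lieS 𝒱 1 m * H + H * lieS 𝒱 1 m) := by
  induction J generalizing j with
  | nil => exact ⟨0, isHomOpS_zero, by simp [contrD, cupMon]⟩
  | cons j' J ih =>
    obtain ⟨H, hH, h⟩ := ih j'
    have h1 := contrS_braceS (isOddS_of_family hd hb hm) (isOddS_cupMon hd hb hm j [])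
      (isOddS_cupMon hd hb hm j' J) hm.maurerCartan (bracketS_cupMon hd hb hm j [])
      (bracketS_cupMon hd hb hm j' J)
    have h2 := lieS_commute_contrD hd hb hm j
    rw [commute_iff_eq] at h2
    refine ⟨contrHomotopyS 𝒱 m (pd j.succ m) (cupMon 𝒱 d m (j' :: J)) + contrD 𝒱 m j * H,
      IsHomOpS.add ?_ ?_, ?_⟩
    · exact (IsHomCochainS.contrHomotopyS hm.degree (isHomCochainS_pd hm j)
        (isHomCochainS_cupMon hd hm j' J)).of_eq (by rw [cupDeg_cons_cons]; ring)
    · exact ((isHomOpS_contrD hm j).mul hH).of_eq (by rw [cupDeg_cons j])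
    · rw [cupMon_cons_cons hd, List.map_cons, List.prod_cons]
      exact homotopy_mul_eq h1 h h2

/-- By `lieS_braceS` the monomial gives `i_A L_B + L_A i_B` with `A = m_(j)` and `B` the tail. Up to
commutators with `L_m`, the induction hypothesis replaces `L_B`, the contraction `i_B` becomes a
product of contractions, and `L_A` moves to the right of this product. -/
theorem exists_lieS_cupMon (j : Fin n) (J : List (Fin n)) :
    ∃ W, IsHomOpS 𝒱 (Fin.cons b d) (cupDeg d (j :: J) - 1) W ∧
      lieS 𝒱 1 (cupMon 𝒱 d m (j :: J)) = leibnizSum (contrD 𝒱 m) (lieD 𝒱 m) (j :: J) +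
        (lieS 𝒱 1 m * W - W * lieS 𝒱 1 m) := by
  induction J generalizing j with
  | nil => exact ⟨0, isHomOpS_zero, by simp [leibnizSum, lieD, cupMon]⟩
  | cons j' J ih =>
    obtain ⟨W, hW, h⟩ := ih j'
    obtain ⟨H, hH, h'⟩ := exists_contrS_cupMon hd hb hm j' J
    obtain ⟨E, hE, h''⟩ := exists_lieD_contrD_prod hd hb hm j (j' :: J)
    have h1 := lieS_braceS (isOddS_of_family hd hb hm) (isOddS_cupMon hd hb hm j [])
      (isOddS_cupMon hd hb hm j' J) (bracketS_cupMon hd hb hm j [])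
      (bracketS_cupMon hd hb hm j' J)
    have h2 := (lieS_commute_contrD hd hb hm j).eq
    have h3 := lieS_anticomm (isOddS_of_family hd hb hm) (isOddS_cupMon hd hb hm j [])
      (bracketS_cupMon hd hb hm j [])
    refine ⟨lieHomotopyS 𝒱 (pd j.succ m) (cupMon 𝒱 d m (j' :: J)) + contrD 𝒱 m j * W +
      lieD 𝒱 m j * H + E, IsHomOpS.add (IsHomOpS.add (IsHomOpS.add ?_ ?_) ?_) ?_, ?_⟩
    · exact ((isHomCochainS_pd hm j).lieHomotopyS (isHomCochainS_cupMon hd hm j' J)).of_eq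
        (by rw [cupDeg_cons_cons]; ring)
    · exact ((isHomOpS_contrD hm j).mul hW).of_eq (by rw [cupDeg_cons j]; ring)
    · exact ((isHomOpS_lieD hm j).mul hH).of_eq (by rw [cupDeg_cons j]; ring)
    · exact hE.of_eq (by rw [cupDeg_cons j]; ring)
    · rw [cupMon_cons_cons hd, leibnizSum]
      exact homotopy_leibniz_eq h1 h h' h'' h2 h3

end Homotopies

/-! ### The operators `W` for a cup polynomial -/

section CupPolynomials

variable {k V : Type*} [Field k] [CharZero k] [AddCommGroup V] [Module k V]
variable {𝒱 : ℤ → Submodule k V} [DirectSum.Decomposition 𝒱] {n : ℕ}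
variable {d : Fin n → ℤ} {p : ℤ} {m : MvPowerSeries (Fin (n + 1)) (Cochain k V)}
  {L : ℕ} {c : (l : ℕ) → (Fin (l + 1) → Fin n) → MvPowerSeries (Fin n) k}

omit [CharZero k] in
theorem flowV_eq (hd : ∀ i, Even (d i)) (j : Fin n) : flowV 𝒱 d L c m j =
    ∑ l ∈ Finset.range L, ∑ s : Fin (l + 1), ∑ J : Fin l → Fin n,
      scalarS k V (incl (c l (Fin.insertNth (α := fun _ => Fin n) s j J))) *
        ((List.ofFn J).map (contrD 𝒱 m)).prod := by
  refine Finset.sum_congr rfl fun l _ => Finset.sum_congr rfl fun s _ =>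
    Finset.sum_congr rfl fun J _ => ?_
  rw [List.map_ofFn]
  have : (fun r => contrS 𝒱 m (1 - d (J r)) (pd (J r).succ m)) = contrD 𝒱 m ∘ J :=
    funext fun r => contrS_odd (odd_one.sub_even (hd _))
  rw [this]
  rfl

/-- A multi-index with a distinguished position `s` is the index `j` at `s` together with the
remaining multi-index. Grouping by `j` produces the operators `V^j`. -/
theorem sum_leibnizSum {R : Type*} [Ring R] (i l : Fin n → R)
    (C : (r : ℕ) → (Fin (r + 1) → Fin n) → R) (L : ℕ) :
    ∑ r ∈ Finset.range L, ∑ J : Fin (r + 1) → Fin n, C r J * leibnizSum i l (List.ofFn J) =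
      ∑ j, (∑ r ∈ Finset.range L, ∑ s : Fin (r + 1), ∑ J : Fin r → Fin n,
        C r (Fin.insertNth (α := fun _ => Fin n) s j J) * ((List.ofFn J).map i).prod) * l j := by
  simp only [Finset.sum_mul]
  rw [Finset.sum_comm]
  refine Finset.sum_congr rfl fun r _ => ?_
  simp only [leibnizSum_ofFn, Finset.mul_sum]
  rw [Finset.sum_comm, Finset.sum_comm (s := Finset.univ (α := Fin n))]
  refine Finset.sum_congr rfl fun s _ => ?_
  rw [← (Fin.insertNthEquiv (fun _ => Fin n) s).sum_comp, Fintype.sum_prod_type]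
  refine Finset.sum_congr rfl fun j _ => Finset.sum_congr rfl fun J _ => ?_
  simp [mul_assoc, List.map_ofFn, Function.comp_def]
  rfl

omit [CharZero k] [DirectSum.Decomposition 𝒱] in
theorem isHomOpS_scalarS_incl (hc : IsHomPoly d p L c) {l : ℕ} (hl : l < L)
    (J : Fin (l + 1) → Fin n) :
    IsHomOpS 𝒱 (Fin.cons (1 - p) d) (p - cupDeg d (List.ofFn J)) (scalarS k V (incl (c l J))) :=
  isHomOpS_scalarS fun ν hν => by
    have := wt_of_incl_ne_zero hc hl J hν
    omega

theorem mul_commutator_eq {R : Type*} [Ring R] {f D E : R} (h : Commute f D) :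
    f * (D * E - E * D) = D * (f * E) - f * E * D := by
  linear_combination (norm := noncomm_ring) h.eq * E

theorem sum_commutator_eq {R ι : Type*} [Ring R] (S : Finset ι) (D : R) (E : ι → R) :
    ∑ i ∈ S, (D * E i - E i * D) = D * (∑ i ∈ S, E i) - (∑ i ∈ S, E i) * D := by
  rw [Finset.sum_sub_distrib, Finset.mul_sum, Finset.sum_mul]

theorem cupDeg_insertNth (l : ℕ) (s : Fin (l + 1)) (j : Fin n) (J : Fin l → Fin n) :
    cupDeg d (List.ofFn (Fin.insertNth (α := fun _ => Fin n) s j J)) =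
      2 - d j + cupDeg d (List.ofFn J) := by
  simp only [cupDeg, List.map_ofFn, List.sum_ofFn, List.length_ofFn]
  rw [Fin.sum_univ_succAbove _ s]
  simp
  ring

section Family

variable (hd : ∀ i, Even (d i)) (hp : Even (1 - p)) (hm : IsAInfFamily 𝒱 (Fin.cons (1 - p) d) m)
  (hc : IsHomPoly d p L c)
include hd hm

theorem isHomOpS_flowV (hc : IsHomPoly d p L c) (j : Fin n) :
    IsHomOpS 𝒱 (Fin.cons (1 - p) d) (p - 1 + d j) (flowV 𝒱 d L c m j) := by
  rw [flowV_eq hd]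
  refine IsHomOpS.sum fun l hl => IsHomOpS.sum fun s _ => IsHomOpS.sum fun J _ => ?_
  refine ((isHomOpS_scalarS_incl hc (Finset.mem_range.1 hl) _).mul
    (isHomOpS_contrD_prod hm _)).of_eq ?_
  rw [cupDeg_insertNth]
  ring

include hp

theorem lieS_commute_flowV (j : Fin n) : Commute (lieS 𝒱 1 m) (flowV 𝒱 d L c m j) := by
  rw [flowV_eq hd]
  exact Commute.sum_right _ _ _ fun l _ => Commute.sum_right _ _ _ fun s _ =>
    Commute.sum_right _ _ _ fun J _ => (scalarS_commute _ _).symm.mul_right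
      (lieS_commute_contrD_prod hd hp hm _)

include hc

/-- `V^j` is a combination of products of contractions with scalar coefficients, and scalars commute
with all operators, so the homotopies of `exists_lieD_contrD_prod` add up. -/
theorem exists_lieD_flowV (j : Fin n) :
    ∃ E, IsHomOpS 𝒱 (Fin.cons (1 - p) d) (p - 1) E ∧
      lieD 𝒱 m j * flowV 𝒱 d L c m j - flowV 𝒱 d L c m j * lieD 𝒱 m j =
        lieS 𝒱 1 m * E - E * lieS 𝒱 1 m := by
  choose E hE h using exists_lieD_contrD_prod hd hp hm j
  refine ⟨∑ l ∈ Finset.range L, ∑ s : Fin (l + 1), ∑ J : Fin l → Fin n,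
    scalarS k V (incl (c l (Fin.insertNth (α := fun _ => Fin n) s j J))) * E (List.ofFn J),
    IsHomOpS.sum fun l hl => IsHomOpS.sum fun s _ => IsHomOpS.sum fun J _ => ?_, ?_⟩
  · refine ((isHomOpS_scalarS_incl hc (Finset.mem_range.1 hl) _).mul (hE _)).of_eq ?_
    rw [cupDeg_insertNth]
    ring
  · rw [flowV_eq hd]
    simp only [← sum_commutator_eq]
    refine Finset.sum_congr rfl fun l _ => Finset.sum_congr rfl fun s _ =>
      Finset.sum_congr rfl fun J _ => ?_
    rw [← mul_commutator_eq (scalarS_commute _ _), ← mul_commutator_eq (scalarS_commute _ _), h]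

theorem exists_isChainW : ∃ W, IsChainW 𝒱 d p L c m W := by
  choose W hW h using exists_lieS_cupMon hd hp hm
  refine ⟨∑ l ∈ Finset.range L, ∑ J : Fin (l + 1) → Fin n,
    scalarS k V (incl (c l J)) * W (J 0) (List.ofFn fun i => J i.succ),
    IsHomOpS.sum fun l hl => IsHomOpS.sum fun J _ => ?_, ?_⟩
  · have := hW (J 0) (List.ofFn fun i => J i.succ)
    rw [← list_ofFn_succ] at this
    exact ((isHomOpS_scalarS_incl hc (Finset.mem_range.1 hl) _).mul this).of_eq (by ring)
  · have hL : ∀ j, lieS 𝒱 (1 - d j) (pd j.succ m) = lieD 𝒱 m j := fun j =>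
      lieS_odd (odd_one.sub_even (hd j))
    have hV := sum_leibnizSum (contrD 𝒱 m) (lieD 𝒱 m) (fun l J => scalarS k V (incl (c l J))) L
    simp only [← flowV_eq hd] at hV
    simp only [hL]
    -- Scalar series commute with `L_m`, so the identity splits into one for each cup monomial,
    -- which is `h`.
    rw [← hV, lieS_odd (show Odd p by simpa using odd_one.sub_even hp), cupPoly,
      lieS_sum, ← sum_commutator_eq, ← Finset.sum_add_distrib]
    refine Finset.sum_congr rfl fun l _ => ?_
    rw [lieS_sum, ← sum_commutator_eq, ← Finset.sum_add_distrib]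
    refine Finset.sum_congr rfl fun J _ => ?_
    rw [lieS_smul, ← mul_commutator_eq (scalarS_commute _ _), add_comm (scalarS k V _ * (_ - _)),
      ← mul_add, list_ofFn_succ J, h]

/-- Passing from `V^j L_{m_(j)}` to `L_{m_(j)} V^j` costs `[L_m, E_j]`, which is absorbed in `W`. -/
theorem exists_isCochainW : ∃ W, IsCochainW 𝒱 d p L c m W := by
  obtain ⟨W, hW, h⟩ := exists_isChainW hd hp hm hc
  choose E hE h' using exists_lieD_flowV hd hp hm hc
  refine ⟨W - ∑ j, E j, hW.sub (IsHomOpS.sum fun j _ => hE j), ?_⟩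
  have hL : ∀ j, lieS 𝒱 (1 - d j) (pd j.succ m) = lieD 𝒱 m j := fun j =>
    lieS_odd (odd_one.sub_even (hd j))
  simp only [hL] at h ⊢
  have h1 := sum_commutator_eq Finset.univ (lieS 𝒱 1 m) E
  simp only [← h'] at h1
  rw [Finset.sum_sub_distrib, sub_eq_iff_eq_add] at h1
  rw [h, h1, mul_sub, sub_mul]
  abel

end Family

end CupPolynomials

/-! ### Existence and uniqueness for flows in `t₀` -/

section Flows

open Finset.HasAntidiagonal (antidiagonal mem_antidiagonal)

variable {n : ℕ} {X Y Z : Type*}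

/-- The power series `f` and `g` agree up to the order `s` in `t₀`. -/
def AgreesTo (s : ℕ) (f g : MvPowerSeries (Fin (n + 1)) X) : Prop :=
  ∀ ν : Fin (n + 1) →₀ ℕ, ν 0 < s → f ν = g ν

variable {s : ℕ}

theorem eq_of_agreesTo {f g : MvPowerSeries (Fin (n + 1)) X} (h : ∀ s, AgreesTo s f g) : f = g :=
  funext fun ν => h _ ν (Nat.lt_succ_self _)

theorem AgreesTo.conv_right [AddCommMonoid Z] (B : X → Y → Z) (f : MvPowerSeries (Fin (n + 1)) X)
    {g g' : MvPowerSeries (Fin (n + 1)) Y} (h : AgreesTo s g g') :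
    AgreesTo s (conv B f g) (conv B f g') := fun ν hν => Finset.sum_congr rfl fun e he => by
  rw [h _ ((snd_zero_le he).trans_lt hν)]

theorem AgreesTo.conv_left [AddCommMonoid Z] (B : X → Y → Z)
    {f f' : MvPowerSeries (Fin (n + 1)) X} (g : MvPowerSeries (Fin (n + 1)) Y)
    (h : AgreesTo s f f') : AgreesTo s (conv B f g) (conv B f' g) := fun ν hν =>
  Finset.sum_congr rfl fun e he => by
  rw [h _ ((fst_zero_le he).trans_lt hν)]

section Module

variable [AddCommGroup X] {f g f' g' : MvPowerSeries (Fin (n + 1)) X}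

theorem AgreesTo.pd_succ (h : AgreesTo s f g) (j : Fin n) :
    AgreesTo s (pd j.succ f) (pd j.succ g) := fun ν hν => by
  rw [pd, pd, h _ (by simpa using hν)]

theorem AgreesTo.add (h : AgreesTo s f g) (h' : AgreesTo s f' g') :
    AgreesTo s (f + f') (g + g') := fun ν hν => by
  change f ν + f' ν = g ν + g' ν; rw [h ν hν, h' ν hν]

theorem AgreesTo.sub (h : AgreesTo s f g) (h' : AgreesTo s f' g') :
    AgreesTo s (f - f') (g - g') := fun ν hν => by
  change f ν - f' ν = g ν - g' ν; rw [h ν hν, h' ν hν]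

theorem AgreesTo.sum {ι : Type*} {S : Finset ι} {f g : ι → MvPowerSeries (Fin (n + 1)) X}
    (h : ∀ i ∈ S, AgreesTo s (f i) (g i)) : AgreesTo s (∑ i ∈ S, f i) (∑ i ∈ S, g i) := by
  induction S using Finset.cons_induction with
  | empty => exact fun _ _ => rfl
  | cons a S ha ih =>
    rw [Finset.sum_cons, Finset.sum_cons]
    exact (h a (Finset.mem_cons_self a S)).add (ih fun i hi => h i (Finset.mem_cons_of_mem hi))

variable (k : Type*) [Field k] [Module k X]

/-- The integral equation of the flow `∂f/∂t₀ = F f` with the initial value `f₀`. -/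
def picard (F : MvPowerSeries (Fin (n + 1)) X → MvPowerSeries (Fin (n + 1)) X)
    (f₀ : MvPowerSeries (Fin n) X) (f : MvPowerSeries (Fin (n + 1)) X) :
    MvPowerSeries (Fin (n + 1)) X :=
  fun ν => if ν 0 = 0 then f₀ (Finsupp.tail ν) else
    (ν 0 : k)⁻¹ • F f (ν - Finsupp.single 0 1)

variable {F : MvPowerSeries (Fin (n + 1)) X → MvPowerSeries (Fin (n + 1)) X}
  {f₀ : MvPowerSeries (Fin n) X}

theorem picard_add_single (μ : Fin (n + 1) →₀ ℕ) :
    picard k F f₀ f (μ + Finsupp.single 0 1) = ((μ 0 + 1 : ℕ) : k)⁻¹ • F f μ := by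
  simp [picard]

/-- Integration by `t₀` gains one order, so `picard` is a contraction for the `t₀`-adic topology. -/
theorem AgreesTo.picard (hF : ∀ s f g, AgreesTo s f g → AgreesTo s (F f) (F g))
    (h : AgreesTo s f g) : AgreesTo (s + 1) (picard k F f₀ f) (picard k F f₀ g) := fun ν hν => by
  by_cases h0 : ν 0 = 0
  · simp [AInf.picard, h0]
  · obtain ⟨μ, rfl, hμ⟩ := exists_eq_add_single h0
    rw [picard_add_single, picard_add_single, hF s f g h μ (by omega)]

variable [CharZero k]
include k

theorem picard_eq_self_iff : picard k F f₀ f = f ↔ atZero f = f₀ ∧ pd 0 f = F f := by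
  have hne : ∀ μ : Fin (n + 1) →₀ ℕ, ((μ 0 + 1 : ℕ) : k) ≠ 0 := fun μ =>
    Nat.cast_ne_zero.2 (Nat.succ_ne_zero (μ 0))
  constructor
  · intro h
    refine ⟨funext fun ν => ?_, funext fun μ => ?_⟩
    · rw [atZero, ← h]
      simp [picard]
    · conv_lhs => rw [← h]
      rw [pd, picard_add_single, ← Nat.cast_smul_eq_nsmul k, smul_smul, mul_inv_cancel₀ (hne μ),
        one_smul]
  · rintro ⟨h0, h1⟩
    funext ν
    by_cases hν : ν 0 = 0
    · rw [picard, if_pos hν, ← h0, atZero, cons_zero_tail hν]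
    · obtain ⟨μ, rfl, -⟩ := exists_eq_add_single hν
      rw [picard_add_single, ← h1, pd, ← Nat.cast_smul_eq_nsmul k, smul_smul,
        inv_mul_cancel₀ (hne μ), one_smul]

theorem flow_unique (hF : ∀ s f g, AgreesTo s f g → AgreesTo s (F f) (F g))
    (h0 : atZero f = atZero g) (hf : pd 0 f = F f) (hg : pd 0 g = F g) : f = g := by
  have h1 := (picard_eq_self_iff k).2 ⟨h0, hf⟩
  have h2 := (picard_eq_self_iff k).2 ⟨rfl, hg⟩
  refine eq_of_agreesTo fun s => ?_
  induction s with
  | zero => exact fun ν hν => absurd hν (Nat.not_lt_zero _)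
  | succ s ih =>
    rw [← h1, ← h2]
    exact ih.picard k hF

theorem exists_flow (hF : ∀ s f g, AgreesTo s f g → AgreesTo s (F f) (F g))
    (f₀ : MvPowerSeries (Fin n) X) : ∃ f, atZero f = f₀ ∧ pd 0 f = F f := by
  have h1 : ∀ s, AgreesTo s ((picard k F f₀)^[s] 0) ((picard k F f₀)^[s + 1] 0) := fun s => by
    induction s with
    | zero => exact fun ν hν => absurd hν (Nat.not_lt_zero _)
    | succ s ih =>
      rw [Function.iterate_succ_apply', Function.iterate_succ_apply']
      exact ih.picard k hF
  have h2 : ∀ s t, s ≤ t → AgreesTo s ((picard k F f₀)^[s] 0) ((picard k F f₀)^[t] 0) :=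
    fun s t hst => by
    induction t, hst using Nat.le_induction with
    | base => exact fun _ _ => rfl
    | succ t hst ih => exact fun ν hν => (ih ν hν).trans (h1 t ν (by omega))
  -- The coefficient at `ν` no longer changes after `ν 0 + 1` iterations, because the iterates agree
  -- from the `s`-th one on in all orders less than `s`.
  refine ⟨fun ν => (picard k F f₀)^[ν 0 + 1] 0 ν, (picard_eq_self_iff k).1 ?_⟩
  have h3 : ∀ s, AgreesTo s (fun ν => (picard k F f₀)^[ν 0 + 1] 0 ν) ((picard k F f₀)^[s] 0) :=
    fun s ν hν => h2 _ s hν ν (Nat.lt_succ_self _)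
  refine eq_of_agreesTo fun s ν hν => ?_
  rw [(h3 s).picard k hF ν (by omega), ← Function.iterate_succ_apply' (picard k F f₀)]
  exact (h3 (s + 1) ν (by omega)).symm

/-- Induction on the order in `t₀` for the coefficients of a solution of a flow. -/
theorem flow_induction (hf : pd 0 f = F f) {P : (Fin (n + 1) →₀ ℕ) → X → Prop}
    (hP : ∀ ν x (c : k), P ν x → P ν (c • x)) (h0 : ∀ ν, P (Finsupp.cons 0 ν) (atZero f ν))
    (h : ∀ s, (∀ ν : Fin (n + 1) →₀ ℕ, ν 0 < s → P ν (f ν)) →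
      ∀ μ : Fin (n + 1) →₀ ℕ, μ 0 < s → P (μ + Finsupp.single 0 1) (F f μ)) (ν) : P ν (f ν) := by
  have h1 := (picard_eq_self_iff k).2 ⟨rfl, hf⟩
  suffices ∀ s, ∀ ν : Fin (n + 1) →₀ ℕ, ν 0 < s → P ν (f ν) from this _ ν (Nat.lt_succ_self _)
  intro s
  induction s with
  | zero => exact fun ν hν => absurd hν (Nat.not_lt_zero _)
  | succ s ih =>
    intro ν hν
    by_cases hz : ν 0 = 0
    · rw [← cons_zero_tail hz]; exact h0 _
    · obtain ⟨μ, rfl, hμ⟩ := exists_eq_add_single hz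
      rw [← h1, picard_add_single]
      exact hP _ _ _ (h s ih μ (by omega))

end Module

end Flows

/-! ### Series of operators acting on chains and functionals -/

section Actions

open Finset.HasAntidiagonal (antidiagonal mem_antidiagonal)

variable {k V : Type*} [Field k] [AddCommGroup V] [Module k V] {N : ℕ}

theorem isBiadditive_apply :
    IsBiadditive (fun (f : Module.End k (Chain k V)) (x : Chain k V) => f x) :=
  ⟨fun _ _ _ => rfl, fun f => map_add f⟩

theorem isBiadditive_dual_comp :
    IsBiadditive (fun (S : Module.Dual k (Chain k V)) (f : Module.End k (Chain k V)) => S ∘ₗ f) :=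
  ⟨fun _ _ _ => LinearMap.add_comp .., fun _ _ _ => LinearMap.comp_add ..⟩

theorem isBiadditive_applyS : IsBiadditive (applyS (k := k) (V := V) (N := N)) :=
  isBiadditive_apply.conv

theorem isBiadditive_dualS : IsBiadditive (dualS (k := k) (V := V) (N := N)) :=
  isBiadditive_dual_comp.conv

variable (U W : MvPowerSeries (Fin N) (Module.End k (Chain k V)))

theorem applyS_mul (α : MvPowerSeries (Fin N) (Chain k V)) :
    applyS (U * W) α = applyS U (applyS W α) := by
  have h1 : applyS U (applyS W α) = conv₃ (fun f g x => f (g x)) U W α :=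
    conv_conv_right _ _ _ isBiadditive_apply _
  have h2 : applyS (U * W) α = conv₃ (fun f g x => (f * g) x) U W α := by
    rw [mul_eq_conv]
    exact conv_conv_left _ _ _ isBiadditive_apply _
  rw [h1, h2]
  rfl

theorem dualS_mul (S : MvPowerSeries (Fin N) (Module.Dual k (Chain k V))) :
    dualS S (U * W) = dualS (dualS S U) W := by
  have h1 : dualS (dualS S U) W = conv₃ (fun S f g => (S ∘ₗ f) ∘ₗ g) S U W :=
    conv_conv_left _ _ _ isBiadditive_dual_comp _
  have h2 : dualS S (U * W) = conv₃ (fun S f g => S ∘ₗ (f * g)) S U W := by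
    rw [mul_eq_conv]
    exact conv_conv_right _ _ _ isBiadditive_dual_comp _
  rw [h1, h2]
  rfl

theorem applyS_sub_left (α : MvPowerSeries (Fin N) (Chain k V)) :
    applyS (U - W) α = applyS U α - applyS W α := by
  rw [eq_sub_iff_add_eq, ← isBiadditive_applyS.add_left, sub_add_cancel]

theorem applyS_sub_right (α β : MvPowerSeries (Fin N) (Chain k V)) :
    applyS U (α - β) = applyS U α - applyS U β := by
  rw [eq_sub_iff_add_eq, ← isBiadditive_applyS.add_right, sub_add_cancel]

theorem dualS_sub_right (S : MvPowerSeries (Fin N) (Module.Dual k (Chain k V))) :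
    dualS S (U - W) = dualS S U - dualS S W := by
  rw [eq_sub_iff_add_eq, ← isBiadditive_dualS.add_right, sub_add_cancel]

variable {𝒱 : ℤ → Submodule k V}

theorem IsHomDual.comp {q r : ℤ} {S : Module.Dual k (Chain k V)} (hS : IsHomDual 𝒱 q S)
    {f : Module.End k (Chain k V)} (hf : IsHomOp 𝒱 r f) : IsHomDual 𝒱 (q + r) (S ∘ₗ f) :=
  fun t ht x hx => hS (t + r) (by omega) _ (hf t x hx)

theorem IsHomDual.add {q : ℤ} {S R : Module.Dual k (Chain k V)} (hS : IsHomDual 𝒱 q S)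
    (hR : IsHomDual 𝒱 q R) : IsHomDual 𝒱 q (S + R) := fun t ht x hx => by
  rw [LinearMap.add_apply, hS t ht x hx, hR t ht x hx, add_zero]

theorem IsHomDual.smul {q : ℤ} {S : Module.Dual k (Chain k V)} (hS : IsHomDual 𝒱 q S) (c : k) :
    IsHomDual 𝒱 q (c • S) := fun t ht x hx => by
  rw [LinearMap.smul_apply, hS t ht x hx, smul_zero]

theorem isHomDual_zero {q : ℤ} : IsHomDual 𝒱 q 0 := fun _ _ _ _ => rfl

theorem IsHomDual.sum {q : ℤ} {ι : Type*} {f : ι → Module.Dual k (Chain k V)} {S : Finset ι}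
    (h : ∀ i ∈ S, IsHomDual 𝒱 q (f i)) : IsHomDual 𝒱 q (∑ i ∈ S, f i) :=
  Finset.sum_induction _ _ (fun _ _ => IsHomDual.add) isHomDual_zero h

end Actions

/-! ### Linear flows preserve cycles, cocycles and degrees -/

section LinearFlows

open Finset.HasAntidiagonal (antidiagonal mem_antidiagonal)

variable {k V : Type*} [Field k] [CharZero k] [AddCommGroup V] [Module k V]
variable {𝒱 : ℤ → Submodule k V} {n : ℕ} {d : Fin n → ℤ} {p q : ℤ}
  {U : Fin n → MvPowerSeries (Fin (n + 1)) (Module.End k (Chain k V))}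
  {D W : MvPowerSeries (Fin (n + 1)) (Module.End k (Chain k V))}

variable (U W) in
/-- The right hand side of a linear flow on chains. -/
def chainField (α : MvPowerSeries (Fin (n + 1)) (Chain k V)) :
    MvPowerSeries (Fin (n + 1)) (Chain k V) :=
  ∑ j : Fin n, applyS (U j) (pd j.succ α) - applyS W α

variable (U W) in
/-- The right hand side of a linear flow on functionals. -/
def dualField (S : MvPowerSeries (Fin (n + 1)) (Module.Dual k (Chain k V))) :
    MvPowerSeries (Fin (n + 1)) (Module.Dual k (Chain k V)) :=
  ∑ j : Fin n, dualS (pd j.succ S) (U j) + dualS S W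

omit [CharZero k] in
theorem AgreesTo.chainField (s : ℕ) (α β : MvPowerSeries (Fin (n + 1)) (Chain k V))
    (h : AgreesTo s α β) : AgreesTo s (chainField U W α) (chainField U W β) :=
  (AgreesTo.sum fun j _ => (h.pd_succ j).conv_right _ _).sub (h.conv_right _ _)

omit [CharZero k] in
theorem AgreesTo.dualField (s : ℕ) (S R : MvPowerSeries (Fin (n + 1)) (Module.Dual k (Chain k V)))
    (h : AgreesTo s S R) : AgreesTo s (dualField U W S) (dualField U W R) :=
  (AgreesTo.sum fun j _ => (h.pd_succ j).conv_left _ _).add (h.conv_left _ _)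

/-- If `[D, -]` intertwines a flow on chains with itself, then the flow preserves the kernel
of `D`. -/
theorem applyS_eq_zero_of_flow (hU : ∀ j, Commute D (U j))
    (hW : pd 0 D = D * W - W * D + ∑ j : Fin n, U j * pd j.succ D)
    {α : MvPowerSeries (Fin (n + 1)) (Chain k V)} (hα : pd 0 α = chainField U W α)
    (h0 : applyS (atZero D) (atZero α) = 0) : applyS D α = 0 := by
  have hb := isBiadditive_applyS (k := k) (V := V) (N := n + 1)
  have hpd : ∀ j, pd j (applyS D α) = applyS (pd j D) α + applyS D (pd j α) := fun j =>
    pd_conv isBiadditive_apply _ _ _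
  refine flow_unique k (F := chainField U W) AgreesTo.chainField ?_ ?_ ?_
  · rw [applyS, atZero_conv]
    exact h0
  -- In `(∂_0 D) α + D ∂_0 α` the terms `D W α` cancel, and as `D` commutes with `U_j`, the terms
  -- `U_j (∂_j D) α` and `D U_j ∂_j α` combine to `U_j ∂_j (D α)`.
  · rw [hpd, hW, hα, chainField, chainField, hb.add_left, applyS_sub_left, applyS_sub_right,
      hb.sum_left, hb.sum_right]
    simp only [hpd, hb.add_right, Finset.sum_add_distrib, ← applyS_mul, (hU _).eq]
    abel
  · have : chainField U W 0 = 0 := by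
      simp only [chainField, pd_zero, hb.zero_right, Finset.sum_const_zero, sub_zero]
    rw [this, pd_zero]

theorem dualS_eq_zero_of_flow (hU : ∀ j, Commute D (U j))
    (hW : pd 0 D = D * W - W * D + ∑ j : Fin n, pd j.succ D * U j)
    {S : MvPowerSeries (Fin (n + 1)) (Module.Dual k (Chain k V))} (hS : pd 0 S = dualField U W S)
    (h0 : dualS (atZero S) (atZero D) = 0) : dualS S D = 0 := by
  have hb := isBiadditive_dualS (k := k) (V := V) (N := n + 1)
  have hpd : ∀ j, pd j (dualS S D) = dualS (pd j S) D + dualS S (pd j D) := fun j =>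
    pd_conv isBiadditive_dual_comp _ _ _
  refine flow_unique k (F := dualField U W) AgreesTo.dualField ?_ ?_ ?_
  · rw [dualS, atZero_conv]
    exact h0
  -- Here the terms `S W D` cancel, and `(∂_j S) U_j D + S (∂_j D) U_j = ∂_j (S D) U_j`.
  · rw [hpd, hW, hS, dualField, dualField, hb.add_left, hb.add_right, dualS_sub_right,
      hb.sum_left, hb.sum_right]
    simp only [hpd, hb.add_left, Finset.sum_add_distrib, ← dualS_mul, (hU _).eq]
    abel
  · have : dualField U W 0 = 0 := by
      simp only [dualField, pd_zero, hb.zero_left, Finset.sum_const_zero, add_zero]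
    rw [this, pd_zero]

/-- `U_j` has degree `p - 1 + d j` and `∂_j` has degree `-d j`, so the right hand side of the flow
shifts the degree by `p - 1`, as does `∂_0`. -/
theorem isHomChainS_of_flow (hU : ∀ j, IsHomOpS 𝒱 (Fin.cons (1 - p) d) (p - 1 + d j) (U j))
    (hW : IsHomOpS 𝒱 (Fin.cons (1 - p) d) (p - 1) W)
    {α : MvPowerSeries (Fin (n + 1)) (Chain k V)} (hα : pd 0 α = chainField U W α)
    (h0 : IsHomChainS 𝒱 d q (atZero α)) : IsHomChainS 𝒱 (Fin.cons (1 - p) d) q α := by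
  refine flow_induction k hα (P := fun ν x => x ∈ chainDeg 𝒱 (q - wt (Fin.cons (1 - p) d) ν))
    (fun ν x c hx => Submodule.smul_mem _ _ hx) (fun ν => ?_) fun s hs μ hμ => ?_
  · rw [wt_cons _ (Finsupp.cons_zero ..), Finsupp.tail_cons]
    exact h0 ν
  · have e0 : wt (Fin.cons (1 - p) d) (μ + Finsupp.single 0 1) =
        wt (Fin.cons (1 - p) d) μ + (1 - p) := by rw [wt_add, wt_single, Fin.cons_zero]
    rw [e0]
    have h1 : chainField U W α μ =
        (∑ j : Fin n, applyS (U j) (pd j.succ α) μ) - applyS W α μ :=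
      congrArg (· - applyS W α μ) (Finset.sum_apply ..)
    rw [h1]
    refine sub_mem (sum_mem fun j _ => sum_mem fun e he => ?_) (sum_mem fun e he => ?_)
    · have h2 := hU j e.1 _ _ (hs (e.2 + Finsupp.single j.succ 1)
        (by have := snd_zero_le he; simp; omega))
      rw [← mem_antidiagonal.1 he, wt_add]
      rw [wt_add, wt_single, Fin.cons_succ] at h2
      have h3 := nsmul_mem h2 (e.2 j.succ + 1)
      rw [← map_nsmul] at h3
      convert h3 using 2
      · ring
      · rfl
    · have h2 := hW e.1 _ _ (hs e.2 ((snd_zero_le he).trans_lt hμ))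
      rw [← mem_antidiagonal.1 he, wt_add]
      convert h2 using 2
      ring

theorem isHomDualS_of_flow (hU : ∀ j, IsHomOpS 𝒱 (Fin.cons (1 - p) d) (p - 1 + d j) (U j))
    (hW : IsHomOpS 𝒱 (Fin.cons (1 - p) d) (p - 1) W)
    {S : MvPowerSeries (Fin (n + 1)) (Module.Dual k (Chain k V))} (hS : pd 0 S = dualField U W S)
    (h0 : IsHomDualS 𝒱 d q (atZero S)) : IsHomDualS 𝒱 (Fin.cons (1 - p) d) q S := by
  refine flow_induction k hS (P := fun ν x => IsHomDual 𝒱 (q - wt (Fin.cons (1 - p) d) ν) x)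
    (fun ν x c hx => hx.smul c) (fun ν => ?_) fun s hs μ hμ => ?_
  · rw [wt_cons _ (Finsupp.cons_zero ..), Finsupp.tail_cons]
    exact h0 ν
  · have e0 : wt (Fin.cons (1 - p) d) (μ + Finsupp.single 0 1) =
        wt (Fin.cons (1 - p) d) μ + (1 - p) := by rw [wt_add, wt_single, Fin.cons_zero]
    rw [e0]
    have h1 : dualField U W S μ =
        (∑ j : Fin n, dualS (pd j.succ S) (U j) μ) + dualS S W μ :=
      congrArg (· + dualS S W μ) (Finset.sum_apply ..)
    rw [h1]
    refine (IsHomDual.sum fun j _ => IsHomDual.sum fun e he => ?_).add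
      (IsHomDual.sum fun e he => ?_)
    · have h2 := ((hs (e.1 + Finsupp.single j.succ 1)
        (by have := fst_zero_le he; simp; omega)).smul ((e.1 j.succ + 1 : ℕ) : k)).comp (hU j e.2)
      rw [Nat.cast_smul_eq_nsmul] at h2
      rw [← mem_antidiagonal.1 he, wt_add]
      rw [wt_add, wt_single, Fin.cons_succ] at h2
      convert h2 using 1
      · ring
      · rfl
    · have h2 := (hs e.1 ((fst_zero_le he).trans_lt hμ)).comp (hW e.2)
      rw [← mem_antidiagonal.1 he, wt_add]
      convert h2 using 1
      ring

end LinearFlows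

end AInf

end

/-! ### The theorem -/

theorem theorem7p1 {k V : Type*} [Field k] [CharZero k] [AddCommGroup V] [Module k V]
    (𝒱 : ℤ → Submodule k V) [DirectSum.Decomposition 𝒱]
    (n : ℕ) (d : Fin n → ℤ) (hd : ∀ i, Even (d i))
    (m : MvPowerSeries (Fin n) (Cochain k V)) (hm : IsAInfFamily 𝒱 d m)
    (p : ℤ) (hp : Even (1 - p)) (L : ℕ)
    (c : (l : ℕ) → (Fin (l + 1) → Fin n) → MvPowerSeries (Fin n) k) (hc : IsHomPoly d p L c)
    (m' : MvPowerSeries (Fin (n + 1)) (Cochain k V))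
    (hm' : IsInnerDeformation 𝒱 d L c m m') :
    IsAInfFamily 𝒱 (Fin.cons (1 - p) d) m' ∧
    ((∃ W, IsChainW 𝒱 d p L c m' W) ∧
      ∀ W, IsChainW 𝒱 d p L c m' W →
        ∀ α : MvPowerSeries (Fin n) (Chain k V), IsCycle 𝒱 m α →
          ∃ α' : MvPowerSeries (Fin (n + 1)) (Chain k V),
            (atZero α' = α ∧ ChainFlow 𝒱 d L c m' W α') ∧
            (∀ β : MvPowerSeries (Fin (n + 1)) (Chain k V),
              atZero β = α ∧ ChainFlow 𝒱 d L c m' W β → β = α') ∧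
            IsCycle 𝒱 m' α' ∧
            ∀ q : ℤ, IsHomChainS 𝒱 d q α → IsHomChainS 𝒱 (Fin.cons (1 - p) d) q α') ∧
    ((∃ W, IsCochainW 𝒱 d p L c m' W) ∧
      ∀ W, IsCochainW 𝒱 d p L c m' W →
        ∀ S : MvPowerSeries (Fin n) (Module.Dual k (Chain k V)), IsCocycle 𝒱 m S →
          ∃ S' : MvPowerSeries (Fin (n + 1)) (Module.Dual k (Chain k V)),
            (atZero S' = S ∧ CochainFlow 𝒱 d L c m' W S') ∧
            (∀ R : MvPowerSeries (Fin (n + 1)) (Module.Dual k (Chain k V)),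
              atZero R = S ∧ CochainFlow 𝒱 d L c m' W R → R = S') ∧
            IsCocycle 𝒱 m' S' ∧
            ∀ q : ℤ, IsHomDualS 𝒱 d q S → IsHomDualS 𝒱 (Fin.cons (1 - p) d) q S') := by
  have hm'' := hm'.isAInfFamily hd hp hc hm
  have hp' : Odd p := by simpa using odd_one.sub_even hp
  -- With `hD` and `hL` the identities for `W` become evolution equations of `L_{m'}` itself, in the
  -- form required for linear flows.
  have hD : pd 0 (lieS 𝒱 1 m') = lieS 𝒱 p (cupPoly 𝒱 d L c m') := by
    rw [pd_lieS, hm'.flow, lieS_odd hp']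
  have hL : ∀ j, lieS 𝒱 (1 - d j) (pd j.succ m') = pd j.succ (lieS 𝒱 1 m') := fun j => by
    rw [pd_lieS, lieS_odd (odd_one.sub_even (hd j))]
  have h0 : atZero (lieS 𝒱 1 m') = lieS 𝒱 1 m := by
    rw [← hm'.initial]; rfl
  have hV := lieS_commute_flowV (L := L) (c := c) hd hp hm''
  have hV' := isHomOpS_flowV hd hm'' hc
  refine ⟨hm'', ⟨exists_isChainW hd hp hm'' hc, fun W hW α hα => ?_⟩,
    exists_isCochainW hd hp hm'' hc, fun W hW S hS => ?_⟩
  · obtain ⟨α', h1, h2⟩ := exists_flow k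
      (AgreesTo.chainField (U := flowV 𝒱 d L c m') (W := W)) α
    have hW' := hW.identity
    simp only [hL] at hW'
    refine ⟨α', ⟨h1, h2⟩, fun β hβ => flow_unique k AgreesTo.chainField
      (hβ.1.trans h1.symm) hβ.2 h2, applyS_eq_zero_of_flow hV (hD.trans hW') h2 ?_,
      fun q hq => isHomChainS_of_flow hV' hW.degree h2 (h1.symm ▸ hq)⟩
    rw [h0, h1]
    exact hα
  · obtain ⟨S', h1, h2⟩ := exists_flow k
      (AgreesTo.dualField (U := flowV 𝒱 d L c m') (W := W)) S
    have hW' := hW.identity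
    simp only [hL] at hW'
    refine ⟨S', ⟨h1, h2⟩, fun R hR => flow_unique k AgreesTo.dualField
      (hR.1.trans h1.symm) hR.2 h2, dualS_eq_zero_of_flow hV (hD.trans hW') h2 ?_,
      fun q hq => isHomDualS_of_flow hV' hW.degree h2 (h1.symm ▸ hq)⟩
    rw [h0, h1]
    exact hS
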